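/- Let $\epsilon_0,\epsilon_r,\mu_0>0$, $c=(\epsilon_0\mu_0)^{-1/2}$, $q(e)=\epsilon_0(e+\epsilon_r e^3)$, $p=q^{-1}$ and, for $D\in\mathbb R^2$, ${\bf P}(D)=\dfrac{D}{\epsilon_0(1+\epsilon_r p^2(|D|))}$. Consider the reduced Transverse Magnetic Kerr system for $D=(D_1,D_2)$ and $H_3$, $$\partial_tD_1-\partial_2H_3=0,\quad \partial_tD_2+\partial_1H_3=0,\quad \partial_tH_3+\mu_0^{-1}\big(\partial_1{\bf P}_2(D)-\partial_2{\bf P}_1(D)\big)=0 .$$ For a unit vector $\omega\in\mathbb R^2$ put $\omega^\perp=(-\omega_2,\omega_1)$, $\omega\times D=\omega_1D_2-\omega_2D_1$. Functions of $y=x\cdot\omega$ and $t$ solve the system if and only if $u=(D,H_3)$ satisfies $$\partial_tu+\partial_yF(u)=0,\qquad F(u)=\big(H_3\,\omega^\perp,\ \mu_0^{-1}\,\omega\times{\bf P}(D)\big), \tag{1}$$ a system with eigenvalues $\lambda_1=-\lambda<\lambda_2=0<\lambda_3=\lambda$, where, with $E={\bf P}(D)$, $$\lambda^2=c^2\,\frac{1+\epsilon_r\big(|E|^2+2(E\cdot\omega)^2\big)}{(1+\epsilon_r|E|^2)(1+3\epsilon_r|E|^2)}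 .$$ Given states $u_\pm=(D_\pm,H_{3,\pm})$, the Riemann problem in the direction $\omega$ is (1) with $u(y,0)=u_-$ for $y<0$ and $u(y,0)=u_+$ for $y>0$; we look for weak solutions of the form $u=V(y/t)$. *Waves.* Let $k\in\{1,3\}$. - A *Liu $k$-shock* is a discontinuity $(u_l,u_r)$, $u_l\ne u_r$, satisfying the Rankine–Hugoniot relations with a speed $\sigma$ ($\sigma<0$ if $k=1$, $\sigma>0$ if $k=3$) and such that $\sigma\le\sigma'$ whenever $u\ne u_l$, $(u_l,u)$ satisfies the Rankine–Hugoniot relations with a speed $\sigma'$ of the same sign as $\sigma$, and $\omega\times D(u)$ lies between $\omega\times D(u_l)$ and $\omega\times D(u_r)$. - A *$k$-rarefaction* is a centred rarefaction wave $V$ of the field $k$: $\lambda_k(u_l)<\lambda_k(u_r)$; $V$ is continuous, equal to $u_l$ for $\xi\le\lambda_k(u_l)$ and to $u_r$ for $\xi\ge\lambda_k(u_r)$; and for $\xi$ in between, $\lambda_k(V(\xi))=\xi$ and $V'(\xi)$ is an eigenvector of $F'(V(\xi))$ for the eigenvalue $\xi$. - A *composite $1$-wave* is a Liu $1$-shock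 $(u_l,u_m)$ of speed $\sigma=\lambda_1(u_m)$ followed by a $1$-rarefaction from $u_m$ to $u_r$; a *composite $3$-wave* is a $3$-rarefaction from $u_l$ to $u_m$ followed by a Liu $3$-shock $(u_m,u_r)$ of speed $\sigma=\lambda_3(u_m)$. - A *$k$-wave* is a Liu $k$-shock, a $k$-rarefaction, a composite $k$-wave, or trivial (no wave). - A *stationary contact discontinuity* is a pair $(u_l,u_r)$ with $F(u_l)=F(u_r)$, that is $[H_3]=0$, $[\omega\times E]=0$ (possibly $u_l=u_r$). *Wave function.* For $d,d_0\in\mathbb R$ let $$f(d,d_0)=\frac{c^2d}{1+\epsilon_rp^2\big(\sqrt{d_0^2+d^2}\big)},\qquad S(d_1,d_2,d_0)=\sqrt{(f(d_1,d_0)-f(d_2,d_0))(d_1-d_2)},$$ let $\lambda(d,d_0)$ be the value of $\lambda$ at $D=d_0\omega+d\,\omega^\perp$ (it does not depend on $\omega$), and $R(d_1,d_2,d_0)=\int_{d_1}^{d_2}\lambda(s,d_0)\,ds$. For $d\neq0$ let $d_*(d)$ (depending also on $d_0$) be the unique real number with $d\,d_*<0$ and $\partial_1f(d_*,d_0)=\frac{f(d,d_0)-f(d_*,d_0)}{d-d_*}$,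 and put $d_*(0)=0$. Let $$\varphi(d_1,d_2,d_0)=\begin{cases}-\operatorname{sgn}(d_2)\,R(|d_1|,|d_2|,d_0)&\text{if }|d_1|\le|d_2|,\ d_1d_2\ge0,\\ \operatorname{sgn}(d_1)\,S(d_1,d_2,d_0)&\text{if } d_2 \text{ lies between } d_*(d_1)\text{ and }d_1,\\ \operatorname{sgn}(d_1)\big(S(d_1,d_*(d_1),d_0)+R(|d_*(d_1)|,|d_2|,d_0)\big)&\text{otherwise.}\end{cases}$$ **Theorem.** Let $\omega\in\mathbb R^2$, $|\omega|=1$, and let $u_\pm=(D_\pm,H_{3,\pm})$ be arbitrary states; write $D_\pm=d_0^\pm\omega+d_\pm\omega^\perp$. 1. The Riemann problem has a unique (up to equality almost everywhere) self-similar weak solution which is the superposition of a $1$-wave from $u_-$ to a state $u^{(1)}$, a stationary contact discontinuity from $u^{(1)}$ to a state $u^{(2)}$, and a $3$-wave from $u^{(2)}$ to $u_+$; the states $u^{(1)},u^{(2)}$ are unique as well. 2. The system $$f(d_1,d_0^-)=f(d_2,d_0^+),\qquad H_{3,-}+\varphi(d_-,d_1,d_0^-)=H_{3,+}-\varphi(d_+,d_2,d_0^+)$$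 has a unique solution $(d_1,d_2)\in\mathbb R^2$, and the intermediate states are $$u^{(1)}=\big(d_0^-\omega+d_1\omega^\perp,\ H_{3,-}+\varphi(d_-,d_1,d_0^-)\big),\qquad u^{(2)}=\big(d_0^+\omega+d_2\omega^\perp,\ H_{3,+}-\varphi(d_+,d_2,d_0^+)\big).$$ 3. If $\omega=(1,0)$ and $u_\pm=(0,D_{2,\pm},H_{3,\pm})$, then the solution has the form $(0,D_2,H_3)$, the stationary contact discontinuity is trivial ($u^{(1)}=u^{(2)}$), and $(D_2,H_3)$ is Liu's solution of the p-system $$\partial_tD_2+\partial_xH_3=0,\qquad \partial_tH_3+\mu_0^{-1}\partial_xp(D_2)=0$$ for the data $(D_{2,\pm},H_{3,\pm})$, i.e. its unique self-similar weak solution consisting of a wave of the first family followed by a wave of the second family, where the waves of the p-system (eigenvalues $\mp\sqrt{\mu_0^{-1}p'(D_2)}$) are Liu shocks, rarefactions, composite waves or trivial, defined as above with $D_2$ in place of $\omega\times D$. -/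

import Mathlib

open MeasureTheory Set Filter Topology

noncomputable section

namespace KerrTM

/-! ## Self-similar waves of a one-dimensional system of conservation laws

The general notions below are stated for a system `∂ₜ u + ∂_y F(u) = 0` having one characteristic
field of negative speed `-lam u` (the slow one) and one of positive speed `lam u` (the fast one),
and possibly stationary fields. The Hugoniot curves are parametrized by a coordinate `coord`. -/

section Waves

variable {E : Type*} [NormedAddCommGroup E] [NormedSpace ℝ E]

/-- The two non-stationary characteristic families. -/
inductive Family
  | slow
  | fast

/-- The sign of the characteristic speed of a family. -/
def Family.sign : Family → ℝ
  | .slow => -1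
  | .fast => 1

/-- Rankine-Hugoniot relations for a discontinuity of speed `σ` with left state `uL` and right
state `uR`. -/
def RankineHugoniot (F : E → E) (σ : ℝ) (uL uR : E) : Prop :=
  σ • (uR - uL) = F uR - F uL

/-- A nontrivial discontinuity of the family `k` with Liu's condition (E): its speed is at most
the speed of every discontinuity `(uL, u)` where `u` lies, on the same branch of the Hugoniot
set of `uL`, between `uL` and `uR`. -/
structure IsLiuShock (F : E → E) (coord : E → ℝ) (k : Family) (σ : ℝ) (uL uR : E) : Prop where
  nontrivial : uL ≠ uR
  sign : 0 < k.sign * σ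
  rankineHugoniot : RankineHugoniot F σ uL uR
  liu : ∀ (σ' : ℝ) (u : E), u ≠ uL → 0 < k.sign * σ' → RankineHugoniot F σ' uL u →
    coord u ∈ uIcc (coord uL) (coord uR) → σ ≤ σ'

/-- `W` is the profile (as a function of `ξ = y / t`) of a centred rarefaction wave of the
family `k`: in the fan, `W` follows an integral curve of the eigenvectors of `F'`, and the
eigenvalue at `W ξ` is `ξ`. -/
structure IsRarefaction (F : E → E) (lam : E → ℝ) (k : Family) (uL uR : E) (W : ℝ → E) :
    Prop where
  speed_lt : k.sign * lam uL < k.sign * lam uR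
  continuous : Continuous W
  left : ∀ ξ ≤ k.sign * lam uL, W ξ = uL
  right : ∀ ξ, k.sign * lam uR ≤ ξ → W ξ = uR
  fan : ∀ ξ ∈ Ioo (k.sign * lam uL) (k.sign * lam uR),
    k.sign * lam (W ξ) = ξ ∧
      ∃ w : E, w ≠ 0 ∧ HasDerivAt W w ξ ∧ fderiv ℝ F (W ξ) w = ξ • w

/-- `W` is the profile of a wave of the family `k` connecting `uL` (on the left) and `uR` (on the
right): no wave at all, a Liu shock, a rarefaction, or a composite wave, in which a Liu shock is
attached to a rarefaction fan of the same family, its speed being the characteristic speed at the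
common state `um`. -/
inductive IsWave (F : E → E) (lam coord : E → ℝ) : Family → E → E → (ℝ → E) → Prop
  | trivial (k : Family) (u : E) (W : ℝ → E) (h : ∀ ξ, W ξ = u) : IsWave F lam coord k u u W
  | shock (k : Family) (uL uR : E) (W : ℝ → E) (σ : ℝ) (h : IsLiuShock F coord k σ uL uR)
      (left : ∀ ξ < σ, W ξ = uL) (right : ∀ ξ, σ < ξ → W ξ = uR) :
      IsWave F lam coord k uL uR W
  | rarefaction (k : Family) (uL uR : E) (W : ℝ → E) (h : IsRarefaction F lam k uL uR W) :
      IsWave F lam coord k uL uR W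
  | slowComposite (uL um uR : E) (W Wr : ℝ → E) (σ : ℝ)
      (hs : IsLiuShock F coord .slow σ uL um) (hσ : σ = -lam um)
      (hr : IsRarefaction F lam .slow um uR Wr)
      (left : ∀ ξ < σ, W ξ = uL) (right : ∀ ξ, σ < ξ → W ξ = Wr ξ) :
      IsWave F lam coord .slow uL uR W
  | fastComposite (uL um uR : E) (W Wr : ℝ → E) (σ : ℝ)
      (hr : IsRarefaction F lam .fast uL um Wr) (hσ : σ = lam um)
      (hs : IsLiuShock F coord .fast σ um uR)
      (left : ∀ ξ < σ, W ξ = Wr ξ) (right : ∀ ξ, σ < ξ → W ξ = uR) :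
      IsWave F lam coord .fast uL uR W

/-- `V` is the superposition of a slow wave from `uL` to `u₁`, a stationary contact discontinuity
between `u₁` and `u₂`, and a fast wave from `u₂` to `uR`. -/
structure IsSuperposition (F : E → E) (lam coord : E → ℝ) (uL uR : E) (V : ℝ → E) (u₁ u₂ : E) :
    Prop where
  slow : ∃ W, IsWave F lam coord .slow uL u₁ W ∧ ∀ ξ < 0, V ξ = W ξ
  contact : RankineHugoniot F 0 u₁ u₂
  fast : ∃ W, IsWave F lam coord .fast u₂ uR W ∧ ∀ ξ, 0 < ξ → V ξ = W ξ

/-- Weak solutions `u (t, y)`, `t > 0`, of the Riemann problem `∂ₜ u + ∂_y F(u) = 0`,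
`u (0, y) = uL` for `y < 0` and `u (0, y) = uR` for `y > 0`. -/
structure IsWeakRiemannSolution (F : E → E) (uL uR : E) (u : ℝ × ℝ → E) : Prop where
  locInt : LocallyIntegrable u (volume.restrict {z | 0 < z.1})
  locInt_flux : LocallyIntegrable (fun z => F (u z)) (volume.restrict {z | 0 < z.1})
  weak : ∀ ψ : ℝ × ℝ → ℝ, ContDiff ℝ ((⊤ : ℕ∞) : WithTop ℕ∞) ψ → HasCompactSupport ψ →
    (∫ z in {z : ℝ × ℝ | 0 < z.1},
        ((fderiv ℝ ψ z (1, 0)) • u z + (fderiv ℝ ψ z (0, 1)) • F (u z))) +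
      ∫ y : ℝ, ψ (0, y) • (if y < 0 then uL else uR) = 0

/-- The self-similar function `(t, y) ↦ V (y / t)` is a weak solution of the Riemann problem, and
it is the superposition of a slow wave, a stationary contact discontinuity and a fast wave, with
intermediate states `u₁` and `u₂`. -/
structure IsRiemannSolution (F : E → E) (lam coord : E → ℝ) (uL uR : E) (V : ℝ → E) (u₁ u₂ : E) :
    Prop where
  weak : IsWeakRiemannSolution F uL uR (fun z => V (z.2 / z.1))
  superposition : IsSuperposition F lam coord uL uR V u₁ u₂

end Waves

/-! ## The Kerr medium -/

/-- The physical constants of a Kerr medium. -/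
structure Medium where
  eps0 : ℝ
  epsr : ℝ
  mu0 : ℝ
  eps0_pos : 0 < eps0
  epsr_pos : 0 < epsr
  mu0_pos : 0 < mu0

namespace Medium

variable (M : Medium)

/-- The light velocity. -/
def c : ℝ := (Real.sqrt (M.eps0 * M.mu0))⁻¹

/-- `q(e) = ε₀ (e + ε_r e³)`. -/
def q (e : ℝ) : ℝ := M.eps0 * (e + M.epsr * e ^ 3)

theorem q_bijective : Function.Bijective M.q := by
  have h0 := M.eps0_pos
  have hr := M.epsr_pos
  have hmono : StrictMono M.q := by
    intro a b hab
    have h3 : a ^ 3 < b ^ 3 := (Odd.strictMono_pow (by decide)) hab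
    exact mul_lt_mul_of_pos_left (add_lt_add hab (mul_lt_mul_of_pos_left h3 hr)) h0
  refine ⟨hmono.injective, Continuous.surjective ?_ ?_ ?_⟩
  · unfold q
    fun_prop
  · refine tendsto_atTop_mono' atTop ?_ (tendsto_id.const_mul_atTop h0)
    filter_upwards [eventually_ge_atTop (0 : ℝ)] with e he
    exact mul_le_mul_of_nonneg_left (le_add_of_nonneg_right (by positivity)) h0.le
  · refine tendsto_atBot_mono' atBot ?_ (tendsto_id.const_mul_atBot h0)
    filter_upwards [eventually_le_atBot (0 : ℝ)] with e he
    have h3 : e ^ 3 ≤ 0 := Odd.pow_nonpos (by decide) he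
    exact mul_le_mul_of_nonneg_left
      (add_le_of_nonpos_right (mul_nonpos_of_nonneg_of_nonpos hr.le h3)) h0.le

/-- `p = q⁻¹`. -/
def p : ℝ → ℝ := (Equiv.ofBijective M.q M.q_bijective).symm

/-- The electric field `E = P(D)` as a function of the electric displacement. -/
def P (D : EuclideanSpace ℝ (Fin 2)) : EuclideanSpace ℝ (Fin 2) :=
  (M.eps0 * (1 + M.epsr * M.p ‖D‖ ^ 2))⁻¹ • D

end Medium

/-! ## The `3 × 3` Transverse Magnetic system -/

/-- States `u = (D, H₃)`, where `D = (D₁, D₂)`. -/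
abbrev TMState := EuclideanSpace ℝ (Fin 2) × ℝ

/-- `ω × D`. -/
def cross (ω D : EuclideanSpace ℝ (Fin 2)) : ℝ := ω 0 * D 1 - ω 1 * D 0

/-- `ω · D`. -/
def dot (ω D : EuclideanSpace ℝ (Fin 2)) : ℝ := ω 0 * D 0 + ω 1 * D 1

/-- `ω^⊥ = (-ω₂, ω₁)`. -/
def perp (ω : EuclideanSpace ℝ (Fin 2)) : EuclideanSpace ℝ (Fin 2) := !₂[-ω 1, ω 0]

namespace Medium

variable (M : Medium)

/-- The flux in the direction `x₁` of the system
`∂ₜD₁ - ∂₂H₃ = 0`, `∂ₜD₂ + ∂₁H₃ = 0`, `∂ₜH₃ + μ₀⁻¹ (∂₁ P₂(D) - ∂₂ P₁(D)) = 0`. -/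
def flux₁ (u : TMState) : TMState := (!₂[0, u.2], M.mu0⁻¹ * M.P u.1 1)

/-- The flux in the direction `x₂` of the same system. -/
def flux₂ (u : TMState) : TMState := (!₂[-u.2, 0], -(M.mu0⁻¹ * M.P u.1 0))

/-- The flux in the direction `ω`: plane waves depending on `y = x · ω` and `t` satisfy
`∂ₜu + ∂_y F_ω(u) = 0`. -/
def flux (ω : EuclideanSpace ℝ (Fin 2)) (u : TMState) : TMState :=
  ω 0 • M.flux₁ u + ω 1 • M.flux₂ u

/-- The positive eigenvalue `λ` of the system in the direction `ω`; the eigenvalues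
are `-λ < 0 < λ`. -/
def charSpeed (ω : EuclideanSpace ℝ (Fin 2)) (u : TMState) : ℝ :=
  Real.sqrt (M.c ^ 2 * (1 + M.epsr * (‖M.P u.1‖ ^ 2 + 2 * dot ω (M.P u.1) ^ 2)) /
    ((1 + M.epsr * ‖M.P u.1‖ ^ 2) * (1 + 3 * M.epsr * ‖M.P u.1‖ ^ 2)))

/-- Solutions of the Riemann problem of the Transverse Magnetic system in the direction `ω` that
are superpositions of a 1-wave, a stationary contact discontinuity and a 3-wave. -/
def IsTMSolution (ω : EuclideanSpace ℝ (Fin 2)) (uL uR : TMState) (V : ℝ → TMState)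
    (u₁ u₂ : TMState) : Prop :=
  IsRiemannSolution (M.flux ω) (M.charSpeed ω) (fun u => cross ω u.1) uL uR V u₁ u₂

/-! ### The wave function -/

/-- `f(d, d₀) = c² d / (1 + ε_r p²(√(d₀² + d²)))`. -/
def f (d d₀ : ℝ) : ℝ := M.c ^ 2 * d / (1 + M.epsr * M.p (Real.sqrt (d₀ ^ 2 + d ^ 2)) ^ 2)

/-- `|E| = p(√(d₀² + d²))`. -/
def absE (d d₀ : ℝ) : ℝ := M.p (Real.sqrt (d₀ ^ 2 + d ^ 2))

/-- The positive eigenvalue as a function of `d = ω × D` and `d₀ = ω · D`. -/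
def lam (d d₀ : ℝ) : ℝ :=
  Real.sqrt (M.c ^ 2 *
    (1 + M.epsr * (M.absE d d₀ ^ 2 +
      2 * (d₀ / (M.eps0 * (1 + M.epsr * M.absE d d₀ ^ 2))) ^ 2)) /
    ((1 + M.epsr * M.absE d d₀ ^ 2) * (1 + 3 * M.epsr * M.absE d d₀ ^ 2)))

/-- `S(d₁, d₂, d₀)`, the jump of `H₃` (up to sign) across a shock. -/
def S (d₁ d₂ d₀ : ℝ) : ℝ := Real.sqrt ((M.f d₁ d₀ - M.f d₂ d₀) * (d₁ - d₂))

/-- `R(d₁, d₂, d₀)`, the variation of `H₃` (up to sign) across a rarefaction. -/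
def R (d₁ d₂ d₀ : ℝ) : ℝ := ∫ s in d₁..d₂, M.lam s d₀

open Classical in
/-- `d_*(d)`: for `d ≠ 0`, the unique real of sign opposite to `d` at which the tangent to the
graph of `f(·, d₀)` passes through the point of abscissa `d`; and `d_*(0) = 0`. -/
def dStar (d d₀ : ℝ) : ℝ :=
  if h : ∃ x : ℝ, d * x < 0 ∧
      deriv (fun s => M.f s d₀) x = (M.f d d₀ - M.f x d₀) / (d - x)
  then h.choose else 0

open Classical in
/-- The wave function `φ(d₁, d₂, d₀)`. In the first case `d₁` and `d₂` have the same sign,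
unless `d₁ = 0`. -/
def waveFn (d₁ d₂ d₀ : ℝ) : ℝ :=
  if |d₁| ≤ |d₂| ∧ 0 ≤ d₁ * d₂ then -(Real.sign d₂ * M.R |d₁| |d₂| d₀)
  else if d₂ ∈ uIcc (M.dStar d₁ d₀) d₁ then Real.sign d₁ * M.S d₁ d₂ d₀
  else Real.sign d₁ *
    (M.S d₁ (M.dStar d₁ d₀) d₀ + M.R |M.dStar d₁ d₀| |d₂| d₀)

/-- The `2 × 2` algebraic system for the intermediate states, where `D_± = d₀^± ω + d_± ω^⊥`. -/
def IntermediateSystem (ω : EuclideanSpace ℝ (Fin 2)) (uL uR : TMState) (d₁ d₂ : ℝ) : Prop :=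
  M.f d₁ (dot ω uL.1) = M.f d₂ (dot ω uR.1) ∧
  uL.2 + M.waveFn (cross ω uL.1) d₁ (dot ω uL.1) =
    uR.2 - M.waveFn (cross ω uR.1) d₂ (dot ω uR.1)

/-! ### The p-system -/

/-- The flux of the p-system `∂ₜD₂ + ∂ₓH₃ = 0`, `∂ₜH₃ + μ₀⁻¹ ∂ₓ p(D₂) = 0`. -/
def pFlux (v : ℝ × ℝ) : ℝ × ℝ := (v.2, M.mu0⁻¹ * M.p v.1)

/-- The positive eigenvalue of the p-system. -/
def pSpeed (v : ℝ × ℝ) : ℝ := Real.sqrt (M.mu0⁻¹ * deriv M.p v.1)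

/-- Liu's solution of the Riemann problem for the p-system: a weak solution made of a 1-wave
followed by a 2-wave, with intermediate state `vm`. -/
def IsLiuPSolution (vL vR : ℝ × ℝ) (V : ℝ → ℝ × ℝ) (vm : ℝ × ℝ) : Prop :=
  IsRiemannSolution M.pFlux M.pSpeed Prod.fst vL vR V vm vm

end Medium

end KerrTM

end

noncomputable section
namespace KerrTM

/-! ## The constitutive law -/

/-! Waves of nonzero speed do not change ω·D. The D-component of the flux is H₃ω^⊥, so both the
Rankine-Hugoniot relations with σ ≠ 0 and the eigenvector equation with ξ ≠ 0 force ω·D to stay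
fixed (`rankineHugoniot_flux_iff`, `fderiv_flux_eq_smul`). On each side of the stationary contact
the problem is therefore the 2×2 system ∂ₜd + ∂_yH = 0, ∂ₜH + ∂_y f(d, d₀) = 0 with d₀ frozen, whose
speeds are ±√(∂₁f) = ±λ (`hasDerivAt_f`).

All depends on the shape of f(·, d₀): it is odd, increasing and onto, and since λ strictly decreases
in |d| (`hasDerivAt_lam`), it is strictly convex for d < 0 and strictly concave for d > 0. Shock
speeds are ± square roots of chord slopes, and Liu's condition compares chord slopes. With a single
inflection point, the states reached from d ≠ 0 by a slow Liu shock are those between d and d_*(d)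
(`liuChord_iff`), and the chord to d_*(d) is tangent there, so that this extreme shock is sonic and
can be continued by a fan. Along a slow fan |d| increases, hence d cannot cross 0, and H + ∫λ is
constant. Consequently exactly one slow wave (up to null sets) leads from a given state to a state
with prescribed d, and its jump of H is φ (`IsPlanarWave.slow_snd`, `IsPlanarWave.slow_unique`,
`exists_isPlanarWave_slow`). The reflection y ↦ -y, H ↦ -H turns these facts into facts about fast
waves.

The contact requires equality of H and of f on its two sides. Each φ(d, ·) decreases continuously
and strictly from +∞ to -∞. Expressing d₂ through d₁ by the increasing bijections f(·, d₀^±) leaves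
one scalar equation with a strictly decreasing left side, hence one solution
(`existsUnique_intermediateSystem`).

That such a superposition V(y/t) is a weak solution follows from a potential: the jump relations
make F(V) - ξV, off finitely many points, agree with a continuous primitive Φ of -V (`IsBalanced`),
and U = -tΦ(y/t) satisfies ∂_yU = V and ∂ₜU = -F(V). The weak formulation is then integration by
parts.

For d₀ = 0 one has f = μ₀⁻¹p, so the 2×2 system is the p-system, and injectivity of f(·, 0) makes
the contact trivial. -/

theorem hasDerivAt_mul_abs (y : ℝ) : HasDerivAt (fun x : ℝ => x * |x|) (2 * |y|) y := by
  rcases lt_trichotomy y 0 with hy | rfl | hy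
  · have h := (hasDerivAt_id y).mul (hasDerivAt_abs_neg hy)
    refine h.congr_deriv ?_
    rw [abs_of_neg hy]; simp; ring
  · rw [hasDerivAt_iff_tendsto_slope]
    have : Tendsto (fun x : ℝ => |x|) (𝓝[≠] 0) (𝓝 (2 * |(0 : ℝ)|)) := by
      have := (continuous_abs (G := ℝ)).tendsto 0
      simp only [abs_zero, mul_zero] at this ⊢
      exact this.mono_left nhdsWithin_le_nhds
    refine this.congr' ?_
    filter_upwards [self_mem_nhdsWithin] with x hx
    have hx : x ≠ 0 := hx
    rw [slope_def_field]; field_simp; simp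
  · have h := (hasDerivAt_id y).mul (hasDerivAt_abs_pos hy)
    refine h.congr_deriv ?_
    rw [abs_of_pos hy]; simp; ring

namespace Medium

variable (M : Medium)

theorem q_p (r : ℝ) : M.q (M.p r) = r := (Equiv.ofBijective M.q M.q_bijective).apply_symm_apply r

theorem c_sq : M.c ^ 2 = M.eps0⁻¹ * M.mu0⁻¹ := by
  have := M.eps0_pos
  have := M.mu0_pos
  rw [c, inv_pow, Real.sq_sqrt (by positivity), mul_inv]

theorem c_sq_pos : 0 < M.c ^ 2 := by
  have := M.eps0_pos
  have := M.mu0_pos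
  rw [c_sq]; positivity

/-- For `y ≥ 0`, the value of `|D|²` when `|E|² = y`. -/
def sqQ (y : ℝ) : ℝ := M.eps0 ^ 2 * (y * (1 + M.epsr * |y|) ^ 2)

/-- Squaring |D| = q(|E|) gives |D|² = ε₀² y (1 + ε_r y)² with y = |E|². Working with squares avoids
√(d₀² + d²), which is not differentiable at D = 0. The absolute value in `sqQ` makes it increasing
on the whole line, so that its inverse has a two-sided derivative even at 0. -/
theorem hasDerivAt_sqQ (y : ℝ) :
    HasDerivAt M.sqQ (M.eps0 ^ 2 * ((1 + M.epsr * |y|) * (1 + 3 * M.epsr * |y|))) y := by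
  have h := (((hasDerivAt_id y).add ((hasDerivAt_mul_abs y).const_mul (2 * M.epsr))).add
    ((hasDerivAt_pow 3 y).const_mul (M.epsr ^ 2))).const_mul (M.eps0 ^ 2)
  have h2 : M.sqQ = fun y => M.eps0 ^ 2 * ((id y + 2 * M.epsr * (y * |y|)) + M.epsr ^ 2 * y ^ 3) := by
    funext y
    simp only [sqQ, id]
    have := sq_abs y
    linear_combination (M.eps0 ^ 2 * M.epsr ^ 2 * y) * this
  rw [h2]
  refine h.congr_deriv ?_
  have := sq_abs y
  push_cast
  linear_combination (-3 * M.eps0 ^ 2 * M.epsr ^ 2) * this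

theorem strictMono_sqQ : StrictMono M.sqQ := by
  refine strictMono_of_deriv_pos fun y => ?_
  have := M.eps0_pos
  have := M.epsr_pos
  rw [(M.hasDerivAt_sqQ y).deriv]; positivity

theorem surjective_sqQ : Function.Surjective M.sqQ := by
  have h0 := M.eps0_pos
  have hr := M.epsr_pos
  have hone : ∀ y : ℝ, 1 ≤ (1 + M.epsr * |y|) ^ 2 := fun y =>
    one_le_pow₀ (le_add_of_nonneg_right (by positivity))
  refine Continuous.surjective ?_ ?_ ?_
  · exact continuous_iff_continuousAt.2 fun y => (M.hasDerivAt_sqQ y).continuousAt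
  · refine tendsto_atTop_mono' atTop ?_ (tendsto_id.const_mul_atTop (by positivity : 0 < M.eps0 ^ 2))
    filter_upwards [eventually_ge_atTop (0 : ℝ)] with e he
    exact mul_le_mul_of_nonneg_left (le_mul_of_one_le_right he (hone e)) (by positivity)
  · refine tendsto_atBot_mono' atBot ?_ (tendsto_id.const_mul_atBot (by positivity : 0 < M.eps0 ^ 2))
    filter_upwards [eventually_le_atBot (0 : ℝ)] with e he
    refine mul_le_mul_of_nonneg_left ?_ (by positivity)
    show e * _ ≤ e
    nlinarith [hone e]

/-- `sqQ` as an order isomorphism of the real line. -/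
def sqQIso : ℝ ≃o ℝ := M.strictMono_sqQ.orderIsoOfSurjective M.sqQ M.surjective_sqQ

/-- `|E|²` as a function of `|D|²`, extended to the whole line. -/
def sqE (s : ℝ) : ℝ := M.sqQIso.symm s

theorem sqQ_sqE (s : ℝ) : M.sqQ (M.sqE s) = s := M.sqQIso.apply_symm_apply s

theorem continuous_sqE : Continuous M.sqE := M.sqQIso.symm.continuous

theorem strictMono_sqE : StrictMono M.sqE := M.sqQIso.symm.strictMono

theorem tendsto_sqE : Tendsto M.sqE atTop atTop := M.sqQIso.symm.tendsto_atTop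

theorem sqE_zero : M.sqE 0 = 0 := by
  apply M.strictMono_sqQ.injective
  rw [sqQ_sqE, sqQ, zero_mul, mul_zero]

theorem sqE_nonneg {s : ℝ} (hs : 0 ≤ s) : 0 ≤ M.sqE s := by
  rw [← M.sqE_zero]; exact M.strictMono_sqE.monotone hs

/-- This rests on q(e)² = `sqQ` (e²). Since f and λ contain p only through p², they become functions
of the differentiable quantity `sqE` (d₀² + d²). -/
theorem p_sq (r : ℝ) : M.p r ^ 2 = M.sqE (r ^ 2) := by
  apply M.strictMono_sqQ.injective
  rw [sqQ_sqE]
  nth_rewrite 2 [← M.q_p r]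
  rw [sqQ, q, abs_of_nonneg (sq_nonneg _)]
  ring

theorem hasDerivAt_sqE {s : ℝ} (hs : 0 ≤ s) : HasDerivAt M.sqE
    (M.eps0 ^ 2 * ((1 + M.epsr * M.sqE s) * (1 + 3 * M.epsr * M.sqE s)))⁻¹ s := by
  have h0 := M.eps0_pos
  have hr := M.epsr_pos
  have hx := M.sqE_nonneg hs
  have h := M.hasDerivAt_sqQ (M.sqE s)
  rw [abs_of_nonneg hx] at h
  exact h.of_local_left_inverse M.continuous_sqE.continuousAt (by positivity)
    (Eventually.of_forall M.sqQ_sqE)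

theorem sqE_eq {s : ℝ} (hs : 0 ≤ s) :
    M.eps0 ^ 2 * (M.sqE s * (1 + M.epsr * M.sqE s) ^ 2) = s := by
  have h := M.sqQ_sqE s
  rwa [sqQ, abs_of_nonneg (M.sqE_nonneg hs)] at h

/-! ### The functions f and λ: f' = λ², monotonicity, behaviour at infinity -/

theorem absE_sq (d d₀ : ℝ) : M.absE d d₀ ^ 2 = M.sqE (d₀ ^ 2 + d ^ 2) := by
  rw [absE, p_sq, Real.sq_sqrt (by positivity)]

theorem f_eq (d d₀ : ℝ) : M.f d d₀ = M.c ^ 2 * d / (1 + M.epsr * M.sqE (d₀ ^ 2 + d ^ 2)) := by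
  rw [f, ← absE_sq, absE]

/-- `λ²` as a function of `|E|²` and `d₀`. -/
def lamSq (d₀ y : ℝ) : ℝ := M.c ^ 2 * (1 + M.epsr * (y +
    2 * (d₀ / (M.eps0 * (1 + M.epsr * y))) ^ 2)) / ((1 + M.epsr * y) * (1 + 3 * M.epsr * y))

theorem lam_eq (d d₀ : ℝ) : M.lam d d₀ = Real.sqrt (M.lamSq d₀ (M.sqE (d₀ ^ 2 + d ^ 2))) := by
  rw [lam, lamSq, absE_sq]

theorem sqE_arg_nonneg (d d₀ : ℝ) : 0 ≤ M.sqE (d₀ ^ 2 + d ^ 2) := M.sqE_nonneg (by positivity)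

theorem lamSq_pos (d₀ : ℝ) {y : ℝ} (hy : 0 ≤ y) : 0 < M.lamSq d₀ y := by
  have h0 := M.eps0_pos
  have hr := M.epsr_pos
  have := M.c_sq_pos
  rw [lamSq]; positivity

theorem lam_sq (d d₀ : ℝ) : M.lam d d₀ ^ 2 = M.lamSq d₀ (M.sqE (d₀ ^ 2 + d ^ 2)) := by
  rw [lam_eq, Real.sq_sqrt (M.lamSq_pos d₀ (M.sqE_arg_nonneg d d₀)).le]

theorem lam_pos (d d₀ : ℝ) : 0 < M.lam d d₀ := by
  rw [lam_eq]; exact Real.sqrt_pos.2 (M.lamSq_pos d₀ (M.sqE_arg_nonneg d d₀))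

theorem lam_neg (d d₀ : ℝ) : M.lam (-d) d₀ = M.lam d d₀ := by rw [lam_eq, lam_eq, neg_sq]

theorem lam_abs (d d₀ : ℝ) : M.lam |d| d₀ = M.lam d d₀ := by rw [lam_eq, lam_eq, sq_abs]

theorem f_neg (d d₀ : ℝ) : M.f (-d) d₀ = -M.f d d₀ := by rw [f_eq, f_eq, neg_sq]; ring

theorem f_zero (d₀ : ℝ) : M.f 0 d₀ = 0 := by rw [f_eq]; simp

theorem hasDerivAt_sqE_comp (d d₀ : ℝ) : HasDerivAt (fun d => M.sqE (d₀ ^ 2 + d ^ 2))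
    ((M.eps0 ^ 2 * ((1 + M.epsr * M.sqE (d₀ ^ 2 + d ^ 2)) *
      (1 + 3 * M.epsr * M.sqE (d₀ ^ 2 + d ^ 2))))⁻¹ * (2 * d)) d := by
  have h1 : HasDerivAt (fun d : ℝ => d₀ ^ 2 + d ^ 2) (2 * d) d := by
    simpa using (hasDerivAt_pow 2 d).const_add (d₀ ^ 2)
  exact (M.hasDerivAt_sqE (by positivity : 0 ≤ d₀ ^ 2 + d ^ 2)).comp d h1

/-- The quotient rule yields an expression in y = |E|² and d². The constitutive relation `sqE_eq`
eliminates d², and what remains is the formula for λ². -/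
theorem hasDerivAt_f (d d₀ : ℝ) : HasDerivAt (fun d => M.f d d₀) (M.lam d d₀ ^ 2) d := by
  have h0 := M.eps0_pos
  have hr := M.epsr_pos
  have hy := M.sqE_arg_nonneg d d₀
  have h := ((hasDerivAt_id d).const_mul (M.c ^ 2)).div
    (((M.hasDerivAt_sqE_comp d d₀).const_mul M.epsr).const_add 1) (by positivity)
  have he : (fun d => M.f d d₀) =
      fun d => M.c ^ 2 * id d / (1 + M.epsr * M.sqE (d₀ ^ 2 + d ^ 2)) := by
    funext x; rw [f_eq]; rfl
  rw [he]
  refine h.congr_deriv ?_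
  rw [lam_sq, lamSq]
  have hs := M.sqE_eq (by positivity : 0 ≤ d₀ ^ 2 + d ^ 2)
  set y := M.sqE (d₀ ^ 2 + d ^ 2)
  have h1 : 1 + M.epsr * y ≠ 0 := by positivity
  have h2 : 1 + 3 * M.epsr * y ≠ 0 := by positivity
  simp only [id]
  field_simp
  linear_combination (2 * M.c ^ 2 * M.epsr) * hs

/-- Splitting the fraction gives λ² = c² (1/(1 + 3ε_r y) + (2ε_r d₀²/ε₀²) / ((1 + ε_r y)³ (1 + 3ε_r
y))). The first term is strictly decreasing for y ≥ 0 and the second is nonincreasing. -/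
theorem hasDerivAt_lamSq (d₀ : ℝ) {y : ℝ} (hy : 0 ≤ y) :
    ∃ l < 0, HasDerivAt (M.lamSq d₀) l y := by
  have h0 := M.eps0_pos
  have hr := M.epsr_pos
  have hc := M.c_sq_pos
  have ha : HasDerivAt (fun y => 1 + M.epsr * y) M.epsr y := by
    simpa using ((hasDerivAt_id y).const_mul M.epsr).const_add 1
  have hb : HasDerivAt (fun y => 1 + 3 * M.epsr * y) (3 * M.epsr) y := by
    simpa using ((hasDerivAt_id y).const_mul (3 * M.epsr)).const_add 1
  have hb' := hb.inv (by positivity)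
  have hc' := ((ha.pow 3).mul hb).inv (by simp only [Pi.mul_apply, Pi.pow_apply]; positivity)
  have h := (hb'.add (hc'.const_mul (2 * M.epsr * d₀ ^ 2 / M.eps0 ^ 2))).const_mul (M.c ^ 2)
  refine ⟨_, ?_, h.congr_of_eventuallyEq ?_⟩
  · refine mul_neg_of_pos_of_neg hc (add_neg_of_neg_of_nonpos ?_ ?_)
    · exact div_neg_of_neg_of_pos (by linarith) (by positivity)
    · refine mul_nonpos_of_nonneg_of_nonpos (by positivity) (div_nonpos_of_nonpos_of_nonneg ?_ ?_)
      · rw [neg_nonpos]; simp only [Pi.pow_apply]; positivity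
      · positivity
  · have e1 : ∀ᶠ x in 𝓝 y, 1 + M.epsr * x ≠ 0 :=
      ha.continuousAt.eventually_ne (by positivity)
    have e2 : ∀ᶠ x in 𝓝 y, 1 + 3 * M.epsr * x ≠ 0 :=
      hb.continuousAt.eventually_ne (by positivity)
    filter_upwards [e1, e2] with x h1 h2
    simp only [lamSq, Pi.inv_apply, Pi.add_apply, Pi.mul_apply, Pi.pow_apply]
    field_simp
    ring

/-- λ depends on d only through y = |E|², whose derivative is a positive multiple of d. The form l *
d with l < 0 shows that f'' = (λ²)' has the sign of -d: the graph of f has its only inflection point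
at 0. -/
theorem hasDerivAt_lam (d d₀ : ℝ) : ∃ l < 0, HasDerivAt (fun d => M.lam d d₀) (l * d) d := by
  have h0 := M.eps0_pos
  have hr := M.epsr_pos
  have hy := M.sqE_arg_nonneg d d₀
  obtain ⟨l, hl, h⟩ := M.hasDerivAt_lamSq d₀ hy
  have h2 := (HasDerivAt.comp (h₂ := M.lamSq d₀) d h (M.hasDerivAt_sqE_comp d d₀)).sqrt
    (M.lamSq_pos d₀ hy).ne'
  have he : (fun d => M.lam d d₀) =
      fun d => Real.sqrt ((M.lamSq d₀ ∘ fun d => M.sqE (d₀ ^ 2 + d ^ 2)) d) := by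
    funext x; rw [lam_eq]; rfl
  rw [he]
  have hp := M.lam_pos d d₀
  rw [lam_eq] at hp
  refine ⟨l * ((M.eps0 ^ 2 * ((1 + M.epsr * M.sqE (d₀ ^ 2 + d ^ 2)) *
      (1 + 3 * M.epsr * M.sqE (d₀ ^ 2 + d ^ 2))))⁻¹ * 2) /
      (2 * Real.sqrt (M.lamSq d₀ (M.sqE (d₀ ^ 2 + d ^ 2)))), ?_, h2.congr_deriv ?_⟩
  · exact div_neg_of_neg_of_pos (mul_neg_of_neg_of_pos hl (by positivity)) (by positivity)
  · simp only [Function.comp]; ring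

theorem continuous_lam (d₀ : ℝ) : Continuous fun d => M.lam d d₀ :=
  continuous_iff_continuousAt.2 fun d => by
    obtain ⟨l, -, h⟩ := M.hasDerivAt_lam d d₀
    exact h.continuousAt

theorem continuous_f (d₀ : ℝ) : Continuous fun d => M.f d d₀ :=
  continuous_iff_continuousAt.2 fun d => (M.hasDerivAt_f d d₀).continuousAt

theorem strictAntiOn_lam (d₀ : ℝ) : StrictAntiOn (fun d => M.lam d d₀) (Ici 0) := by
  refine strictAntiOn_of_deriv_neg (convex_Ici 0) (M.continuous_lam d₀).continuousOn fun d hd => ?_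
  obtain ⟨l, hl, h⟩ := M.hasDerivAt_lam d d₀
  rw [interior_Ici] at hd
  rw [h.deriv]
  exact mul_neg_of_neg_of_pos hl hd

theorem lam_lt_lam_iff {a b : ℝ} (d₀ : ℝ) : M.lam a d₀ < M.lam b d₀ ↔ |b| < |a| := by
  rw [← M.lam_abs a, ← M.lam_abs b]
  exact (M.strictAntiOn_lam d₀).lt_iff_gt (abs_nonneg a) (abs_nonneg b)

theorem lam_eq_lam_iff {a b : ℝ} (d₀ : ℝ) : M.lam a d₀ = M.lam b d₀ ↔ |a| = |b| := by
  rw [← M.lam_abs a, ← M.lam_abs b]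
  exact (M.strictAntiOn_lam d₀).injOn.eq_iff (abs_nonneg a) (abs_nonneg b)

theorem strictMono_f (d₀ : ℝ) : StrictMono fun d => M.f d d₀ := by
  refine strictMono_of_deriv_pos fun d => ?_
  have := M.lam_pos d d₀
  rw [(M.hasDerivAt_f d d₀).deriv]; positivity

/-- By the constitutive relation, f² = c⁴ (ε₀² y - d₀²/(1 + ε_r y)²) ≥ c⁴ (ε₀² y - d₀²), and y =
|E|² tends to infinity with d. -/
theorem tendsto_f (d₀ : ℝ) : Tendsto (fun d => M.f d d₀) atTop atTop := by
  have h0 := M.eps0_pos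
  have hr := M.epsr_pos
  have hc := M.c_sq_pos
  have h1 : Tendsto (fun d : ℝ => d₀ ^ 2 + d ^ 2) atTop atTop :=
    tendsto_atTop_add_const_left _ _ (tendsto_pow_atTop two_ne_zero)
  have h2 : Tendsto (fun d : ℝ => (M.c ^ 2) ^ 2 * (M.eps0 ^ 2 * M.sqE (d₀ ^ 2 + d ^ 2) - d₀ ^ 2))
      atTop atTop := by
    refine Tendsto.const_mul_atTop (by positivity) (tendsto_atTop_add_const_right _ _ ?_)
    exact (M.tendsto_sqE.comp h1).const_mul_atTop (by positivity)
  have h3 : Tendsto (fun d => Real.sqrt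
      ((M.c ^ 2) ^ 2 * (M.eps0 ^ 2 * M.sqE (d₀ ^ 2 + d ^ 2) - d₀ ^ 2))) atTop atTop :=
    Real.tendsto_sqrt_atTop.comp h2
  refine tendsto_atTop_mono' atTop ?_ h3
  filter_upwards [eventually_ge_atTop (0 : ℝ)] with d hd
  have hy := M.sqE_arg_nonneg d d₀
  have hf : 0 ≤ M.f d d₀ := by rw [f_eq]; positivity
  refine Real.sqrt_le_iff.2 ⟨hf, ?_⟩
  have hs := M.sqE_eq (by positivity : 0 ≤ d₀ ^ 2 + d ^ 2)
  rw [f_eq]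
  set y := M.sqE (d₀ ^ 2 + d ^ 2)
  rw [div_pow, le_div_iff₀ (by positivity), mul_pow, mul_assoc]
  refine mul_le_mul_of_nonneg_left ?_ (by positivity)
  have : d₀ ^ 2 ≤ d₀ ^ 2 * (1 + M.epsr * y) ^ 2 :=
    le_mul_of_one_le_right (by positivity) (one_le_pow₀ (le_add_of_nonneg_right (by positivity)))
  nlinarith

theorem tendsto_f_atBot (d₀ : ℝ) : Tendsto (fun d => M.f d d₀) atBot atBot := by
  have h := tendsto_neg_atTop_atBot.comp ((M.tendsto_f d₀).comp tendsto_neg_atBot_atTop)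
  refine h.congr fun d => ?_
  simp [f_neg]

/-- When ω·D = 0 the field is transverse and the law reduces to the scalar one. This is the link
with the p-system. -/
theorem f_zero_right (d : ℝ) : M.f d 0 = M.mu0⁻¹ * M.p d := by
  have h0 := M.eps0_pos
  have hr := M.epsr_pos
  have hq := M.q_p d
  rw [f_eq, M.c_sq, show (0 : ℝ) ^ 2 + d ^ 2 = d ^ 2 by ring, ← p_sq]
  have h1 : 1 + M.epsr * M.p d ^ 2 ≠ 0 := by positivity
  nth_rewrite 1 [← hq]
  rw [q]
  field_simp

end Medium

namespace Medium

variable (M : Medium)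

/-! ## Chords of the graph of `f(·, d₀)` -/

/-- The slope of the chord of the graph of `f(·, d₀)` with abscissas `a` and `x`. -/
def chord (d₀ a x : ℝ) : ℝ := (M.f a d₀ - M.f x d₀) / (a - x)

/-- The function whose zeros `x ≠ a` are the abscissas of the points where the tangent passes
through the point of abscissa `a`. -/
def tangentGap (d₀ a x : ℝ) : ℝ := M.lam x d₀ ^ 2 * (a - x) - (M.f a d₀ - M.f x d₀)

theorem chord_pos (d₀ : ℝ) {a x : ℝ} (h : a ≠ x) : 0 < M.chord d₀ a x := by
  rcases lt_or_gt_of_ne h with h | h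
  · exact div_pos_of_neg_of_neg (sub_neg.2 (M.strictMono_f d₀ h)) (sub_neg.2 h)
  · exact div_pos (sub_pos.2 (M.strictMono_f d₀ h)) (sub_pos.2 h)

theorem chord_comm (d₀ a x : ℝ) : M.chord d₀ a x = M.chord d₀ x a := by
  rw [chord, chord, ← neg_sub, ← neg_sub x a, neg_div_neg_eq]

theorem chord_neg (d₀ a x : ℝ) : M.chord d₀ (-a) (-x) = M.chord d₀ a x := by
  rw [chord, chord, f_neg, f_neg, ← neg_div_neg_eq]; ring

theorem tangentGap_neg (d₀ a x : ℝ) : M.tangentGap d₀ (-a) (-x) = -M.tangentGap d₀ a x := by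
  rw [tangentGap, tangentGap, f_neg, f_neg, lam_neg]; ring

theorem exists_lam_sq_mul (d₀ : ℝ) {x y : ℝ} (h : x < y) :
    ∃ z ∈ Ioo x y, M.f y d₀ - M.f x d₀ = M.lam z d₀ ^ 2 * (y - x) := by
  obtain ⟨z, hz, h2⟩ := exists_hasDerivAt_eq_slope (fun d => M.f d d₀) _ h
    (M.continuous_f d₀).continuousOn fun z _ => M.hasDerivAt_f z d₀
  refine ⟨z, hz, ?_⟩
  rw [h2, div_mul_cancel₀ _ (sub_pos.2 h).ne']

theorem lam_sq_lt_lam_sq {a b : ℝ} (d₀ : ℝ) (h : |b| < |a|) : M.lam a d₀ ^ 2 < M.lam b d₀ ^ 2 :=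
  pow_lt_pow_left₀ ((M.lam_lt_lam_iff d₀).2 h) (M.lam_pos a d₀).le two_ne_zero

/-- By strict concavity of f on [0, ∞), the tangent at x passes above the point of abscissa a. The
mean value theorem turns this into a comparison of λ² at x and at an intermediate point. -/
theorem tangentGap_pos_of_nonneg (d₀ : ℝ) {a x : ℝ} (hx : 0 ≤ x) (h : x < a) :
    0 < M.tangentGap d₀ a x := by
  obtain ⟨z, hz, h2⟩ := M.exists_lam_sq_mul d₀ h
  rw [tangentGap, h2, ← sub_mul]
  refine mul_pos (sub_pos.2 (M.lam_sq_lt_lam_sq d₀ ?_)) (sub_pos.2 h)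
  rw [abs_of_nonneg hx, abs_of_nonneg (hx.trans hz.1.le)]
  exact hz.1

/-- The same concavity argument, with the tangency point on the outer side of a. -/
theorem tangentGap_pos_of_lt (d₀ : ℝ) {a x : ℝ} (ha : 0 ≤ a) (h : a < x) :
    0 < M.tangentGap d₀ a x := by
  obtain ⟨z, hz, h2⟩ := M.exists_lam_sq_mul d₀ h
  have h3 : M.tangentGap d₀ a x = (M.lam z d₀ ^ 2 - M.lam x d₀ ^ 2) * (x - a) := by
    rw [tangentGap]; linear_combination h2
  rw [h3]
  refine mul_pos (sub_pos.2 (M.lam_sq_lt_lam_sq d₀ ?_)) (sub_pos.2 h)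
  rw [abs_of_nonneg (ha.trans h.le), abs_of_nonneg (ha.trans hz.1.le)]
  exact hz.2

/-- Formally the derivative in x is (λ²)'(x)(a - x), which is positive for x < 0 < a. The identity
`h5` is the finite-difference version: both of its terms are positive because λ increases on (-∞,
0]. -/
theorem strictMonoOn_tangentGap (d₀ : ℝ) {a : ℝ} (ha : 0 < a) :
    StrictMonoOn (M.tangentGap d₀ a) (Iic 0) := by
  intro x hx y hy hxy
  have hx : x ≤ 0 := hx
  have hy : y ≤ 0 := hy
  obtain ⟨z, hz, h2⟩ := M.exists_lam_sq_mul d₀ hxy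
  have h3 : M.lam x d₀ ^ 2 < M.lam z d₀ ^ 2 := by
    refine M.lam_sq_lt_lam_sq d₀ ?_
    rw [abs_of_nonpos hx, abs_of_nonpos (hz.2.le.trans hy)]; linarith [hz.1]
  have h4 : M.lam x d₀ ^ 2 < M.lam y d₀ ^ 2 := by
    refine M.lam_sq_lt_lam_sq d₀ ?_
    rw [abs_of_nonpos hx, abs_of_nonpos hy]; linarith
  have h5 : M.tangentGap d₀ a y - M.tangentGap d₀ a x =
      (M.lam y d₀ ^ 2 - M.lam x d₀ ^ 2) * (a - y) + (M.lam z d₀ ^ 2 - M.lam x d₀ ^ 2) * (y - x) := by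
    rw [tangentGap, tangentGap]; linear_combination h2
  have h6 : 0 < (M.lam y d₀ ^ 2 - M.lam x d₀ ^ 2) * (a - y) :=
    mul_pos (sub_pos.2 h4) (by linarith)
  have h7 : 0 < (M.lam z d₀ ^ 2 - M.lam x d₀ ^ 2) * (y - x) :=
    mul_pos (sub_pos.2 h3) (by linarith)
  linarith

/-- By oddness of f and evenness of λ the gap at (a, -a) is -2 times the gap at (0, a). Together
with positivity at 0, this brackets the zero d_*(a) in (-a, 0). -/
theorem tangentGap_neg_self (d₀ : ℝ) {a : ℝ} (ha : 0 < a) : M.tangentGap d₀ a (-a) < 0 := by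
  have h := M.tangentGap_pos_of_lt d₀ le_rfl ha
  rw [tangentGap, f_zero] at h
  rw [tangentGap, f_neg, lam_neg]
  linarith

theorem continuous_tangentGap (d₀ a : ℝ) : Continuous (M.tangentGap d₀ a) := by
  have := M.continuous_f d₀
  have := M.continuous_lam d₀
  unfold tangentGap
  fun_prop

theorem exists_tangentGap_eq_zero (d₀ : ℝ) {a : ℝ} (ha : 0 < a) :
    ∃ x ∈ Ioo (-a) 0, M.tangentGap d₀ a x = 0 :=
  intermediate_value_Ioo (by linarith) (M.continuous_tangentGap d₀ a).continuousOn
    ⟨M.tangentGap_neg_self d₀ ha, M.tangentGap_pos_of_nonneg d₀ le_rfl ha⟩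

theorem tangentGap_eq_zero_iff (d₀ : ℝ) {a x : ℝ} (h : a ≠ x) :
    M.tangentGap d₀ a x = 0 ↔ M.chord d₀ a x = M.lam x d₀ ^ 2 := by
  rw [tangentGap, chord, div_eq_iff (sub_ne_zero.2 h), sub_eq_zero, eq_comm]

/-- Strict monotonicity of the gap leaves at most one zero of sign opposite to a, so the point
selected by choice in `dStar` is whatever zero is exhibited. Negative a is brought to positive a by
oddness. -/
theorem dStar_eq_of_tangentGap (d₀ : ℝ) {a x : ℝ} (hax : a * x < 0)
    (h : M.tangentGap d₀ a x = 0) : M.dStar a d₀ = x := by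
  have key : ∀ y : ℝ, a * y < 0 ∧
      deriv (fun s => M.f s d₀) y = (M.f a d₀ - M.f y d₀) / (a - y) → y = x := by
    rintro y ⟨hy, h2⟩
    have hne : a ≠ y := by
      rintro rfl
      exact absurd hy (not_lt.2 (mul_self_nonneg a))
    have h3 : M.tangentGap d₀ a y = 0 := by
      rw [tangentGap_eq_zero_iff M d₀ hne, chord, ← h2, (M.hasDerivAt_f y d₀).deriv]
    rcases lt_trichotomy a 0 with ha | rfl | ha
    · have hy' : 0 < y := by nlinarith
      have hx' : 0 < x := by nlinarith
      have e1 := M.tangentGap_neg d₀ a x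
      have e2 := M.tangentGap_neg d₀ a y
      rw [h, neg_zero] at e1
      rw [h3, neg_zero] at e2
      have := (M.strictMonoOn_tangentGap d₀ (neg_pos.2 ha)).injOn
        (show -y ≤ 0 by linarith) (show -x ≤ 0 by linarith) (e2.trans e1.symm)
      linarith
    · simp at hax
    · have hy' : y < 0 := by nlinarith
      have hx' : x < 0 := by nlinarith
      exact (M.strictMonoOn_tangentGap d₀ ha).injOn hy'.le hx'.le (h3.trans h.symm)
  have hne : a ≠ x := by
    rintro rfl
    exact absurd hax (not_lt.2 (mul_self_nonneg a))
  have hex : ∃ y : ℝ, a * y < 0 ∧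
      deriv (fun s => M.f s d₀) y = (M.f a d₀ - M.f y d₀) / (a - y) := by
    refine ⟨x, hax, ?_⟩
    rw [(M.hasDerivAt_f x d₀).deriv]
    exact ((M.tangentGap_eq_zero_iff d₀ hne).1 h).symm
  rw [dStar, dif_pos hex]
  exact key _ hex.choose_spec

theorem dStar_spec (d₀ : ℝ) {a : ℝ} (ha : 0 < a) :
    M.dStar a d₀ ∈ Ioo (-a) 0 ∧ M.tangentGap d₀ a (M.dStar a d₀) = 0 := by
  obtain ⟨x, hx, h⟩ := M.exists_tangentGap_eq_zero d₀ ha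
  rw [M.dStar_eq_of_tangentGap d₀ (mul_neg_of_pos_of_neg ha hx.2) h]
  exact ⟨hx, h⟩

theorem dStar_zero (d₀ : ℝ) : M.dStar 0 d₀ = 0 := by
  rw [dStar, dif_neg]
  rintro ⟨x, hx, -⟩
  simp at hx

theorem dStar_neg (d₀ a : ℝ) : M.dStar (-a) d₀ = -M.dStar a d₀ := by
  have key : ∀ b : ℝ, 0 < b → M.dStar (-b) d₀ = -M.dStar b d₀ := by
    intro b hb
    obtain ⟨h1, h2⟩ := M.dStar_spec d₀ hb
    refine M.dStar_eq_of_tangentGap d₀ ?_ ?_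
    · rw [neg_mul_neg]; exact mul_neg_of_pos_of_neg hb h1.2
    · rw [tangentGap_neg, h2, neg_zero]
  rcases lt_trichotomy a 0 with ha | rfl | ha
  · have := key (-a) (neg_pos.2 ha)
    rw [neg_neg] at this
    rw [this, neg_neg]
  · simp [dStar_zero]
  · exact key a ha

theorem tangentGap_pos (d₀ : ℝ) {a x : ℝ} (ha : 0 < a) (hx : M.dStar a d₀ < x) (hne : x ≠ a) :
    0 < M.tangentGap d₀ a x := by
  obtain ⟨h1, h2⟩ := M.dStar_spec d₀ ha
  rcases lt_or_gt_of_ne hne with h | h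
  · rcases le_or_gt 0 x with h0 | h0
    · exact M.tangentGap_pos_of_nonneg d₀ h0 h
    · rw [← h2]
      exact M.strictMonoOn_tangentGap d₀ ha h1.2.le h0.le hx
  · exact M.tangentGap_pos_of_lt d₀ ha.le h

theorem tangentGap_neg_of_lt (d₀ : ℝ) {a x : ℝ} (ha : 0 < a) (hx : x < M.dStar a d₀) :
    M.tangentGap d₀ a x < 0 := by
  obtain ⟨h1, h2⟩ := M.dStar_spec d₀ ha
  rw [← h2]
  exact M.strictMonoOn_tangentGap d₀ ha (hx.le.trans h1.2.le) h1.2.le hx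

/-- The sign of the tangent gap thus decides the monotonicity of chord slopes. For a > 0, slopes of
chords from a increase up to d_*(a), decrease between d_*(a) and a, and decrease again beyond a. -/
theorem hasDerivAt_chord (d₀ : ℝ) {a x : ℝ} (h : x ≠ a) :
    HasDerivAt (M.chord d₀ a) (-M.tangentGap d₀ a x / (a - x) ^ 2) x := by
  have h1 := ((M.hasDerivAt_f x d₀).const_sub (M.f a d₀)).div ((hasDerivAt_id x).const_sub a)
    (sub_ne_zero.2 h.symm)
  refine h1.congr_deriv ?_
  rw [tangentGap, id]; ring

theorem continuousOn_chord (d₀ : ℝ) {a : ℝ} {s : Set ℝ} (h : a ∉ s) :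
    ContinuousOn (M.chord d₀ a) s := fun x hx =>
  (M.hasDerivAt_chord d₀ fun e : x = a => h (e ▸ hx)).continuousAt.continuousWithinAt

theorem strictAntiOn_chord_Ico (d₀ : ℝ) {a : ℝ} (ha : 0 < a) :
    StrictAntiOn (M.chord d₀ a) (Ico (M.dStar a d₀) a) := by
  refine strictAntiOn_of_deriv_neg (convex_Ico _ _) (M.continuousOn_chord d₀ (by simp)) ?_
  intro x hx
  rw [interior_Ico] at hx
  rw [(M.hasDerivAt_chord d₀ hx.2.ne).deriv]
  refine div_neg_of_neg_of_pos (neg_neg_of_pos (M.tangentGap_pos d₀ ha hx.1 hx.2.ne)) ?_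
  exact pow_pos (sub_pos.2 hx.2) 2

theorem strictMonoOn_chord_Iic (d₀ : ℝ) {a : ℝ} (ha : 0 < a) :
    StrictMonoOn (M.chord d₀ a) (Iic (M.dStar a d₀)) := by
  have hs : M.dStar a d₀ < a := (M.dStar_spec d₀ ha).1.2.trans ha
  refine strictMonoOn_of_deriv_pos (convex_Iic _)
    (M.continuousOn_chord d₀ (by simpa using hs)) ?_
  intro x hx
  rw [interior_Iic] at hx
  have hxa : x < a := lt_trans hx hs
  rw [(M.hasDerivAt_chord d₀ hxa.ne).deriv]
  refine div_pos (neg_pos.2 (M.tangentGap_neg_of_lt d₀ ha hx)) ?_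
  exact pow_pos (sub_pos.2 hxa) 2

theorem strictAntiOn_chord_Ioi (d₀ : ℝ) {a : ℝ} (ha : 0 ≤ a) :
    StrictAntiOn (M.chord d₀ a) (Ioi a) := by
  refine strictAntiOn_of_deriv_neg (convex_Ioi _) (M.continuousOn_chord d₀ (by simp)) ?_
  intro x hx
  rw [interior_Ioi] at hx
  have hxa : a < x := hx
  rw [(M.hasDerivAt_chord d₀ hxa.ne').deriv]
  refine div_neg_of_neg_of_pos (neg_neg_of_pos (M.tangentGap_pos_of_lt d₀ ha hxa)) ?_
  exact sq_pos_of_ne_zero (sub_ne_zero.2 hxa.ne)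

/-- Liu's condition for a discontinuity of the first family from `a` to `b`. -/
def LiuChord (d₀ a b : ℝ) : Prop :=
  ∀ x ∈ uIcc a b, x ≠ a → M.chord d₀ a x ≤ M.chord d₀ a b

theorem liuChord_neg (d₀ : ℝ) {a b : ℝ} (h : M.LiuChord d₀ a b) : M.LiuChord d₀ (-a) (-b) := by
  intro x hx hne
  have h2 := h (-x) ?_ fun e => hne (by rw [← e, neg_neg])
  · rw [chord_neg, ← chord_neg, neg_neg]
    exact h2
  · rw [mem_uIcc] at hx ⊢
    rcases hx with hx | hx
    · right; constructor <;> linarith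
    · left; constructor <;> linarith

/-- Away from the inflection point chord slopes decrease, so the midpoint of a and b already gives a
steeper chord. -/
theorem not_liuChord_of_lt (d₀ : ℝ) {a b : ℝ} (ha : 0 ≤ a) (h : a < b) : ¬M.LiuChord d₀ a b := by
  intro hL
  have h1 : a < (a + b) / 2 := by linarith
  have h2 : (a + b) / 2 < b := by linarith
  have h3 := hL ((a + b) / 2) (by rw [uIcc_of_le h.le]; exact ⟨h1.le, h2.le⟩) h1.ne'
  exact absurd (M.strictAntiOn_chord_Ioi d₀ ha h1 h h2) (not_lt.2 h3)

/-- Between d_*(a) and a the slope is largest at the far end, as required. A b beyond d_*(a) is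
defeated by d_*(a) itself, where the slope is maximal, and a b > a is excluded by concavity. -/
theorem liuChord_iff_of_pos (d₀ : ℝ) {a b : ℝ} (ha : 0 < a) (hab : b ≠ a) :
    M.LiuChord d₀ a b ↔ b ∈ uIcc (M.dStar a d₀) a := by
  have hs : M.dStar a d₀ < a := (M.dStar_spec d₀ ha).1.2.trans ha
  rw [uIcc_of_le hs.le]
  constructor
  · intro hL
    have h1 : b < a := by
      by_contra! h
      exact M.not_liuChord_of_lt d₀ ha.le (lt_of_le_of_ne h hab.symm) hL
    refine ⟨?_, h1.le⟩
    by_contra! h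
    have h3 := hL (M.dStar a d₀) (by rw [uIcc_of_ge h1.le]; exact ⟨h.le, hs.le⟩) hs.ne
    exact absurd (M.strictMonoOn_chord_Iic d₀ ha h.le self_mem_Iic h) (not_lt.2 h3)
  · rintro ⟨h1, h2⟩ x hx hne
    rw [uIcc_of_ge h2] at hx
    have h3 : b < a := lt_of_le_of_ne h2 hab
    exact (M.strictAntiOn_chord_Ico d₀ ha).antitoneOn ⟨h1, h3⟩
      ⟨h1.trans hx.1, lt_of_le_of_ne hx.2 hne⟩ hx.1

theorem uIcc_dStar_neg (d₀ : ℝ) {a b : ℝ} :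
    -b ∈ uIcc (M.dStar (-a) d₀) (-a) ↔ b ∈ uIcc (M.dStar a d₀) a := by
  rw [dStar_neg, mem_uIcc, mem_uIcc]
  constructor
  · rintro (h | h)
    · right; constructor <;> linarith [h.1, h.2]
    · left; constructor <;> linarith [h.1, h.2]
  · rintro (h | h)
    · right; constructor <;> linarith [h.1, h.2]
    · left; constructor <;> linarith [h.1, h.2]

theorem liuChord_iff (d₀ : ℝ) {a b : ℝ} (hab : b ≠ a) :
    M.LiuChord d₀ a b ↔ a ≠ 0 ∧ b ∈ uIcc (M.dStar a d₀) a := by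
  rcases lt_trichotomy a 0 with ha | rfl | ha
  · have h1 : M.LiuChord d₀ a b ↔ M.LiuChord d₀ (-a) (-b) :=
      ⟨M.liuChord_neg d₀, fun h => by simpa using M.liuChord_neg d₀ h⟩
    rw [h1, M.liuChord_iff_of_pos d₀ (neg_pos.2 ha) (fun h => hab (neg_injective h)),
      uIcc_dStar_neg]
    exact ⟨fun h => ⟨ha.ne, h⟩, fun h => h.2⟩
  · refine ⟨fun h => ?_, fun h => absurd rfl h.1⟩
    exfalso
    rcases lt_or_gt_of_ne hab with hb | hb
    · have := M.liuChord_neg d₀ h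
      rw [neg_zero] at this
      exact M.not_liuChord_of_lt d₀ le_rfl (neg_pos.2 hb) this
    · exact M.not_liuChord_of_lt d₀ le_rfl hb h
  · rw [M.liuChord_iff_of_pos d₀ ha hab]
    exact ⟨fun h => ⟨ha.ne', h⟩, fun h => h.2⟩

theorem mul_dStar_neg (d₀ : ℝ) {a : ℝ} (ha : a ≠ 0) : a * M.dStar a d₀ < 0 := by
  have key : ∀ b : ℝ, 0 < b → b * M.dStar b d₀ < 0 := fun b hb =>
    mul_neg_of_pos_of_neg hb (M.dStar_spec d₀ hb).1.2
  rcases lt_or_gt_of_ne ha with ha | ha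
  · have := key (-a) (neg_pos.2 ha)
    rwa [dStar_neg, neg_mul_neg] at this
  · exact key a ha

/-- Tangency means that the shock from a to d_*(a) moves at the characteristic speed of its right
state, which is what a composite wave needs. -/
theorem chord_dStar (d₀ : ℝ) {a : ℝ} (ha : a ≠ 0) :
    M.chord d₀ a (M.dStar a d₀) = M.lam (M.dStar a d₀) d₀ ^ 2 := by
  have key : ∀ b : ℝ, 0 < b → M.chord d₀ b (M.dStar b d₀) = M.lam (M.dStar b d₀) d₀ ^ 2 := by
    intro b hb
    obtain ⟨h1, h2⟩ := M.dStar_spec d₀ hb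
    exact (M.tangentGap_eq_zero_iff d₀ (h1.2.trans hb).ne').1 h2
  rcases lt_or_gt_of_ne ha with ha | ha
  · have := key (-a) (neg_pos.2 ha)
    rwa [dStar_neg, chord_neg, lam_neg] at this
  · exact key a ha

/-- No other admissible shock is sonic on the right: the tangent gap does not vanish strictly beyond
d_*(a) on the side of a, except at a itself. -/
theorem eq_dStar_of_chord_eq (d₀ : ℝ) {a b : ℝ} (ha : a ≠ 0) (hab : b ≠ a)
    (hb : b ∈ uIcc (M.dStar a d₀) a) (h : M.chord d₀ a b = M.lam b d₀ ^ 2) :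
    b = M.dStar a d₀ := by
  have key : ∀ a b : ℝ, 0 < a → b ≠ a → b ∈ uIcc (M.dStar a d₀) a →
      M.chord d₀ a b = M.lam b d₀ ^ 2 → b = M.dStar a d₀ := by
    intro a b ha hab hb h
    have hs : M.dStar a d₀ < a := (M.dStar_spec d₀ ha).1.2.trans ha
    rw [uIcc_of_le hs.le] at hb
    by_contra hne
    have := M.tangentGap_pos d₀ ha (lt_of_le_of_ne hb.1 (Ne.symm hne)) hab
    rw [(M.tangentGap_eq_zero_iff d₀ hab.symm).2 h] at this
    exact this.false
  rcases lt_or_gt_of_ne ha with ha | ha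
  · have := key (-a) (-b) (neg_pos.2 ha) (fun e => hab (neg_injective e))
      ((M.uIcc_dStar_neg d₀).2 hb) (by rw [chord_neg, lam_neg, h])
    rw [dStar_neg] at this
    exact neg_injective this
  · exact key a b ha hab hb h

end Medium

namespace Medium

variable (M : Medium)

/-! ## The wave function -/

/-- The odd primitive of the positive eigenvalue. -/
def lamInt (d₀ d : ℝ) : ℝ := ∫ s in (0 : ℝ)..d, M.lam s d₀

theorem R_eq (a b d₀ : ℝ) : M.R a b d₀ = M.lamInt d₀ b - M.lamInt d₀ a :=
  (intervalIntegral.integral_interval_sub_left ((M.continuous_lam d₀).intervalIntegrable _ _)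
    ((M.continuous_lam d₀).intervalIntegrable _ _)).symm

theorem hasDerivAt_lamInt (d₀ d : ℝ) : HasDerivAt (M.lamInt d₀) (M.lam d d₀) d :=
  (M.continuous_lam d₀).integral_hasStrictDerivAt 0 d |>.hasDerivAt

theorem lamInt_zero (d₀ : ℝ) : M.lamInt d₀ 0 = 0 := intervalIntegral.integral_same

theorem lamInt_neg (d₀ d : ℝ) : M.lamInt d₀ (-d) = -M.lamInt d₀ d := by
  have h := intervalIntegral.integral_comp_neg (fun s => M.lam s d₀) (a := 0) (b := d)
  simp only [lam_neg, neg_zero] at h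
  rw [lamInt, lamInt, h, intervalIntegral.integral_symm]

theorem continuous_lamInt (d₀ : ℝ) : Continuous (M.lamInt d₀) :=
  continuous_iff_continuousAt.2 fun d => (M.hasDerivAt_lamInt d₀ d).continuousAt

theorem strictMono_lamInt (d₀ : ℝ) : StrictMono (M.lamInt d₀) :=
  strictMono_of_deriv_pos fun d => by
    rw [(M.hasDerivAt_lamInt d₀ d).deriv]; exact M.lam_pos d d₀

/-- Since λ ≤ λ(0), one has λ(0)·λ ≥ λ² = f'. Hence the primitive of λ dominates f/λ(0) on [0, ∞),
and f is unbounded. -/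
theorem tendsto_lamInt (d₀ : ℝ) : Tendsto (M.lamInt d₀) atTop atTop := by
  have h0 := M.lam_pos 0 d₀
  have hmono : Monotone fun d => M.lam 0 d₀ * M.lamInt d₀ d - M.f d d₀ := by
    refine monotone_of_hasDerivAt_nonneg
      (f' := fun d => M.lam 0 d₀ * M.lam d d₀ - M.lam d d₀ ^ 2)
      (fun d => ((M.hasDerivAt_lamInt d₀ d).const_mul _).sub (M.hasDerivAt_f d d₀)) fun d => ?_
    have h1 : M.lam d d₀ ≤ M.lam 0 d₀ := by
      by_contra! h
      have := (M.lam_lt_lam_iff d₀).1 h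
      rw [abs_zero] at this
      exact absurd this (not_lt.2 (abs_nonneg d))
    have := M.lam_pos d d₀
    show 0 ≤ _
    nlinarith
  have h := (M.tendsto_f d₀).atTop_div_const h0
  refine tendsto_atTop_mono' atTop ?_ h
  filter_upwards [eventually_ge_atTop (0 : ℝ)] with d hd
  have h2 := hmono hd
  simp only [lamInt_zero, f_zero, mul_zero, sub_zero] at h2
  rw [div_le_iff₀ h0]; linarith

theorem tendsto_lamInt_atBot (d₀ : ℝ) : Tendsto (M.lamInt d₀) atBot atBot := by
  have h := tendsto_neg_atTop_atBot.comp ((M.tendsto_lamInt d₀).comp tendsto_neg_atBot_atTop)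
  refine h.congr fun d => ?_
  simp [lamInt_neg]

theorem S_self (a d₀ : ℝ) : M.S a a d₀ = 0 := by simp [S]

theorem S_neg (a b d₀ : ℝ) : M.S (-a) (-b) d₀ = M.S a b d₀ := by
  rw [S, S, f_neg, f_neg]; ring_nf

/-- Absorbs the signs and absolute values in the definition of φ: in the fan cases φ becomes a
difference of values of the odd primitive. -/
theorem sign_mul_lamInt_abs (d₀ d : ℝ) : Real.sign d * M.lamInt d₀ |d| = M.lamInt d₀ d := by
  rcases lt_trichotomy d 0 with h | rfl | h
  · rw [Real.sign_of_neg h, abs_of_neg h, lamInt_neg]; ring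
  · simp [lamInt_zero]
  · rw [Real.sign_of_pos h, abs_of_pos h, one_mul]

theorem waveFn_neg (d₀ a b : ℝ) : M.waveFn (-a) (-b) d₀ = -M.waveFn a b d₀ := by
  unfold waveFn
  have hu := M.uIcc_dStar_neg d₀ (a := a) (b := b)
  simp only [abs_neg, neg_mul_neg, S_neg]
  split_ifs
  all_goals first
    | (exfalso; tauto)
    | (simp only [dStar_neg, S_neg, abs_neg, Real.sign_neg]; ring)

theorem waveFn_of_abs_le {d₀ a b : ℝ} (h1 : |a| ≤ |b|) (h2 : 0 ≤ a * b) :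
    M.waveFn a b d₀ = M.lamInt d₀ a - M.lamInt d₀ b := by
  rw [waveFn, if_pos ⟨h1, h2⟩, R_eq, mul_sub, sign_mul_lamInt_abs]
  rcases eq_or_ne a 0 with rfl | ha
  · simp [lamInt_zero]
  · have hb : b ≠ 0 := by
      rintro rfl
      exact ha (abs_eq_zero.1 (le_antisymm (by simpa using h1) (abs_nonneg a)))
    have : Real.sign b = Real.sign a := by
      rcases lt_or_gt_of_ne ha with ha | ha
      · rw [Real.sign_of_neg ha, Real.sign_of_neg (by
          rcases lt_or_gt_of_ne hb with h | h
          · exact h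
          · exact absurd h2 (not_le.2 (mul_neg_of_neg_of_pos ha h)))]
      · rw [Real.sign_of_pos ha, Real.sign_of_pos (by
          rcases lt_or_gt_of_ne hb with h | h
          · exact absurd h2 (not_le.2 (mul_neg_of_pos_of_neg ha h))
          · exact h)]
    rw [this, sign_mul_lamInt_abs]; ring

/-- The first two cases of φ overlap on this interval only at b = a, where both values are 0. -/
theorem waveFn_of_mem {d₀ a b : ℝ} (ha : a ≠ 0) (hb : b ∈ uIcc (M.dStar a d₀) a) :
    M.waveFn a b d₀ = Real.sign a * M.S a b d₀ := by
  by_cases h : |a| ≤ |b| ∧ 0 ≤ a * b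
  · have hba : b = a := by
      have key : ∀ a b : ℝ, 0 < a → |a| ≤ |b| → 0 ≤ a * b → b ∈ uIcc (M.dStar a d₀) a → b = a := by
        intro a b ha h1 h2 h3
        rw [uIcc_of_le ((M.dStar_spec d₀ ha).1.2.trans ha).le] at h3
        have hb : 0 ≤ b := nonneg_of_mul_nonneg_right h2 ha
        rw [abs_of_pos ha, abs_of_nonneg hb] at h1
        exact le_antisymm h3.2 h1
      rcases lt_or_gt_of_ne ha with ha | ha
      · exact neg_injective (key (-a) (-b) (neg_pos.2 ha) (by simpa using h.1) (by simpa using h.2)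
          ((M.uIcc_dStar_neg d₀).2 hb))
      · exact key a b ha h.1 h.2 hb
    rw [M.waveFn_of_abs_le h.1 h.2, hba, S_self]; simp
  · rw [waveFn, if_neg h, if_pos hb]

theorem abs_dStar_lt {d₀ a : ℝ} (ha : a ≠ 0) : |M.dStar a d₀| < |a| := by
  have key : ∀ b : ℝ, 0 < b → |M.dStar b d₀| < |b| := by
    intro b hb
    have h := (M.dStar_spec d₀ hb).1
    rw [abs_of_neg h.2, abs_of_pos hb]; linarith [h.1]
  rcases lt_or_gt_of_ne ha with ha | ha
  · have := key (-a) (neg_pos.2 ha)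
    rwa [dStar_neg, abs_neg, abs_neg] at this
  · exact key a ha

theorem waveFn_of_lt_abs {d₀ a b : ℝ} (h1 : |M.dStar a d₀| ≤ |b|) (h2 : a * b < 0) :
    M.waveFn a b d₀ = Real.sign a * M.S a (M.dStar a d₀) d₀ +
      (M.lamInt d₀ (M.dStar a d₀) - M.lamInt d₀ b) := by
  have key : ∀ a b : ℝ, 0 < a → |M.dStar a d₀| ≤ |b| → a * b < 0 →
      M.waveFn a b d₀ = Real.sign a * M.S a (M.dStar a d₀) d₀ +
      (M.lamInt d₀ (M.dStar a d₀) - M.lamInt d₀ b) := by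
    intro a b ha h1 h2
    have hs := (M.dStar_spec d₀ ha).1
    have hb : b < 0 := by nlinarith
    rcases eq_or_ne b (M.dStar a d₀) with rfl | hne
    · rw [M.waveFn_of_mem ha.ne' left_mem_uIcc]; ring
    · have hn : ¬(b ∈ uIcc (M.dStar a d₀) a) := by
        rw [uIcc_of_le (hs.2.trans ha).le]
        rw [abs_of_neg hs.2, abs_of_neg hb] at h1
        exact fun h => hne (le_antisymm (by linarith) h.1)
      rw [waveFn, if_neg (fun h => absurd h.2 (not_le.2 h2)), if_neg hn, Real.sign_of_pos ha, R_eq,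
        abs_of_neg hs.2, abs_of_neg hb, lamInt_neg, lamInt_neg]
      ring
  have ha : a ≠ 0 := by rintro rfl; simp at h2
  rcases lt_or_gt_of_ne ha with ha | ha
  · have := key (-a) (-b) (neg_pos.2 ha) (by simpa [dStar_neg] using h1) (by simpa using h2)
    simp only [waveFn_neg, dStar_neg, S_neg, lamInt_neg, Real.sign_neg] at this
    linarith
  · exact key a b ha h1 h2

/-- Clamping b to the intervals cut out by d_*(a) and a replaces the case distinction by one
formula: on each of the three intervals a single summand varies. Continuity is then immediate, and
monotonicity is checked interval by interval. -/
theorem waveFn_eq_of_pos {d₀ a : ℝ} (ha : 0 < a) (b : ℝ) :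
    M.waveFn a b d₀ = (M.lamInt d₀ a - M.lamInt d₀ (max b a)) +
      M.S a (min (max b (M.dStar a d₀)) a) d₀ +
      (M.lamInt d₀ (M.dStar a d₀) - M.lamInt d₀ (min b (M.dStar a d₀))) := by
  have hs := (M.dStar_spec d₀ ha).1
  have hsa := hs.2.trans ha
  rcases le_total a b with h | h
  · rw [M.waveFn_of_abs_le (by rwa [abs_of_pos ha, abs_of_pos (ha.trans_le h)])
      (mul_nonneg ha.le (ha.le.trans h)), max_eq_left h, max_eq_left (hsa.le.trans h),
      min_eq_right h, min_eq_right (hsa.le.trans h), S_self]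
    ring
  · rcases le_total (M.dStar a d₀) b with h2 | h2
    · rw [M.waveFn_of_mem ha.ne' (by rw [uIcc_of_le hsa.le]; exact ⟨h2, h⟩), Real.sign_of_pos ha,
        max_eq_right h, max_eq_left h2, min_eq_left h, min_eq_right h2]
      ring
    · have hb := h2.trans_lt hs.2
      rw [M.waveFn_of_lt_abs (by rw [abs_of_neg hs.2, abs_of_neg hb]; linarith)
        (mul_neg_of_pos_of_neg ha hb), Real.sign_of_pos ha, max_eq_right h, max_eq_right h2,
        min_eq_left hsa.le, min_eq_left h2]
      ring

theorem waveFn_zero (d₀ b : ℝ) : M.waveFn 0 b d₀ = -M.lamInt d₀ b := by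
  rw [M.waveFn_of_abs_le (by simp) (by simp), lamInt_zero, zero_sub]

/-- By reflection, a property of the partial functions of `waveFn` need only be proved for
nonnegative first arguments. -/
theorem waveFn_induction {d₀ : ℝ} {p : (ℝ → ℝ) → Prop}
    (hneg : ∀ g, p g → p fun b => -g (-b)) (zero : p fun b => M.waveFn 0 b d₀)
    (pos : ∀ a, 0 < a → p fun b => M.waveFn a b d₀) (a : ℝ) : p fun b => M.waveFn a b d₀ := by
  rcases lt_trichotomy a 0 with ha | rfl | ha
  · have := hneg _ (pos (-a) (neg_pos.2 ha))
    simpa [waveFn_neg] using this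
  · exact zero
  · exact pos a ha

theorem continuous_waveFn (d₀ a : ℝ) : Continuous fun b => M.waveFn a b d₀ := by
  have hL := M.continuous_lamInt d₀
  have hf := M.continuous_f d₀
  refine M.waveFn_induction (p := Continuous) (fun g hg => by fun_prop) ?_ (fun a ha => ?_) a
  · simp only [waveFn_zero]; fun_prop
  · simp only [M.waveFn_eq_of_pos ha, S]
    fun_prop

theorem strictAntiOn_S (d₀ a : ℝ) : StrictAntiOn (fun b => M.S a b d₀) (Iic a) := by
  intro x hx y hy hxy
  have hf := M.strictMono_f d₀
  have hx : x ≤ a := hx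
  have hy : y ≤ a := hy
  refine Real.sqrt_lt_sqrt ?_ ?_
  · exact mul_nonneg (sub_nonneg.2 (hf.monotone hy)) (sub_nonneg.2 hy)
  · have h1 : M.f x d₀ < M.f y d₀ := hf hxy
    have h2 : M.f y d₀ ≤ M.f a d₀ := hf.monotone hy
    exact mul_lt_mul'' (by linarith) (by linarith) (by linarith) (by linarith)

theorem strictAnti_waveFn (d₀ a : ℝ) : StrictAnti fun b => M.waveFn a b d₀ := by
  have hL := M.strictMono_lamInt d₀
  refine M.waveFn_induction (p := StrictAnti) (fun g hg x y hxy => ?_) ?_ (fun a ha => ?_) a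
  · exact neg_lt_neg (hg (neg_lt_neg hxy))
  · simp only [waveFn_zero]
    exact fun x y hxy => neg_lt_neg (hL hxy)
  · have hs := (M.dStar_spec d₀ ha).1
    have hsa := hs.2.trans ha
    have h1 : StrictAntiOn (fun b => M.waveFn a b d₀) (Iic (M.dStar a d₀)) := by
      intro x hx y hy hxy
      have hx : x ≤ _ := hx
      have hy : y ≤ _ := hy
      have := hL hxy
      simp only [M.waveFn_eq_of_pos ha, max_eq_right hx, max_eq_right hy, min_eq_left hx,
        min_eq_left hy, max_eq_right (hx.trans hsa.le), max_eq_right (hy.trans hsa.le)]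
      linarith
    have h2 : StrictAntiOn (fun b => M.waveFn a b d₀) (Icc (M.dStar a d₀) a) := by
      intro x hx y hy hxy
      have := M.strictAntiOn_S d₀ a hx.2 hy.2 hxy
      simp only [M.waveFn_eq_of_pos ha, max_eq_right hx.2, max_eq_right hy.2, max_eq_left hx.1,
        max_eq_left hy.1, min_eq_left hx.2, min_eq_left hy.2, min_eq_right hx.1, min_eq_right hy.1]
      linarith
    have h3 : StrictAntiOn (fun b => M.waveFn a b d₀) (Ici a) := by
      intro x hx y hy hxy
      have hx : a ≤ x := hx
      have hy : a ≤ y := hy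
      have := hL hxy
      simp only [M.waveFn_eq_of_pos ha, max_eq_left hx, max_eq_left hy,
        max_eq_left (hsa.le.trans hx), max_eq_left (hsa.le.trans hy), min_eq_right hx,
        min_eq_right hy, min_eq_right (hsa.le.trans hx), min_eq_right (hsa.le.trans hy)]
      linarith
    have h12 := h1.union h2 isGreatest_Iic (isLeast_Icc hsa.le)
    rw [Iic_union_Icc_eq_Iic hsa.le] at h12
    exact h12.Iic_union_Ici h3

theorem tendsto_waveFn (d₀ a : ℝ) :
    Tendsto (fun b => M.waveFn a b d₀) atTop atBot ∧ Tendsto (fun b => M.waveFn a b d₀) atBot atTop := by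
  have h1 : ∀ C : ℝ, Tendsto (fun b => C - M.lamInt d₀ b) atTop atBot := fun C =>
    tendsto_atBot_add_const_left _ C (tendsto_neg_atTop_atBot.comp (M.tendsto_lamInt d₀))
  have h2 : ∀ C : ℝ, Tendsto (fun b => C - M.lamInt d₀ b) atBot atTop := fun C =>
    tendsto_atTop_add_const_left _ C (tendsto_neg_atBot_atTop.comp (M.tendsto_lamInt_atBot d₀))
  refine M.waveFn_induction
    (p := fun g => Tendsto g atTop atBot ∧ Tendsto g atBot atTop) (fun g hg => ?_) ?_ (fun a ha => ?_) a
  · exact ⟨tendsto_neg_atTop_atBot.comp (hg.2.comp tendsto_neg_atTop_atBot),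
      tendsto_neg_atBot_atTop.comp (hg.1.comp tendsto_neg_atBot_atTop)⟩
  · simp only [waveFn_zero, ← zero_sub]
    exact ⟨h1 0, h2 0⟩
  · have hs := (M.dStar_spec d₀ ha).1
    constructor
    · refine (h1 (M.lamInt d₀ a)).congr' ?_
      filter_upwards [eventually_ge_atTop a] with b hb
      rw [M.waveFn_of_abs_le (by rwa [abs_of_pos ha, abs_of_pos (ha.trans_le hb)])
        (mul_nonneg ha.le (ha.le.trans hb))]
    · refine (h2 (Real.sign a * M.S a (M.dStar a d₀) d₀ + M.lamInt d₀ (M.dStar a d₀))).congr' ?_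
      filter_upwards [eventually_le_atBot (M.dStar a d₀)] with b hb
      have hb0 := hb.trans_lt hs.2
      rw [M.waveFn_of_lt_abs (by rw [abs_of_neg hs.2, abs_of_neg hb0]; linarith)
        (mul_neg_of_pos_of_neg ha hb0)]
      ring

/-- `f(·, d₀)` as an order isomorphism of the real line. -/
def fIso (d₀ : ℝ) : ℝ ≃o ℝ := (M.strictMono_f d₀).orderIsoOfSurjective _
  ((M.continuous_f d₀).surjective (M.tendsto_f d₀) (M.tendsto_f_atBot d₀))

/-- The first equation is solved by d₂ = h(d₁) with h an increasing bijection. The second becomes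
Ψ(d₁) = H₃,₊ - H₃,₋, where Ψ is continuous and strictly decreasing from +∞ to -∞. -/
theorem existsUnique_intermediateSystem (ω : EuclideanSpace ℝ (Fin 2)) (uL uR : TMState) :
    ∃! d : ℝ × ℝ, M.IntermediateSystem ω uL uR d.1 d.2 := by
  set aL := cross ω uL.1
  set aR := cross ω uR.1
  set dL := dot ω uL.1
  set dR := dot ω uR.1
  let h : ℝ ≃o ℝ := (M.fIso dL).trans (M.fIso dR).symm
  have hh : ∀ x y, M.f x dL = M.f y dR ↔ y = h x := by
    intro x y
    show M.fIso dL x = M.fIso dR y ↔ y = (M.fIso dR).symm (M.fIso dL x)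
    rw [← OrderIso.symm_apply_eq]
    exact eq_comm
  let Ψ : ℝ → ℝ := fun x => M.waveFn aL x dL + M.waveFn aR (h x) dR
  have hanti : StrictAnti Ψ :=
    (M.strictAnti_waveFn dL aL).add ((M.strictAnti_waveFn dR aR).comp_strictMono h.strictMono)
  have hcont : Continuous Ψ :=
    (M.continuous_waveFn dL aL).add ((M.continuous_waveFn dR aR).comp h.continuous)
  have htop : Tendsto Ψ atTop atBot :=
    (M.tendsto_waveFn dL aL).1.atBot_add_atBot ((M.tendsto_waveFn dR aR).1.comp h.tendsto_atTop)
  have hbot : Tendsto Ψ atBot atTop :=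
    (M.tendsto_waveFn dL aL).2.atTop_add_atTop ((M.tendsto_waveFn dR aR).2.comp h.tendsto_atBot)
  obtain ⟨x, hx⟩ := hcont.surjective' hbot htop (uR.2 - uL.2)
  have hx : M.waveFn aL x dL + M.waveFn aR (h x) dR = uR.2 - uL.2 := hx
  refine ⟨(x, h x), ⟨(hh _ _).2 rfl, ?_⟩, ?_⟩
  · show uL.2 + M.waveFn aL x dL = uR.2 - M.waveFn aR (h x) dR
    linarith
  · rintro ⟨y, z⟩ ⟨h1, h2⟩
    have h1 := (hh _ _).1 h1
    dsimp only at h1 h2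
    subst h1
    have h3 : Ψ y = Ψ x := by
      show M.waveFn aL y dL + M.waveFn aR (h y) dR = M.waveFn aL x dL + M.waveFn aR (h x) dR
      have h2 : uL.2 + M.waveFn aL y dL = uR.2 - M.waveFn aR (h y) dR := h2
      linarith
    rw [hanti.injective h3]

end Medium

/-- The other characteristic family. -/
def Family.flip : Family → Family
  | .slow => .fast
  | .fast => .slow

theorem Family.sign_flip (k : Family) : k.flip.sign = -k.sign := by
  cases k <;> simp [flip, sign]

namespace Medium

variable (M : Medium)

/-! ## The system satisfied by `(ω × D, H₃)` when `ω · D = d₀` is constant -/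

/-- The flux of the system `∂ₜd + ∂_yH = 0`, `∂ₜH + ∂_y f(d, d₀) = 0`. -/
def planarFlux (d₀ : ℝ) (v : ℝ × ℝ) : ℝ × ℝ := (v.2, M.f v.1 d₀)

/-- The positive eigenvalue of this system. -/
def planarSpeed (d₀ : ℝ) (v : ℝ × ℝ) : ℝ := M.lam v.1 d₀

/-- The waves of this system. -/
abbrev IsPlanarWave (d₀ : ℝ) (k : Family) (a b : ℝ × ℝ) (W : ℝ → ℝ × ℝ) : Prop :=
  IsWave (M.planarFlux d₀) (M.planarSpeed d₀) Prod.fst k a b W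

/-- The Liu shocks of this system. -/
abbrev IsPlanarShock (d₀ : ℝ) (k : Family) (σ : ℝ) (a b : ℝ × ℝ) : Prop :=
  IsLiuShock (M.planarFlux d₀) Prod.fst k σ a b

/-- The rarefactions of this system. -/
abbrev IsPlanarRarefaction (d₀ : ℝ) (k : Family) (a b : ℝ × ℝ) (W : ℝ → ℝ × ℝ) : Prop :=
  IsRarefaction (M.planarFlux d₀) (M.planarSpeed d₀) k a b W

theorem hasFDerivAt_planarFlux (d₀ : ℝ) (v : ℝ × ℝ) : HasFDerivAt (M.planarFlux d₀)
    ((ContinuousLinearMap.snd ℝ ℝ ℝ).prod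
      ((M.lam v.1 d₀ ^ 2) • ContinuousLinearMap.fst ℝ ℝ ℝ)) v :=
  hasFDerivAt_snd.prodMk ((M.hasDerivAt_f v.1 d₀).comp_hasFDerivAt v hasFDerivAt_fst)

theorem fderiv_planarFlux (d₀ : ℝ) (v w : ℝ × ℝ) :
    fderiv ℝ (M.planarFlux d₀) v w = (w.2, M.lam v.1 d₀ ^ 2 * w.1) := by
  rw [(M.hasFDerivAt_planarFlux d₀ v).fderiv]; rfl

theorem fderiv_planarFlux_eq_smul (d₀ : ℝ) (v w : ℝ × ℝ) (ξ : ℝ) :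
    fderiv ℝ (M.planarFlux d₀) v w = ξ • w ↔ w.2 = ξ * w.1 ∧ M.lam v.1 d₀ ^ 2 * w.1 = ξ * w.2 := by
  rw [fderiv_planarFlux, Prod.ext_iff]; rfl

theorem rankineHugoniot_planarFlux (d₀ σ : ℝ) (a b : ℝ × ℝ) :
    RankineHugoniot (M.planarFlux d₀) σ a b ↔
      σ * (b.1 - a.1) = b.2 - a.2 ∧ σ * (b.2 - a.2) = M.f b.1 d₀ - M.f a.1 d₀ := by
  rw [RankineHugoniot, Prod.ext_iff]; rfl

/-- Eliminating the jump of H gives σ² = slope of the chord. Each family therefore has exactly one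
Hugoniot branch, parametrized by d. -/
theorem rankineHugoniot_planarFlux_iff (d₀ : ℝ) (k : Family) {σ : ℝ} {a b : ℝ × ℝ} :
    (a ≠ b ∧ 0 < k.sign * σ ∧ RankineHugoniot (M.planarFlux d₀) σ a b) ↔
      a.1 ≠ b.1 ∧ σ = k.sign * Real.sqrt (M.chord d₀ a.1 b.1) ∧ b.2 - a.2 = σ * (b.1 - a.1) := by
  have hk : k.sign * k.sign = 1 := by cases k <;> simp [Family.sign]
  rw [rankineHugoniot_planarFlux]
  constructor
  · rintro ⟨hab, hσ, h1, h2⟩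
    have hne : a.1 ≠ b.1 := by
      intro h
      refine hab (Prod.ext h ?_)
      rw [h, sub_self, mul_zero] at h1
      linarith
    refine ⟨hne, ?_, h1.symm⟩
    have h3 : M.chord d₀ a.1 b.1 = (k.sign * σ) ^ 2 := by
      rw [chord, div_eq_iff (sub_ne_zero.2 hne)]
      linear_combination h2 + σ * h1 + (b.1 - a.1) * σ ^ 2 * hk
    rw [h3, Real.sqrt_sq hσ.le, ← mul_assoc, hk, one_mul]
  · rintro ⟨hne, hσ, h1⟩
    have hc := M.chord_pos d₀ hne
    refine ⟨fun h => hne (congrArg Prod.fst h), ?_, h1.symm, ?_⟩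
    · rw [hσ, ← mul_assoc, hk, one_mul]; exact Real.sqrt_pos.2 hc
    · have h3 : σ ^ 2 = M.chord d₀ a.1 b.1 := by
        rw [hσ, mul_pow, Real.sq_sqrt hc.le, pow_two, hk, one_mul]
      have h4 : M.chord d₀ a.1 b.1 * (a.1 - b.1) = M.f a.1 d₀ - M.f b.1 d₀ :=
        div_mul_cancel₀ _ (sub_ne_zero.2 hne)
      rw [← h3] at h4
      rw [h1]; linear_combination -h4

/-- The Hugoniot branch being a graph over d, Liu's condition, which quantifies over states and
speeds, reduces to an inequality between chord slopes. -/
theorem isPlanarShock_iff (d₀ : ℝ) (k : Family) {σ : ℝ} {a b : ℝ × ℝ} :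
    M.IsPlanarShock d₀ k σ a b ↔
      a.1 ≠ b.1 ∧ σ = k.sign * Real.sqrt (M.chord d₀ a.1 b.1) ∧ b.2 - a.2 = σ * (b.1 - a.1) ∧
      ∀ x ∈ uIcc a.1 b.1, x ≠ a.1 →
        k.sign * Real.sqrt (M.chord d₀ a.1 b.1) ≤ k.sign * Real.sqrt (M.chord d₀ a.1 x) := by
  constructor
  · intro h
    obtain ⟨h1, h2, h3⟩ :=
      (M.rankineHugoniot_planarFlux_iff d₀ k).1 ⟨h.nontrivial, h.sign, h.rankineHugoniot⟩
    refine ⟨h1, h2, h3, fun x hx hne => ?_⟩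
    rw [← h2]
    set τ := k.sign * Real.sqrt (M.chord d₀ a.1 x) with hτ
    -- The competitor is the state over x on the Hugoniot branch of a, whose H is dictated by the
    -- first jump relation.
    obtain ⟨e1, e2, e3⟩ := (M.rankineHugoniot_planarFlux_iff d₀ k (σ := τ) (a := a)
      (b := (x, a.2 + τ * (x - a.1)))).2 ⟨hne.symm, hτ, by simp⟩
    exact h.liu τ _ e1.symm e2 e3 hx
  · rintro ⟨h1, h2, h3, h4⟩
    obtain ⟨e1, e2, e3⟩ := (M.rankineHugoniot_planarFlux_iff d₀ k).2 ⟨h1, h2, h3⟩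
    refine ⟨e1, e2, e3, fun σ' u hu hσ' hRH hmem => ?_⟩
    obtain ⟨g1, g2, -⟩ := (M.rankineHugoniot_planarFlux_iff d₀ k).1 ⟨hu.symm, hσ', hRH⟩
    rw [h2, g2]
    exact h4 u.1 hmem g1.symm

theorem isPlanarShock_slow_iff (d₀ : ℝ) {σ : ℝ} {a b : ℝ × ℝ} :
    M.IsPlanarShock d₀ .slow σ a b ↔
      a.1 ≠ b.1 ∧ σ = -Real.sqrt (M.chord d₀ a.1 b.1) ∧ b.2 - a.2 = σ * (b.1 - a.1) ∧
      M.LiuChord d₀ a.1 b.1 := by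
  rw [isPlanarShock_iff]
  simp only [Family.sign, neg_one_mul, neg_le_neg_iff, LiuChord]
  refine and_congr_right fun h => and_congr_right fun _ => and_congr_right fun _ => ?_
  exact forall_congr' fun x => forall_congr' fun _ => forall_congr' fun _ =>
    Real.sqrt_le_sqrt_iff (M.chord_pos d₀ h).le

/-- Both inequalities say on which side of the chord from a to b the point of the graph at x lies.
This moves the base point of Liu's condition from the left to the right state. -/
theorem chord_le_chord_iff (d₀ : ℝ) {a b x : ℝ} (hx : x ∈ uIcc a b) (ha : x ≠ a) (hb : x ≠ b) :
    M.chord d₀ a b ≤ M.chord d₀ a x ↔ M.chord d₀ b x ≤ M.chord d₀ b a := by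
  have hab : a ≠ b := by
    rintro rfl
    rw [uIcc_self] at hx
    exact ha hx
  have e1 : M.chord d₀ a b * (a - b) = M.f a d₀ - M.f b d₀ :=
    div_mul_cancel₀ _ (sub_ne_zero.2 hab)
  have e2 : M.chord d₀ a x * (a - x) = M.f a d₀ - M.f x d₀ :=
    div_mul_cancel₀ _ (sub_ne_zero.2 ha.symm)
  have e3 : M.chord d₀ b x * (b - x) = M.f b d₀ - M.f x d₀ :=
    div_mul_cancel₀ _ (sub_ne_zero.2 hb.symm)
  rw [M.chord_comm d₀ b a]
  have key : (M.chord d₀ a x - M.chord d₀ a b) * (a - x) =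
      (M.chord d₀ b x - M.chord d₀ a b) * (b - x) := by linear_combination e2 - e3 - e1
  rcases mem_uIcc.1 hx with h | h
  · have h1 : 0 < x - a := sub_pos.2 (lt_of_le_of_ne h.1 ha.symm)
    have h2 : 0 < b - x := sub_pos.2 (lt_of_le_of_ne h.2 hb)
    constructor <;> intro h3 <;> by_contra! h4 <;> nlinarith
  · have h1 : 0 < x - b := sub_pos.2 (lt_of_le_of_ne h.1 hb.symm)
    have h2 : 0 < a - x := sub_pos.2 (lt_of_le_of_ne h.2 ha)
    constructor <;> intro h3 <;> by_contra! h4 <;> nlinarith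

/-- Liu's condition compares chords from the left state. Restated from the right state it is the
slow condition read backwards, so that reflection exchanges the two families. -/
theorem isPlanarShock_fast_iff (d₀ : ℝ) {σ : ℝ} {a b : ℝ × ℝ} :
    M.IsPlanarShock d₀ .fast σ a b ↔
      a.1 ≠ b.1 ∧ σ = Real.sqrt (M.chord d₀ a.1 b.1) ∧ b.2 - a.2 = σ * (b.1 - a.1) ∧
      M.LiuChord d₀ b.1 a.1 := by
  rw [isPlanarShock_iff]
  simp only [Family.sign, one_mul, LiuChord]
  refine and_congr_right fun h => and_congr_right fun _ => and_congr_right fun _ => ?_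
  constructor
  · intro H x hx hb
    rcases eq_or_ne x a.1 with rfl | ha
    · exact le_rfl
    · rw [uIcc_comm] at hx
      rw [← M.chord_le_chord_iff d₀ hx ha hb]
      exact (Real.sqrt_le_sqrt_iff (M.chord_pos d₀ ha.symm).le).1 (H x hx ha)
  · intro H x hx ha
    rcases eq_or_ne x b.1 with rfl | hb
    · exact le_rfl
    · refine Real.sqrt_le_sqrt ((M.chord_le_chord_iff d₀ hx ha hb).2 ?_)
      exact H x (by rwa [uIcc_comm]) hb

/-! ### Reflection -/

/-- The reflection `y ↦ -y` changes the sign of `H₃`. -/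
def reflect (v : ℝ × ℝ) : ℝ × ℝ := (v.1, -v.2)

theorem reflect_reflect (v : ℝ × ℝ) : reflect (reflect v) = v := by simp [reflect]

theorem continuous_reflect : Continuous reflect := by unfold reflect; fun_prop

variable {M}

theorem IsPlanarShock.reflect {d₀ σ : ℝ} {k : Family} {a b : ℝ × ℝ}
    (h : M.IsPlanarShock d₀ k σ a b) :
    M.IsPlanarShock d₀ k.flip (-σ) (reflect b) (reflect a) := by
  cases k
  · obtain ⟨h1, h2, h3, h4⟩ := (M.isPlanarShock_slow_iff d₀).1 h
    refine (M.isPlanarShock_fast_iff d₀).2 ⟨h1.symm, ?_, ?_, h4⟩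
    · rw [h2, neg_neg]; exact congrArg _ (M.chord_comm _ _ _)
    · simp only [Medium.reflect]; linarith
  · obtain ⟨h1, h2, h3, h4⟩ := (M.isPlanarShock_fast_iff d₀).1 h
    refine (M.isPlanarShock_slow_iff d₀).2 ⟨h1.symm, ?_, ?_, h4⟩
    · rw [h2]; exact congrArg (fun x => -Real.sqrt x) (M.chord_comm _ _ _)
    · simp only [Medium.reflect]; linarith

theorem IsPlanarRarefaction.reflect {d₀ : ℝ} {k : Family} {a b : ℝ × ℝ} {W : ℝ → ℝ × ℝ}
    (h : M.IsPlanarRarefaction d₀ k a b W) :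
    M.IsPlanarRarefaction d₀ k.flip (reflect b) (reflect a) (fun ξ => reflect (W (-ξ))) := by
  have hs : ∀ v, M.planarSpeed d₀ (Medium.reflect v) = M.planarSpeed d₀ v := fun v => rfl
  refine ⟨?_, ?_, ?_, ?_, ?_⟩
  · have := h.speed_lt
    rw [Family.sign_flip, hs, hs]; linarith
  · exact continuous_reflect.comp (h.continuous.comp continuous_neg)
  · intro ξ hξ
    rw [Family.sign_flip, hs] at hξ
    rw [h.right _ (by linarith)]
  · intro ξ hξ
    rw [Family.sign_flip, hs] at hξ
    rw [h.left _ (by linarith)]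
  · intro ξ hξ
    rw [Family.sign_flip, hs, hs] at hξ
    obtain ⟨h1, w, hw, hd, he⟩ := h.fan (-ξ) ⟨by linarith [hξ.2], by linarith [hξ.1]⟩
    -- The vector is the reflection of -w, the minus sign coming from ξ ↦ -ξ.
    refine ⟨by rw [Family.sign_flip, hs]; linarith, (-w.1, w.2), ?_, ?_, ?_⟩
    · intro e
      refine hw (Prod.ext ?_ ?_)
      · simpa using congrArg Prod.fst e
      · simpa using congrArg Prod.snd e
    · have h2 : HasDerivAt (fun ξ => W (-ξ)) (-w) ξ := by
        have h3 := HasDerivAt.scomp ξ hd (hasDerivAt_neg ξ)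
        rwa [neg_one_smul] at h3
      have h3 := ((ContinuousLinearMap.fst ℝ ℝ ℝ).prod
        (-ContinuousLinearMap.snd ℝ ℝ ℝ)).hasFDerivAt.comp_hasDerivAt ξ h2
      exact h3.congr_deriv (by simp)
    · rw [fderiv_planarFlux_eq_smul] at he ⊢
      obtain ⟨e1, e2⟩ := he
      refine ⟨by simp only; linarith, ?_⟩
      simp only [Medium.reflect]
      linarith

theorem IsPlanarWave.reflect {d₀ : ℝ} {k : Family} {a b : ℝ × ℝ} {W : ℝ → ℝ × ℝ}
    (h : M.IsPlanarWave d₀ k a b W) :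
    M.IsPlanarWave d₀ k.flip (reflect b) (reflect a) (fun ξ => reflect (W (-ξ))) := by
  cases h with
  | trivial _ _ _ h => exact .trivial _ _ _ fun ξ => by rw [h]
  | shock _ _ _ _ σ h left right =>
    refine .shock _ _ _ _ (-σ) (IsPlanarShock.reflect h) ?_ ?_
    · intro ξ hξ; rw [right _ (by linarith)]
    · intro ξ hξ; rw [left _ (by linarith)]
  | rarefaction _ _ _ _ h => exact .rarefaction _ _ _ _ (IsPlanarRarefaction.reflect h)
  | slowComposite _ um _ _ Wr σ hs hσ hr left right =>
    refine .fastComposite _ (Medium.reflect um) _ _ (fun ξ => Medium.reflect (Wr (-ξ))) (-σ)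
      (IsPlanarRarefaction.reflect hr) (by rw [hσ, neg_neg]; rfl) (IsPlanarShock.reflect hs) ?_ ?_
    · intro ξ hξ; rw [right _ (by linarith)]
    · intro ξ hξ; rw [left _ (by linarith)]
  | fastComposite _ um _ _ Wr σ hr hσ hs left right =>
    refine .slowComposite _ (Medium.reflect um) _ _ (fun ξ => Medium.reflect (Wr (-ξ))) (-σ)
      (IsPlanarShock.reflect hs) (by rw [hσ]; rfl) (IsPlanarRarefaction.reflect hr) ?_ ?_
    · intro ξ hξ; rw [right _ (by linarith)]
    · intro ξ hξ; rw [left _ (by linarith)]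

end Medium

namespace Medium

variable {M : Medium}

/-! ### Rarefactions of the slow family -/

namespace IsPlanarRarefaction

variable {d₀ : ℝ} {a b : ℝ × ℝ} {W W' : ℝ → ℝ × ℝ}

theorem abs_lt (h : M.IsPlanarRarefaction d₀ .slow a b W) : |a.1| < |b.1| := by
  have := h.speed_lt
  simp only [Family.sign, neg_one_mul, neg_lt_neg_iff] at this
  exact (M.lam_lt_lam_iff d₀).1 this

theorem lam_apply (h : M.IsPlanarRarefaction d₀ .slow a b W) {ξ : ℝ}
    (hξ : ξ ∈ Icc (-M.lam a.1 d₀) (-M.lam b.1 d₀)) : M.lam (W ξ).1 d₀ = -ξ := by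
  have hl := h.left
  have hr := h.right
  have hf := h.fan
  simp only [Family.sign, neg_one_mul, planarSpeed] at hl hr hf
  rcases eq_or_lt_of_le hξ.1 with h1 | h1
  · rw [hl ξ h1.ge, ← h1, neg_neg]
  · rcases eq_or_lt_of_le hξ.2 with h2 | h2
    · rw [hr ξ h2.ge, h2, neg_neg]
    · have := (hf ξ ⟨h1, h2⟩).1
      linarith

theorem apply_left (h : M.IsPlanarRarefaction d₀ .slow a b W) {ξ : ℝ}
    (hξ : ξ ≤ -M.lam a.1 d₀) : W ξ = a := by
  refine h.left ξ ?_
  simpa only [Family.sign, neg_one_mul, planarSpeed] using hξ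

theorem apply_right (h : M.IsPlanarRarefaction d₀ .slow a b W) {ξ : ℝ}
    (hξ : -M.lam b.1 d₀ ≤ ξ) : W ξ = b := by
  refine h.right ξ ?_
  simpa only [Family.sign, neg_one_mul, planarSpeed] using hξ

theorem lt (h : M.IsPlanarRarefaction d₀ .slow a b W) : -M.lam a.1 d₀ < -M.lam b.1 d₀ :=
  neg_lt_neg ((M.lam_lt_lam_iff d₀).2 h.abs_lt)

/-- λ is maximal at d = 0, whereas it drops strictly below its value at a inside the fan. So a slow
fan can start at d = 0 but cannot cross it. -/
theorem apply_ne_zero (h : M.IsPlanarRarefaction d₀ .slow a b W) {ξ : ℝ}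
    (hξ : ξ ∈ Ioc (-M.lam a.1 d₀) (-M.lam b.1 d₀)) : (W ξ).1 ≠ 0 := by
  intro h0
  have h1 := h.lam_apply (Ioc_subset_Icc_self hξ)
  rw [h0] at h1
  have h2 : M.lam 0 d₀ < M.lam a.1 d₀ := by linarith [hξ.1]
  have := (M.lam_lt_lam_iff d₀).1 h2
  rw [abs_zero] at this
  exact absurd this (not_lt.2 (abs_nonneg _))

theorem mul_pos_of_mem (h : M.IsPlanarRarefaction d₀ .slow a b W) {ξ : ℝ}
    (hξ : ξ ∈ Ioc (-M.lam a.1 d₀) (-M.lam b.1 d₀)) : 0 < (W ξ).1 * b.1 := by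
  have hb : b.1 ≠ 0 := by
    have := h.apply_ne_zero (right_mem_Ioc.2 h.lt)
    rwa [h.apply_right le_rfl] at this
  by_contra! hneg
  have hc : ContinuousOn (fun η => (W η).1 * b.1) (Icc ξ (-M.lam b.1 d₀)) :=
    ((continuous_fst.comp h.continuous).mul continuous_const).continuousOn
  have h2 : (0 : ℝ) ∈ Icc ((W ξ).1 * b.1) ((W (-M.lam b.1 d₀)).1 * b.1) := by
    rw [h.apply_right le_rfl]
    exact ⟨hneg, mul_self_nonneg _⟩
  obtain ⟨η, hη, h0⟩ := intermediate_value_Icc hξ.2 hc h2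
  exact h.apply_ne_zero ⟨hξ.1.trans_le hη.1, hη.2⟩ ((mul_eq_zero.1 h0).resolve_right hb)

/-- Since d may vanish at the left edge, the strict sign inside the fan passes only to a weak
inequality in the limit. -/
theorem mul_nonneg (h : M.IsPlanarRarefaction d₀ .slow a b W) : 0 ≤ a.1 * b.1 := by
  have hc : ContinuousWithinAt (fun η => (W η).1 * b.1) (Ioi (-M.lam a.1 d₀)) (-M.lam a.1 d₀) :=
    ((continuous_fst.comp h.continuous).mul continuous_const).continuousWithinAt
  rw [← h.apply_left le_rfl]
  refine ge_of_tendsto hc ?_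
  filter_upwards [Ioc_mem_nhdsGT h.lt] with ξ hξ using (h.mul_pos_of_mem hξ).le

/-- H + ∫λ is a Riemann invariant: the eigenvector relation gives H' = ξ d' = -λ d' in the fan. -/
theorem snd_apply (h : M.IsPlanarRarefaction d₀ .slow a b W) {ξ : ℝ}
    (hξ : ξ ∈ Icc (-M.lam a.1 d₀) (-M.lam b.1 d₀)) :
    (W ξ).2 = a.2 + M.lamInt d₀ a.1 - M.lamInt d₀ (W ξ).1 := by
  rcases eq_or_lt_of_le hξ.1 with h1 | h1
  · rw [h.apply_left h1.ge]; ring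
  have hc : ContinuousOn (fun η => (W η).2 + M.lamInt d₀ (W η).1) (Icc (-M.lam a.1 d₀) ξ) := by
    have := M.continuous_lamInt d₀
    have := h.continuous
    exact Continuous.continuousOn (by fun_prop)
  have hf := h.fan
  simp only [Family.sign, neg_one_mul, planarSpeed] at hf
  have hd : ∀ η ∈ Ioo (-M.lam a.1 d₀) ξ,
      HasDerivAt (fun η => (W η).2 + M.lamInt d₀ (W η).1) 0 η := by
    intro η hη
    obtain ⟨e1, w, -, e2, e3⟩ := hf η ⟨hη.1, hη.2.trans_le hξ.2⟩
    rw [fderiv_planarFlux_eq_smul] at e3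
    have g1 : HasDerivAt (fun η => (W η).1) w.1 η :=
      (ContinuousLinearMap.fst ℝ ℝ ℝ).hasFDerivAt.comp_hasDerivAt η e2
    have g2 : HasDerivAt (fun η => (W η).2) w.2 η :=
      (ContinuousLinearMap.snd ℝ ℝ ℝ).hasFDerivAt.comp_hasDerivAt η e2
    refine (g2.add ((M.hasDerivAt_lamInt d₀ _).comp η g1)).congr_deriv ?_
    rw [e3.1]; linear_combination (-w.1) * e1
  obtain ⟨η, -, h2⟩ := exists_hasDerivAt_eq_slope _ _ h1 hc hd
  rw [eq_comm, div_eq_zero_iff, h.apply_left le_rfl] at h2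
  have := h2.resolve_right (sub_pos.2 h1).ne'
  linarith

theorem snd_eq (h : M.IsPlanarRarefaction d₀ .slow a b W) :
    b.2 = a.2 + M.lamInt d₀ a.1 - M.lamInt d₀ b.1 := by
  have := h.snd_apply (right_mem_Icc.2 h.lt.le)
  rwa [h.apply_right le_rfl] at this

/-- At each ξ the speed determines |d|, the common sign with the right state determines d, and the
Riemann invariant then determines H. -/
theorem unique (h : M.IsPlanarRarefaction d₀ .slow a b W)
    (h' : M.IsPlanarRarefaction d₀ .slow a b W') : W = W' := by
  funext ξ
  rcases le_or_gt ξ (-M.lam a.1 d₀) with h1 | h1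
  · rw [h.apply_left h1, h'.apply_left h1]
  rcases le_or_gt (-M.lam b.1 d₀) ξ with h2 | h2
  · rw [h.apply_right h2, h'.apply_right h2]
  have hI : ξ ∈ Icc (-M.lam a.1 d₀) (-M.lam b.1 d₀) := ⟨h1.le, h2.le⟩
  have e1 : (W ξ).1 = (W' ξ).1 := by
    have e := (M.lam_eq_lam_iff d₀).1 ((h.lam_apply hI).trans (h'.lam_apply hI).symm)
    have p := h.mul_pos_of_mem ⟨h1, h2.le⟩
    have p' := h'.mul_pos_of_mem ⟨h1, h2.le⟩
    rcases abs_eq_abs.1 e with e | e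
    · exact e
    · rw [e] at p; linarith
  exact Prod.ext e1 (by rw [h.snd_apply hI, h'.snd_apply hI, e1])

end IsPlanarRarefaction

/-- The profile of the fan is the inverse of -λ on [α, β]. Differentiability is asked only in the
open fan, which allows α = 0, where the derivative of λ vanishes. -/
theorem exists_hasDerivAt_inverse (M : Medium) (d₀ : ℝ) {α β : ℝ} (hα : 0 ≤ α) (h : α < β) :
    ∃ D : ℝ → ℝ, Continuous D ∧ (∀ ξ ≤ -M.lam α d₀, D ξ = α) ∧ (∀ ξ, -M.lam β d₀ ≤ ξ → D ξ = β) ∧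
      ∀ ξ ∈ Ioo (-M.lam α d₀) (-M.lam β d₀),
        M.lam (D ξ) d₀ = -ξ ∧ ∃ δ ≠ 0, HasDerivAt D δ ξ := by
  -- `cl` is the projection onto [α, β], and `m` equals -λ there and has slope one outside. It is an
  -- increasing bijection of the line, so its inverse is globally continuous, and composing with
  -- `cl` makes the profile constant off the fan.
  let cl : ℝ → ℝ := fun x => max α (min x β)
  let m : ℝ → ℝ := fun x => -M.lam (cl x) d₀ + (x - cl x)
  have cl_left : ∀ x ≤ α, cl x = α := fun x hx => max_eq_left ((min_le_left _ _).trans hx)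
  have cl_right : ∀ x, β ≤ x → cl x = β := fun x hx => by
    show max α (min x β) = β
    rw [min_eq_right hx, max_eq_right h.le]
  have cl_mem : ∀ x ∈ Icc α β, cl x = x := fun x hx => by
    show max α (min x β) = x
    rw [min_eq_left hx.2, max_eq_right hx.1]
  have hclc : Continuous cl := by fun_prop
  have hmc : Continuous m := by
    have := M.continuous_lam d₀
    fun_prop
  have hmono : StrictMono m := by
    intro x y hxy
    have h1 : cl x ≤ cl y := max_le_max_left _ (min_le_min_right _ hxy.le)
    have h2 : cl y - cl x ≤ y - x := by
      simp only [cl]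
      rcases le_total x β with hx | hx <;> rcases le_total y β with hy | hy <;>
        rcases le_total α x with hx' | hx' <;> rcases le_total α y with hy' | hy' <;>
        simp [hx, hy, hx', hy', h.le] <;> linarith
    have h3 : 0 ≤ cl x := hα.trans (le_max_left _ _)
    show -M.lam (cl x) d₀ + (x - cl x) < -M.lam (cl y) d₀ + (y - cl y)
    rcases eq_or_lt_of_le h1 with h4 | h4
    · rw [h4]; linarith
    · have := M.strictAntiOn_lam d₀ h3 (h3.trans h1 : 0 ≤ cl y) h4
      simp only at this
      linarith
  have htop : Tendsto m atTop atTop := by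
    have h1 : Tendsto (fun x : ℝ => -M.lam β d₀ + (x - β)) atTop atTop :=
      tendsto_atTop_add_const_left _ _ (tendsto_atTop_add_const_right _ (-β) tendsto_id)
    refine h1.congr' ?_
    filter_upwards [eventually_ge_atTop β] with x hx
    simp only [m, cl_right x hx]
  have hbot : Tendsto m atBot atBot := by
    have h1 : Tendsto (fun x : ℝ => -M.lam α d₀ + (x - α)) atBot atBot :=
      tendsto_atBot_add_const_left _ _ (tendsto_atBot_add_const_right _ (-α) tendsto_id)
    refine h1.congr' ?_
    filter_upwards [eventually_le_atBot α] with x hx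
    simp only [m, cl_left x hx]
  let e : ℝ ≃o ℝ := hmono.orderIsoOfSurjective m (hmc.surjective htop hbot)
  have he : ∀ ξ, m (e.symm ξ) = ξ := fun ξ => e.apply_symm_apply ξ
  have hmα : m α = -M.lam α d₀ := by simp only [m, cl_left α le_rfl]; ring
  have hmβ : m β = -M.lam β d₀ := by simp only [m, cl_right β le_rfl]; ring
  refine ⟨fun ξ => cl (e.symm ξ), hclc.comp e.symm.continuous, ?_, ?_, ?_⟩
  · intro ξ hξ
    refine cl_left _ ?_
    rwa [← hmono.le_iff_le, he, hmα]
  · intro ξ hξ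
    refine cl_right _ ?_
    rwa [← hmono.le_iff_le, he, hmβ]
  · intro ξ hξ
    rw [← hmα, ← hmβ] at hξ
    have hx : e.symm ξ ∈ Ioo α β := by
      rw [← he ξ] at hξ
      exact ⟨hmono.lt_iff_lt.1 hξ.1, hmono.lt_iff_lt.1 hξ.2⟩
    have hcl : cl (e.symm ξ) = e.symm ξ := cl_mem _ (Ioo_subset_Icc_self hx)
    refine ⟨?_, ?_⟩
    · have := he ξ
      simp only [m, hcl] at this
      show M.lam (cl (e.symm ξ)) d₀ = -ξ
      rw [hcl]; linarith
    · obtain ⟨l, hl, hd⟩ := M.hasDerivAt_lam (e.symm ξ) d₀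
      have hx0 : 0 < e.symm ξ := hα.trans_lt hx.1
      have hdm : HasDerivAt m (-(l * e.symm ξ)) (e.symm ξ) := by
        refine hd.neg.congr_of_eventuallyEq ?_
        filter_upwards [Ioo_mem_nhds hx.1 hx.2] with x hx
        simp only [m, cl_mem x (Ioo_subset_Icc_self hx), sub_self, add_zero, Pi.neg_apply]
      have hne : -(l * e.symm ξ) ≠ 0 := neg_ne_zero.2 (mul_ne_zero hl.ne hx0.ne')
      refine ⟨(-(l * e.symm ξ))⁻¹, inv_ne_zero hne, ?_⟩
      have hde : HasDerivAt e.symm (-(l * e.symm ξ))⁻¹ ξ :=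
        hdm.of_local_left_inverse e.symm.continuous.continuousAt hne (Eventually.of_forall he)
      refine hde.congr_of_eventuallyEq ?_
      filter_upwards [e.symm.continuous.continuousAt.preimage_mem_nhds (Ioo_mem_nhds hx.1 hx.2)]
        with η hη using cl_mem _ (Ioo_subset_Icc_self hη)

theorem exists_isPlanarRarefaction (M : Medium) (d₀ : ℝ) {a b : ℝ × ℝ} (h1 : |a.1| < |b.1|)
    (h2 : 0 ≤ a.1 * b.1) (h3 : b.2 = a.2 + M.lamInt d₀ a.1 - M.lamInt d₀ b.1) :
    ∃ W, M.IsPlanarRarefaction d₀ .slow a b W := by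
  obtain ⟨D, hDc, hDl, hDr, hDf⟩ := M.exists_hasDerivAt_inverse d₀ (abs_nonneg a.1) h1
  rw [lam_abs, lam_abs] at hDf
  rw [lam_abs] at hDl hDr
  -- The common sign is read off the right state, because d may be 0 on the left.
  obtain ⟨s, hs, ha, hb⟩ : ∃ s : ℝ, |s| = 1 ∧ a.1 = s * |a.1| ∧ b.1 = s * |b.1| := by
    have hb : b.1 ≠ 0 := fun e => by
      rw [e, abs_zero] at h1
      exact absurd h1 (not_lt.2 (abs_nonneg _))
    rcases lt_or_gt_of_ne hb with hb | hb
    · have : a.1 ≤ 0 := by by_contra! h; exact absurd h2 (not_le.2 (mul_neg_of_pos_of_neg h hb))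
      exact ⟨-1, by simp, by rw [abs_of_nonpos this]; ring, by rw [abs_of_neg hb]; ring⟩
    · have : 0 ≤ a.1 := by by_contra! h; exact absurd h2 (not_le.2 (mul_neg_of_neg_of_pos h hb))
      exact ⟨1, by simp, by rw [abs_of_nonneg this]; ring, by rw [abs_of_pos hb]; ring⟩
  have hs0 : s ≠ 0 := by rintro rfl; simp at hs
  refine ⟨fun ξ => (s * D ξ, a.2 + M.lamInt d₀ a.1 - M.lamInt d₀ (s * D ξ)), ?_, ?_, ?_, ?_, ?_⟩
  · simp only [Family.sign, neg_one_mul, planarSpeed, neg_lt_neg_iff]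
    exact (M.lam_lt_lam_iff d₀).2 h1
  · have := M.continuous_lamInt d₀
    fun_prop
  · intro ξ hξ
    simp only [Family.sign, neg_one_mul, planarSpeed] at hξ
    rw [hDl ξ hξ, ← ha]
    exact Prod.ext rfl (by simp)
  · intro ξ hξ
    simp only [Family.sign, neg_one_mul, planarSpeed] at hξ
    rw [hDr ξ hξ, ← hb]
    exact Prod.ext rfl h3.symm
  · intro ξ hξ
    simp only [Family.sign, neg_one_mul, planarSpeed] at hξ
    obtain ⟨e1, δ, hδ, e2⟩ := hDf ξ hξ
    have e3 : M.lam (s * D ξ) d₀ = -ξ := by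
      rw [← M.lam_abs, abs_mul, hs, one_mul, M.lam_abs, e1]
    refine ⟨by simp only [Family.sign, planarSpeed, e3]; ring, (s * δ, ξ * (s * δ)), ?_, ?_, ?_⟩
    · intro e
      exact mul_ne_zero hs0 hδ (congrArg Prod.fst e)
    · have g1 := e2.const_mul s
      have g2 := (HasDerivAt.comp ξ (M.hasDerivAt_lamInt d₀ (s * D ξ)) g1).const_sub
        (a.2 + M.lamInt d₀ a.1)
      refine (g1.prodMk g2).congr_deriv ?_
      rw [e3, neg_mul, neg_neg]
    · rw [fderiv_planarFlux_eq_smul]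
      refine ⟨rfl, ?_⟩
      simp only [e3]; ring

/-! ### Classification of the slow waves -/

/-- On this interval a - b has the sign of a or is 0, so the jump σ(b - a) of H is sgn(a) times the
square root defining S. -/
theorem neg_sqrt_chord_mul (M : Medium) (d₀ : ℝ) {a b : ℝ} (ha : a ≠ 0)
    (hb : b ∈ uIcc (M.dStar a d₀) a) :
    -Real.sqrt (M.chord d₀ a b) * (b - a) = Real.sign a * M.S a b d₀ := by
  rcases eq_or_ne a b with rfl | hab
  · simp [S_self]
  have h1 : M.S a b d₀ = Real.sqrt (M.chord d₀ a b) * |a - b| := by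
    have : (M.f a d₀ - M.f b d₀) * (a - b) = M.chord d₀ a b * (a - b) ^ 2 := by
      have := sub_ne_zero.2 hab
      rw [chord]; field_simp
    rw [S, this, Real.sqrt_mul (M.chord_pos d₀ hab).le, Real.sqrt_sq_eq_abs]
  rw [h1]
  have h2 := M.mul_dStar_neg d₀ ha
  rcases lt_or_gt_of_ne ha with ha | ha
  · have h3 : 0 < M.dStar a d₀ := pos_of_mul_neg_right h2 ha.le
    rw [uIcc_of_ge (ha.trans h3).le] at hb
    rw [Real.sign_of_neg ha, abs_of_nonpos (sub_nonpos.2 hb.1)]; ring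
  · have h3 : M.dStar a d₀ < 0 := neg_of_mul_neg_right h2 ha.le
    rw [uIcc_of_le (h3.trans ha).le] at hb
    rw [Real.sign_of_pos ha, abs_of_nonneg (sub_nonneg.2 hb.2)]; ring

/-- These bounds separate shocks from fans, for which |b| > |a|, and from composite waves, for which
|b| > |d_*(a)| with ab < 0. -/
theorem abs_le_of_mem_uIcc_dStar (M : Medium) (d₀ : ℝ) {a b : ℝ} (ha : a ≠ 0)
    (hb : b ∈ uIcc (M.dStar a d₀) a) : |b| ≤ |a| ∧ (a * b < 0 → |b| ≤ |M.dStar a d₀|) := by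
  have h2 := M.mul_dStar_neg d₀ ha
  have h4 := M.abs_dStar_lt (d₀ := d₀) ha
  rcases lt_or_gt_of_ne ha with ha | ha
  · have h3 : 0 < M.dStar a d₀ := pos_of_mul_neg_right h2 ha.le
    rw [uIcc_of_ge (ha.trans h3).le] at hb
    rw [abs_of_pos h3] at h4 ⊢
    rw [abs_of_neg ha] at h4 ⊢
    refine ⟨abs_le.2 ⟨by linarith [hb.1], hb.2.trans h4.le⟩, fun h => ?_⟩
    rw [abs_of_pos (pos_of_mul_neg_right h ha.le)]; exact hb.2
  · have h3 : M.dStar a d₀ < 0 := neg_of_mul_neg_right h2 ha.le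
    rw [uIcc_of_le (h3.trans ha).le] at hb
    rw [abs_of_neg h3] at h4 ⊢
    rw [abs_of_pos ha] at h4 ⊢
    refine ⟨abs_le.2 ⟨by linarith [hb.1], hb.2⟩, fun h => ?_⟩
    rw [abs_of_neg (neg_of_mul_neg_right h ha.le)]; linarith [hb.1]

theorem isPlanarShock_slow_iff_mem (M : Medium) (d₀ : ℝ) {σ : ℝ} {a b : ℝ × ℝ} :
    M.IsPlanarShock d₀ .slow σ a b ↔
      b.1 ≠ a.1 ∧ σ = -Real.sqrt (M.chord d₀ a.1 b.1) ∧ b.2 = a.2 + M.waveFn a.1 b.1 d₀ ∧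
      a.1 ≠ 0 ∧ b.1 ∈ uIcc (M.dStar a.1 d₀) a.1 := by
  rw [isPlanarShock_slow_iff]
  constructor
  · rintro ⟨h1, h2, h3, h4⟩
    obtain ⟨h5, h6⟩ := (M.liuChord_iff d₀ h1.symm).1 h4
    refine ⟨h1.symm, h2, ?_, h5, h6⟩
    rw [M.waveFn_of_mem h5 h6, ← M.neg_sqrt_chord_mul d₀ h5 h6, ← h2]
    linarith
  · rintro ⟨h1, h2, h3, h5, h6⟩
    refine ⟨h1.symm, h2, ?_, (M.liuChord_iff d₀ h1).2 ⟨h5, h6⟩⟩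
    rw [M.waveFn_of_mem h5 h6, ← M.neg_sqrt_chord_mul d₀ h5 h6, ← h2] at h3
    linarith

/-- The state at which the rarefaction of a slow composite wave starts. -/
def touchState (M : Medium) (d₀ : ℝ) (a : ℝ × ℝ) : ℝ × ℝ :=
  (M.dStar a.1 d₀, a.2 + M.waveFn a.1 (M.dStar a.1 d₀) d₀)

theorem sqrt_chord_dStar (M : Medium) (d₀ : ℝ) {a : ℝ} (ha : a ≠ 0) :
    Real.sqrt (M.chord d₀ a (M.dStar a d₀)) = M.lam (M.dStar a d₀) d₀ := by
  rw [M.chord_dStar d₀ ha, Real.sqrt_sq (M.lam_pos _ _).le]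

theorem isPlanarShock_touchState (M : Medium) (d₀ : ℝ) {a : ℝ × ℝ} (ha : a.1 ≠ 0) :
    M.IsPlanarShock d₀ .slow (-M.lam (M.dStar a.1 d₀) d₀) a (M.touchState d₀ a) := by
  refine (M.isPlanarShock_slow_iff_mem d₀).2 ⟨?_, ?_, rfl, ha, left_mem_uIcc⟩
  · intro h
    have := M.mul_dStar_neg d₀ ha
    have h : M.dStar a.1 d₀ = a.1 := h
    rw [h] at this
    exact absurd this (not_lt.2 (mul_self_nonneg _))
  · exact congrArg _ (M.sqrt_chord_dStar d₀ ha).symm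

/-- A sonic shock must end at d_*, so the intermediate state of a composite wave is determined by
its left state. -/
theorem eq_touchState (M : Medium) (d₀ : ℝ) {σ : ℝ} {a b : ℝ × ℝ}
    (h : M.IsPlanarShock d₀ .slow σ a b) (hσ : σ = -M.lam b.1 d₀) :
    a.1 ≠ 0 ∧ b = M.touchState d₀ a := by
  obtain ⟨h1, h2, h3, h4, h5⟩ := (M.isPlanarShock_slow_iff_mem d₀).1 h
  have hb : b.1 = M.dStar a.1 d₀ := by
    refine M.eq_dStar_of_chord_eq d₀ h4 h1 h5 ?_
    have : M.lam b.1 d₀ = Real.sqrt (M.chord d₀ a.1 b.1) := by linarith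
    rw [this, Real.sq_sqrt (M.chord_pos d₀ h1.symm).le]
  refine ⟨h4, Prod.ext hb ?_⟩
  rw [h3, hb]; rfl

theorem IsPlanarWave.slow_cases {d₀ : ℝ} {a b : ℝ × ℝ} {W : ℝ → ℝ × ℝ}
    (h : M.IsPlanarWave d₀ .slow a b W) :
    (a = b ∧ ∀ ξ, W ξ = a) ∨
    M.IsPlanarRarefaction d₀ .slow a b W ∨
    ((b.1 ≠ a.1 ∧ a.1 ≠ 0 ∧ b.1 ∈ uIcc (M.dStar a.1 d₀) a.1) ∧
      b.2 = a.2 + M.waveFn a.1 b.1 d₀ ∧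
      (∀ ξ < -Real.sqrt (M.chord d₀ a.1 b.1), W ξ = a) ∧
      ∀ ξ, -Real.sqrt (M.chord d₀ a.1 b.1) < ξ → W ξ = b) ∨
    (a.1 ≠ 0 ∧ ∃ Wr, M.IsPlanarRarefaction d₀ .slow (M.touchState d₀ a) b Wr ∧
      (∀ ξ < -M.lam (M.dStar a.1 d₀) d₀, W ξ = a) ∧
      ∀ ξ, -M.lam (M.dStar a.1 d₀) d₀ < ξ → W ξ = Wr ξ) := by
  cases h with
  | trivial _ _ _ h => exact .inl ⟨rfl, h⟩
  | shock _ _ _ _ σ h left right =>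
    obtain ⟨h1, h2, h3, h4, h5⟩ := (M.isPlanarShock_slow_iff_mem d₀).1 h
    rw [h2] at left right
    exact .inr (.inr (.inl ⟨⟨h1, h4, h5⟩, h3, left, right⟩))
  | rarefaction _ _ _ _ h => exact .inr (.inl h)
  | slowComposite _ um _ _ Wr σ hs hσ hr left right =>
    obtain ⟨h1, h2⟩ := M.eq_touchState d₀ hs hσ
    rw [h2] at hr hσ
    have hσ : σ = -M.lam (M.dStar a.1 d₀) d₀ := hσ
    rw [hσ] at left right
    exact .inr (.inr (.inr ⟨h1, Wr, hr, left, right⟩))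

theorem touchState_facts {d₀ : ℝ} {a b : ℝ × ℝ} {W : ℝ → ℝ × ℝ} (ha : a.1 ≠ 0)
    (h : M.IsPlanarRarefaction d₀ .slow (M.touchState d₀ a) b W) :
    |M.dStar a.1 d₀| < |b.1| ∧ a.1 * b.1 < 0 := by
  have h1 := h.abs_lt
  have h2 := h.mul_nonneg
  have h3 := M.mul_dStar_neg d₀ ha
  simp only [touchState] at h1 h2
  refine ⟨h1, ?_⟩
  have hb : b.1 ≠ 0 := fun e => by
    rw [e, abs_zero] at h1
    exact absurd h1 (not_lt.2 (abs_nonneg _))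
  by_contra! h4
  have h5 : 0 < a.1 * b.1 := lt_of_le_of_ne h4 (mul_ne_zero ha hb).symm
  have h6 := mul_pos_of_neg_of_neg h3 (neg_neg_of_pos h5)
  -- `h6` says -a² (d_* b) > 0, while `h2` says d_* b ≥ 0.
  nlinarith [mul_pos_iff_of_pos_left (sq_pos_of_ne_zero ha) |>.2 (sq_pos_of_ne_zero hb),
    mul_nonneg (sq_nonneg a.1) h2]

theorem IsPlanarWave.slow_snd {d₀ : ℝ} {a b : ℝ × ℝ} {W : ℝ → ℝ × ℝ}
    (h : M.IsPlanarWave d₀ .slow a b W) : b.2 = a.2 + M.waveFn a.1 b.1 d₀ := by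
  rcases h.slow_cases with ⟨rfl, -⟩ | h | ⟨-, h, -⟩ | ⟨ha, Wr, h, -⟩
  · rw [M.waveFn_of_abs_le le_rfl (mul_self_nonneg _)]; ring
  · rw [M.waveFn_of_abs_le h.abs_lt.le h.mul_nonneg, h.snd_eq]; ring
  · exact h
  · obtain ⟨h1, h2⟩ := touchState_facts ha h
    rw [M.waveFn_of_lt_abs h1.le h2, h.snd_eq]
    simp only [touchState]
    rw [M.waveFn_of_mem ha left_mem_uIcc]; ring

theorem ae_eq_of_eq_off_point {α : Type*} {g h : ℝ → α} (σ : ℝ) (h1 : ∀ ξ < σ, g ξ = h ξ)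
    (h2 : ∀ ξ, σ < ξ → g ξ = h ξ) : g =ᵐ[volume] h := by
  have : ∀ᵐ ξ : ℝ, ξ ≠ σ := by simp [ae_iff, measure_singleton]
  filter_upwards [this] with ξ hξ
  rcases lt_or_gt_of_ne hξ with h | h
  · exact h1 ξ h
  · exact h2 ξ h

/-- The position of b relative to a and d_*(a) decides the type: the four alternatives of
`slow_cases` exclude one another, which settles the off-diagonal pairs. Equality holds only almost
everywhere because a profile is arbitrary at its shock speed. -/
theorem IsPlanarWave.slow_unique {d₀ : ℝ} {a b : ℝ × ℝ} {W W' : ℝ → ℝ × ℝ}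
    (h : M.IsPlanarWave d₀ .slow a b W) (h' : M.IsPlanarWave d₀ .slow a b W') :
    W =ᵐ[volume] W' := by
  rcases h.slow_cases with ⟨e, h⟩ | h | ⟨⟨e1, e2, e3⟩, -, l, r⟩ | ⟨ha, Wr, h, l, r⟩ <;>
  rcases h'.slow_cases with ⟨e', h'⟩ | h' | ⟨⟨e1', e2', e3'⟩, -, l', r'⟩ | ⟨ha', Wr', h', l', r'⟩
  · exact Eventually.of_forall fun ξ => (h ξ).trans (h' ξ).symm
  · rw [e] at h'; exact absurd h'.abs_lt (lt_irrefl _)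
  · rw [e] at e1'; exact absurd rfl e1'
  · rw [← e] at h'; exact absurd (touchState_facts ha' h').2 (not_lt.2 (mul_self_nonneg _))
  · rw [e'] at h; exact absurd h.abs_lt (lt_irrefl _)
  · rw [h.unique h']
  · exact absurd h.abs_lt (not_lt.2 (M.abs_le_of_mem_uIcc_dStar d₀ e2' e3').1)
  · exact absurd (touchState_facts ha' h').2 (not_lt.2 h.mul_nonneg)
  · rw [e'] at e1; exact absurd rfl e1
  · exact absurd h'.abs_lt (not_lt.2 (M.abs_le_of_mem_uIcc_dStar d₀ e2 e3).1)
  · exact ae_eq_of_eq_off_point _ (fun ξ hξ => (l ξ hξ).trans (l' ξ hξ).symm)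
      fun ξ hξ => (r ξ hξ).trans (r' ξ hξ).symm
  · obtain ⟨g1, g2⟩ := touchState_facts ha' h'
    exact absurd g1 (not_lt.2 ((M.abs_le_of_mem_uIcc_dStar d₀ e2 e3).2 g2))
  · rw [← e'] at h; exact absurd (touchState_facts ha h).2 (not_lt.2 (mul_self_nonneg _))
  · exact absurd (touchState_facts ha h).2 (not_lt.2 h'.mul_nonneg)
  · obtain ⟨g1, g2⟩ := touchState_facts ha h
    exact absurd g1 (not_lt.2 ((M.abs_le_of_mem_uIcc_dStar d₀ e2' e3').2 g2))
  · rw [h.unique h'] at r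
    exact ae_eq_of_eq_off_point _ (fun ξ hξ => (l ξ hξ).trans (l' ξ hξ).symm)
      fun ξ hξ => (r ξ hξ).trans (r' ξ hξ).symm

/-- The three cases of φ correspond to a fan, a shock and a composite wave; the boundary case d = a
of the first is the trivial wave. -/
theorem exists_isPlanarWave_slow (M : Medium) (d₀ : ℝ) (a : ℝ × ℝ) (d : ℝ) :
    ∃ W, M.IsPlanarWave d₀ .slow a (d, a.2 + M.waveFn a.1 d d₀) W := by
  by_cases h1 : |a.1| ≤ |d| ∧ 0 ≤ a.1 * d
  · have hw := M.waveFn_of_abs_le (d₀ := d₀) h1.1 h1.2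
    rcases eq_or_lt_of_le h1.1 with h2 | h2
    · have h3 : d = a.1 := by
        rcases abs_eq_abs.1 h2 with h3 | h3
        · exact h3.symm
        · have h4 := h1.2
          rw [h3] at h4 ⊢
          have : d = 0 := by nlinarith
          rw [this, neg_zero]
      refine ⟨fun _ => a, ?_⟩
      have : (d, a.2 + M.waveFn a.1 d d₀) = a := by
        rw [hw, h3, sub_self, add_zero]
      rw [this]
      exact .trivial _ _ _ fun _ => rfl
    · obtain ⟨W, hW⟩ := M.exists_isPlanarRarefaction d₀ (a := a)
        (b := (d, a.2 + M.waveFn a.1 d d₀)) h2 h1.2 (by simp only [hw]; ring)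
      exact ⟨W, .rarefaction _ _ _ _ hW⟩
  have ha : a.1 ≠ 0 := fun h => h1 (by simp [h])
  by_cases h2 : d ∈ uIcc (M.dStar a.1 d₀) a.1
  · have h3 : d ≠ a.1 := by
      rintro rfl
      exact h1 ⟨le_rfl, mul_self_nonneg _⟩
    have hs : M.IsPlanarShock d₀ .slow (-Real.sqrt (M.chord d₀ a.1 d)) a
        (d, a.2 + M.waveFn a.1 d d₀) :=
      (M.isPlanarShock_slow_iff_mem d₀).2 ⟨h3, rfl, rfl, ha, h2⟩
    refine ⟨fun ξ => if ξ < -Real.sqrt (M.chord d₀ a.1 d) then a else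
      (d, a.2 + M.waveFn a.1 d d₀), .shock _ _ _ _ _ hs ?_ ?_⟩
    · intro ξ hξ; rw [if_pos hξ]
    · intro ξ hξ; rw [if_neg hξ.not_gt]
  · have h3 : a.1 * d < 0 ∧ |M.dStar a.1 d₀| < |d| := by
      have g1 := M.mul_dStar_neg d₀ ha
      rcases lt_or_gt_of_ne ha with ha | ha
      · have g2 : 0 < M.dStar a.1 d₀ := pos_of_mul_neg_right g1 ha.le
        have g3 : M.dStar a.1 d₀ < d := by
          by_contra! g4
          rw [uIcc_of_ge (ha.trans g2).le] at h2
          have g5 : d < a.1 := by by_contra! g5; exact h2 ⟨g5, g4⟩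
          have g6 : d < 0 := g5.trans ha
          exact h1 ⟨by rw [abs_of_neg ha, abs_of_neg g6]; linarith,
            (mul_pos_of_neg_of_neg ha g6).le⟩
        rw [abs_of_pos g2, abs_of_pos (g2.trans g3)]
        exact ⟨mul_neg_of_neg_of_pos ha (g2.trans g3), g3⟩
      · have g2 : M.dStar a.1 d₀ < 0 := neg_of_mul_neg_right g1 ha.le
        have g3 : d < M.dStar a.1 d₀ := by
          by_contra! g4
          rw [uIcc_of_le (g2.trans ha).le] at h2
          have g5 : a.1 < d := by by_contra! g5; exact h2 ⟨g4, g5⟩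
          have g6 : 0 < d := ha.trans g5
          exact h1 ⟨by rw [abs_of_pos ha, abs_of_pos g6]; linarith, (mul_pos ha g6).le⟩
        rw [abs_of_neg g2, abs_of_neg (g3.trans g2)]
        exact ⟨mul_neg_of_pos_of_neg ha (g3.trans g2), by linarith⟩
    obtain ⟨Wr, hr⟩ := M.exists_isPlanarRarefaction d₀ (a := M.touchState d₀ a)
      (b := (d, a.2 + M.waveFn a.1 d d₀)) h3.2 (by
        have g1 := M.mul_dStar_neg d₀ ha
        have g2 := mul_pos_of_neg_of_neg g1 h3.1
        have g3 : 0 < a.1 ^ 2 := sq_pos_of_ne_zero ha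
        show 0 ≤ M.dStar a.1 d₀ * d
        by_contra! g4
        nlinarith) (by
        simp only [touchState]
        rw [M.waveFn_of_lt_abs h3.2.le h3.1, M.waveFn_of_mem ha left_mem_uIcc]; ring)
    refine ⟨fun ξ => if ξ < -M.lam (M.dStar a.1 d₀) d₀ then a else Wr ξ,
      .slowComposite _ _ _ _ _ _ (M.isPlanarShock_touchState d₀ ha) rfl hr ?_ ?_⟩
    · intro ξ hξ; rw [if_pos hξ]
    · intro ξ hξ; rw [if_neg hξ.not_gt]

/-! ### Fast waves -/

theorem IsPlanarWave.fast_snd {d₀ : ℝ} {a b : ℝ × ℝ} {W : ℝ → ℝ × ℝ}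
    (h : M.IsPlanarWave d₀ .fast a b W) : a.2 = b.2 - M.waveFn b.1 a.1 d₀ := by
  have := (IsPlanarWave.reflect h).slow_snd
  simp only [Medium.reflect] at this
  linarith

theorem IsPlanarWave.fast_unique {d₀ : ℝ} {a b : ℝ × ℝ} {W W' : ℝ → ℝ × ℝ}
    (h : M.IsPlanarWave d₀ .fast a b W) (h' : M.IsPlanarWave d₀ .fast a b W') :
    W =ᵐ[volume] W' := by
  have h1 := IsPlanarWave.slow_unique (IsPlanarWave.reflect h) (IsPlanarWave.reflect h')
  have h2 := (Measure.measurePreserving_neg (volume : Measure ℝ)).quasiMeasurePreserving.ae h1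
  filter_upwards [h2] with ξ hξ
  simp only [neg_neg] at hξ
  rw [← reflect_reflect (W ξ), hξ, reflect_reflect]

theorem exists_isPlanarWave_fast (M : Medium) (d₀ : ℝ) (b : ℝ × ℝ) (d : ℝ) :
    ∃ W, M.IsPlanarWave d₀ .fast (d, b.2 - M.waveFn b.1 d d₀) b W := by
  obtain ⟨W, hW⟩ := M.exists_isPlanarWave_slow d₀ (reflect b) d
  have h := IsPlanarWave.reflect hW
  rw [reflect_reflect] at h
  have e : reflect (d, (reflect b).2 + M.waveFn (reflect b).1 d d₀) =
      (d, b.2 - M.waveFn b.1 d d₀) := by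
    simp only [reflect, Prod.mk.injEq, true_and]; ring
  rw [e] at h
  exact ⟨_, h⟩

end Medium

/-! ## Self-similar weak solutions -/

section Weak

variable {E : Type*} [NormedAddCommGroup E] [NormedSpace ℝ E]

/-- `Φ` is a continuous primitive of `-V` that coincides with `F(V) - ξ V`, off finitely many
values of `ξ`, and `V` is a bounded profile, piecewise continuous, and constant near `±∞`. -/
structure IsBalanced (F : E → E) (uL uR : E) (V Φ : ℝ → E) (N : Set ℝ) (C : ℝ) : Prop where
  finite : N.Finite
  continuous : Continuous Φ
  continuousAt : ∀ ξ ∉ N, ContinuousAt V ξ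
  continuousAt_flux : ∀ ξ ∉ N, ContinuousAt (fun ξ => F (V ξ)) ξ
  hasDerivAt : ∀ ξ ∉ N, HasDerivAt Φ (-V ξ) ξ
  eq : ∀ ξ ∉ N, Φ ξ = F (V ξ) - ξ • V ξ
  norm_le : ∀ ξ ∉ N, ‖V ξ‖ ≤ C
  norm_flux_le : ∀ ξ ∉ N, ‖F (V ξ)‖ ≤ C
  left : ∀ᶠ ξ in atBot, V ξ = uL
  right : ∀ᶠ ξ in atTop, V ξ = uR

theorem IsBalanced.const (F : E → E) (u : E) {V : ℝ → E} (h : ∀ ξ, V ξ = u) :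
    IsBalanced F u u V (fun ξ => F u - ξ • u) ∅ (max ‖u‖ ‖F u‖) := by
  obtain rfl : V = fun _ => u := funext h
  refine ⟨finite_empty, by fun_prop, fun _ _ => continuousAt_const, fun _ _ => continuousAt_const,
    fun ξ _ => ?_, fun _ _ => rfl, fun _ _ => le_max_left _ _, fun _ _ => le_max_right _ _,
    Eventually.of_forall fun _ => rfl, Eventually.of_forall fun _ => rfl⟩
  simpa using ((hasDerivAt_id ξ).smul_const u).const_sub (F u)

/-- Matching the primitives at σ is the Rankine-Hugoniot relation in the form F(u_l) - σu_l = F(u_r)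
- σu_r. The value of V at σ plays no role, since σ joins the exceptional set. -/
theorem IsBalanced.glue {F : E → E} {uL um um' uR : E} {V₁ V₂ V Φ₁ Φ₂ : ℝ → E} {N₁ N₂ : Set ℝ}
    {C₁ C₂ : ℝ} (σ : ℝ) (h₁ : IsBalanced F uL um V₁ Φ₁ N₁ C₁) (h₂ : IsBalanced F um' uR V₂ Φ₂ N₂ C₂)
    (hσ : Φ₁ σ = Φ₂ σ) (left : ∀ ξ < σ, V ξ = V₁ ξ) (right : ∀ ξ, σ < ξ → V ξ = V₂ ξ) :
    IsBalanced F uL uR V (fun ξ => if ξ ≤ σ then Φ₁ ξ else Φ₂ ξ) ({σ} ∪ N₁ ∪ N₂) (max C₁ C₂) := by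
  have hev₁ : ∀ ξ < σ, ∀ᶠ η in 𝓝 ξ, η < σ := fun ξ hξ => Iio_mem_nhds hξ
  have hev₂ : ∀ ξ, σ < ξ → ∀ᶠ η in 𝓝 ξ, σ < η := fun ξ hξ => Ioi_mem_nhds hξ
  have hN : ∀ ξ ∉ ({σ} ∪ N₁ ∪ N₂ : Set ℝ), (ξ < σ ∧ ξ ∉ N₁) ∨ (σ < ξ ∧ ξ ∉ N₂) := by
    intro ξ hξ
    simp only [mem_union, mem_singleton_iff, not_or] at hξ
    rcases lt_or_gt_of_ne hξ.1.1 with h | h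
    · exact .inl ⟨h, hξ.1.2⟩
    · exact .inr ⟨h, hξ.2⟩
  refine ⟨((finite_singleton σ).union h₁.finite).union h₂.finite, ?_, ?_, ?_, ?_, ?_, ?_, ?_, ?_, ?_⟩
  · exact h₁.continuous.if_le h₂.continuous continuous_id continuous_const fun x hx => by
      rw [hx, hσ]
  · intro ξ hξ
    rcases hN ξ hξ with ⟨h, hn⟩ | ⟨h, hn⟩
    · exact (h₁.continuousAt ξ hn).congr ((hev₁ ξ h).mono fun η hη => (left η hη).symm)
    · exact (h₂.continuousAt ξ hn).congr ((hev₂ ξ h).mono fun η hη => (right η hη).symm)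
  · intro ξ hξ
    rcases hN ξ hξ with ⟨h, hn⟩ | ⟨h, hn⟩
    · exact (h₁.continuousAt_flux ξ hn).congr
        ((hev₁ ξ h).mono fun η hη => congrArg F (left η hη).symm)
    · exact (h₂.continuousAt_flux ξ hn).congr
        ((hev₂ ξ h).mono fun η hη => congrArg F (right η hη).symm)
  · intro ξ hξ
    rcases hN ξ hξ with ⟨h, hn⟩ | ⟨h, hn⟩
    · rw [left ξ h]
      exact (h₁.hasDerivAt ξ hn).congr_of_eventuallyEq
        ((hev₁ ξ h).mono fun η hη => if_pos hη.le)
    · rw [right ξ h]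
      exact (h₂.hasDerivAt ξ hn).congr_of_eventuallyEq
        ((hev₂ ξ h).mono fun η hη => if_neg hη.not_ge)
  · intro ξ hξ
    rcases hN ξ hξ with ⟨h, hn⟩ | ⟨h, hn⟩
    · rw [left ξ h, if_pos h.le, h₁.eq ξ hn]
    · rw [right ξ h, if_neg h.not_ge, h₂.eq ξ hn]
  · intro ξ hξ
    rcases hN ξ hξ with ⟨h, hn⟩ | ⟨h, hn⟩
    · rw [left ξ h]; exact (h₁.norm_le ξ hn).trans (le_max_left _ _)
    · rw [right ξ h]; exact (h₂.norm_le ξ hn).trans (le_max_right _ _)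
  · intro ξ hξ
    rcases hN ξ hξ with ⟨h, hn⟩ | ⟨h, hn⟩
    · rw [left ξ h]; exact (h₁.norm_flux_le ξ hn).trans (le_max_left _ _)
    · rw [right ξ h]; exact (h₂.norm_flux_le ξ hn).trans (le_max_right _ _)
  · filter_upwards [h₁.left, eventually_lt_atBot σ] with ξ h hξ
    rw [left ξ hξ, h]
  · filter_upwards [h₂.right, eventually_gt_atTop σ] with ξ h hξ
    rw [right ξ hξ, h]

theorem IsLiuShock.isBalanced {F : E → E} {coord : E → ℝ} {k : Family} {σ : ℝ} {uL uR : E}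
    {V : ℝ → E} (h : IsLiuShock F coord k σ uL uR) (left : ∀ ξ < σ, V ξ = uL)
    (right : ∀ ξ, σ < ξ → V ξ = uR) :
    ∃ N C, IsBalanced F uL uR V (fun ξ => if ξ ≤ σ then F uL - ξ • uL else F uR - ξ • uR) N C := by
  have hRH : σ • (uR - uL) = F uR - F uL := h.rankineHugoniot
  refine ⟨_, _, (IsBalanced.const F uL fun _ => rfl).glue σ (IsBalanced.const F uR fun _ => rfl)
    ?_ left right⟩
  rw [smul_sub] at hRH
  rw [sub_eq_sub_iff_sub_eq_sub, ← neg_inj, neg_sub, neg_sub]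
  exact hRH.symm

/-- In the fan F'(W)W' = ξW', so the derivative of F(W) - ξW is ξW' - W - ξW' = -W. -/
theorem IsRarefaction.isBalanced {F : E → E} {lam : E → ℝ} {k : Family} {uL uR : E} {W : ℝ → E}
    (hF : Differentiable ℝ F) (h : IsRarefaction F lam k uL uR W) :
    ∃ N C, IsBalanced F uL uR W (fun ξ => F (W ξ) - ξ • W ξ) N C := by
  have hFW : Continuous fun ξ => F (W ξ) := hF.continuous.comp h.continuous
  -- Outside the fan W keeps its edge values, so a bound on the compact fan is a global one.
  have hbd : ∀ g : E → E, Continuous (fun ξ => g (W ξ)) → ∃ C, ∀ ξ, ‖g (W ξ)‖ ≤ C := by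
    intro g hg
    obtain ⟨C, hC⟩ := (isCompact_Icc (a := k.sign * lam uL)
      (b := k.sign * lam uR)).exists_bound_of_continuousOn hg.continuousOn
    refine ⟨C, fun ξ => ?_⟩
    have h1 := hC _ (left_mem_Icc.2 h.speed_lt.le)
    have h2 := hC _ (right_mem_Icc.2 h.speed_lt.le)
    rcases le_total ξ (k.sign * lam uL) with hξ | hξ
    · rw [h.left ξ hξ, ← h.left _ le_rfl]; exact h1
    · rcases le_total (k.sign * lam uR) ξ with hξ' | hξ'
      · rw [h.right ξ hξ', ← h.right _ le_rfl]; exact h2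
      · exact hC ξ ⟨hξ, hξ'⟩
  obtain ⟨C₁, h₁⟩ := hbd id h.continuous
  obtain ⟨C₂, h₂⟩ := hbd F hFW
  refine ⟨{k.sign * lam uL, k.sign * lam uR}, max C₁ C₂, by simp, ?_,
    fun _ _ => h.continuous.continuousAt, fun _ _ => hFW.continuousAt, ?_, fun _ _ => rfl,
    fun ξ _ => (h₁ ξ).trans (le_max_left _ _), fun ξ _ => (h₂ ξ).trans (le_max_right _ _),
    (eventually_le_atBot _).mono h.left, (eventually_ge_atTop _).mono h.right⟩
  · exact hFW.sub (continuous_id.smul h.continuous)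
  · intro ξ hξ
    have hconst : ∀ u : E, (∀ᶠ η in 𝓝 ξ, W η = u) →
        HasDerivAt (fun ξ => F (W ξ) - ξ • W ξ) (-W ξ) ξ := by
      intro u hu
      rw [hu.self_of_nhds]
      have h2 : HasDerivAt (fun ξ : ℝ => F u - ξ • u) (-u) ξ := by
        simpa using ((hasDerivAt_id ξ).smul_const u).const_sub (F u)
      exact h2.congr_of_eventuallyEq (hu.mono fun η hη => by simp only [hη])
    simp only [mem_insert_iff, mem_singleton_iff, not_or] at hξ
    rcases lt_or_gt_of_ne hξ.1 with h1 | h1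
    · exact hconst uL ((eventually_lt_nhds h1).mono fun η hη => h.left η hη.le)
    · rcases lt_or_gt_of_ne hξ.2 with h2 | h2
      · obtain ⟨-, w, -, hd, he⟩ := h.fan ξ ⟨h1, h2⟩
        have h3 : HasDerivAt (fun ξ => F (W ξ)) (ξ • w) ξ := by
          rw [← he]
          exact (hF (W ξ)).hasFDerivAt.comp_hasDerivAt ξ hd
        refine (h3.sub ((hasDerivAt_id ξ).smul hd)).congr_deriv ?_
        simp
      · exact hconst uR ((eventually_gt_nhds h2).mono fun η hη => h.right η hη.le)

/-- The values at ξ = 0 serve to glue the two waves there: slow waves end before 0 and fast waves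
start after it, so Φ(0) is the flux of the adjacent intermediate state, and the contact condition is
equality of these fluxes. -/
theorem IsWave.isBalanced {F : E → E} {lam coord : E → ℝ} {k : Family} {uL uR : E} {W : ℝ → E}
    (hF : Differentiable ℝ F) (hlam : ∀ u, 0 < lam u) (h : IsWave F lam coord k uL uR W) :
    ∃ Φ N C, IsBalanced F uL uR W Φ N C ∧ (k = .slow → Φ 0 = F uR) ∧ (k = .fast → Φ 0 = F uL) := by
  have hshock : ∀ {σ : ℝ} {uL uR : E}, IsLiuShock F coord k σ uL uR →
      (k = .slow → ¬(0 ≤ σ)) ∧ (k = .fast → 0 ≤ σ) := by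
    intro σ uL uR hs
    have := hs.sign
    constructor
    · rintro rfl; simp only [Family.sign] at this; linarith
    · rintro rfl; simp only [Family.sign] at this; linarith
  cases h with
  | trivial _ u _ h =>
    exact ⟨_, _, _, IsBalanced.const F _ h, fun _ => by simp, fun _ => by simp⟩
  | shock _ _ _ _ σ h left right =>
    obtain ⟨N, C, hb⟩ := h.isBalanced left right
    refine ⟨_, N, C, hb, fun hk => ?_, fun hk => ?_⟩
    · simp only [if_neg ((hshock h).1 hk), zero_smul, sub_zero]
    · simp only [if_pos ((hshock h).2 hk), zero_smul, sub_zero]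
  | rarefaction _ _ _ _ h =>
    obtain ⟨N, C, hb⟩ := h.isBalanced hF
    refine ⟨_, N, C, hb, ?_, ?_⟩
    · rintro rfl
      rw [zero_smul, sub_zero, h.right 0 (by simpa [Family.sign] using (hlam uR).le)]
    · rintro rfl
      rw [zero_smul, sub_zero, h.left 0 (by simpa [Family.sign] using (hlam uL).le)]
  | slowComposite _ um _ _ Wr σ hs hσ hr left right =>
    obtain ⟨N, C, hb⟩ := hr.isBalanced hF
    refine ⟨_, _, _, (IsBalanced.const F uL fun _ => rfl).glue σ hb ?_ left right,
      fun _ => ?_, nofun⟩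
    · have hRH : σ • (um - uL) = F um - F uL := hs.rankineHugoniot
      rw [hr.left σ (by rw [hσ, Family.sign, neg_one_mul])]
      rw [smul_sub] at hRH
      rw [sub_eq_sub_iff_sub_eq_sub, ← neg_inj, neg_sub, neg_sub]
      exact hRH.symm
    · rw [if_neg ((hshock hs).1 rfl), zero_smul, sub_zero,
        hr.right 0 (by simpa [Family.sign] using (hlam uR).le)]
  | fastComposite _ um _ _ Wr σ hr hσ hs left right =>
    obtain ⟨N, C, hb⟩ := hr.isBalanced hF
    refine ⟨_, _, _, hb.glue σ (IsBalanced.const F uR fun _ => rfl) ?_ left right,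
      nofun, fun _ => ?_⟩
    · have hRH : σ • (uR - um) = F uR - F um := hs.rankineHugoniot
      rw [hr.right σ (by rw [hσ, Family.sign, one_mul])]
      rw [smul_sub] at hRH
      rw [sub_eq_sub_iff_sub_eq_sub, ← neg_inj, neg_sub, neg_sub]
      exact hRH.symm
    · rw [if_pos ((hshock hs).2 rfl), zero_smul, sub_zero,
        hr.left 0 (by simpa [Family.sign] using (hlam uL).le)]

theorem IsSuperposition.isBalanced {F : E → E} {lam coord : E → ℝ} {uL uR u₁ u₂ : E} {V : ℝ → E}
    (hF : Differentiable ℝ F) (hlam : ∀ u, 0 < lam u)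
    (h : IsSuperposition F lam coord uL uR V u₁ u₂) :
    ∃ Φ N C, IsBalanced F uL uR V Φ N C := by
  obtain ⟨W₁, hW₁, left⟩ := h.slow
  obtain ⟨W₂, hW₂, right⟩ := h.fast
  have hc : (0 : ℝ) • (u₂ - u₁) = F u₂ - F u₁ := h.contact
  rw [zero_smul, eq_comm, sub_eq_zero] at hc
  obtain ⟨Φ₁, N₁, C₁, hb₁, e₁, -⟩ := hW₁.isBalanced hF hlam
  obtain ⟨Φ₂, N₂, C₂, hb₂, -, e₂⟩ := hW₂.isBalanced hF hlam
  exact ⟨_, _, _, hb₁.glue 0 hb₂ (by rw [e₁ rfl, e₂ rfl, hc]) left right⟩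

end Weak

/-! ### Self-similar functions on the half-plane and their potential -/

section Weak

variable {E : Type*} [NormedAddCommGroup E]

/-- The discontinuities lie on finitely many lines through the origin, which are proper subspaces of
the plane. -/
theorem volume_setOf_div_mem {N : Set ℝ} (hN : N.Finite) :
    volume {z : ℝ × ℝ | 0 < z.1 ∧ z.2 / z.1 ∈ N} = 0 := by
  have hsub : {z : ℝ × ℝ | 0 < z.1 ∧ z.2 / z.1 ∈ N} ⊆
      ⋃ n ∈ N, (LinearMap.ker (LinearMap.snd ℝ ℝ ℝ - n • LinearMap.fst ℝ ℝ ℝ) : Set (ℝ × ℝ)) := by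
    rintro z ⟨h1, h2⟩
    refine mem_biUnion h2 ?_
    simp only [SetLike.mem_coe, LinearMap.mem_ker, LinearMap.sub_apply, LinearMap.snd_apply,
      LinearMap.smul_apply, LinearMap.fst_apply, smul_eq_mul]
    field_simp
    ring
  refine measure_mono_null hsub ((measure_biUnion_null_iff hN.countable).2 fun n _ => ?_)
  refine Measure.addHaar_submodule _ _ fun h => ?_
  have : ((0, 1) : ℝ × ℝ) ∈ LinearMap.ker (LinearMap.snd ℝ ℝ ℝ - n • LinearMap.fst ℝ ℝ ℝ) := by
    rw [h]; trivial
  simp at this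

theorem ae_div_notMem {N : Set ℝ} (hN : N.Finite) :
    ∀ᵐ z : ℝ × ℝ ∂volume.restrict {z | 0 < z.1}, z.2 / z.1 ∉ N := by
  rw [ae_restrict_iff' (measurableSet_lt measurable_const measurable_fst), ae_iff]
  convert volume_setOf_div_mem hN using 3
  simp

theorem aestronglyMeasurable_comp_div {N : Set ℝ} (hN : N.Finite) {X : ℝ → E}
    (hX : ∀ ξ ∉ N, ContinuousAt X ξ) :
    AEStronglyMeasurable (fun z : ℝ × ℝ => X (z.2 / z.1)) (volume.restrict {z | 0 < z.1}) := by
  have hm : MeasurableSet {z : ℝ × ℝ | 0 < z.1} := measurableSet_lt measurable_const measurable_fst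
  have hO : MeasurableSet {z : ℝ × ℝ | 0 < z.1 ∧ z.2 / z.1 ∉ N} :=
    hm.inter ((measurable_snd.div measurable_fst) hN.measurableSet).compl
  have he : ({z : ℝ × ℝ | 0 < z.1} : Set (ℝ × ℝ)) =ᵐ[volume]
      {z : ℝ × ℝ | 0 < z.1 ∧ z.2 / z.1 ∉ N} := by
    have h := ae_div_notMem hN
    rw [ae_restrict_iff' hm] at h
    filter_upwards [h] with z hz
    exact propext ⟨fun h => ⟨h, hz h⟩, fun h => h.1⟩
  rw [Measure.restrict_congr_set he]
  refine ContinuousOn.aestronglyMeasurable (fun z hz => ContinuousAt.continuousWithinAt ?_) hO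
  exact ContinuousAt.comp (f := fun z : ℝ × ℝ => z.2 / z.1) (hX _ hz.2)
    (continuous_snd.continuousAt.div continuous_fst.continuousAt hz.1.ne')

theorem locallyIntegrable_of_norm_le {X : ℝ × ℝ → E} {C : ℝ}
    (hm : AEStronglyMeasurable X (volume.restrict {z : ℝ × ℝ | 0 < z.1}))
    (hC : ∀ᵐ z ∂volume.restrict {z : ℝ × ℝ | 0 < z.1}, ‖X z‖ ≤ C * (1 + |z.1| + |z.2|)) :
    LocallyIntegrable X (volume.restrict {z : ℝ × ℝ | 0 < z.1}) := by
  have hc : Continuous fun z : ℝ × ℝ => C * (1 + |z.1| + |z.2|) := by fun_prop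
  refine LocallyIntegrable.mono hc.locallyIntegrable hm ?_
  filter_upwards [hC] with z hz using hz.trans (le_abs_self _)

variable [NormedSpace ℝ E]

/-- The potential of a self-similar solution: `∂_yU = V(y/t)` and `∂ₜU = -F(V(y/t))`. -/
def potential (Φ : ℝ → E) (z : ℝ × ℝ) : E := -(z.1 • Φ (z.2 / z.1))

/-- The trace of the potential on the line `t = 0`. -/
def potentialTrace (uL uR : E) (y : ℝ) : E := y • (if y < 0 then uL else uR)

theorem continuous_potentialTrace (uL uR : E) : Continuous (potentialTrace uL uR) := by
  have : potentialTrace uL uR = fun y => if 0 ≤ y then y • uR else y • uL := by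
    funext y
    by_cases h : y < 0
    · rw [potentialTrace, if_pos h, if_neg h.not_ge]
    · rw [potentialTrace, if_neg h, if_pos (not_lt.1 h)]
  rw [this]
  exact Continuous.if_le (by fun_prop) (by fun_prop) continuous_const continuous_id fun y hy => by
    rw [← hy, zero_smul, zero_smul]

theorem hasDerivAt_potentialTrace (uL uR : E) {y : ℝ} (hy : y ≠ 0) :
    HasDerivAt (potentialTrace uL uR) (if y < 0 then uL else uR) y := by
  rcases lt_or_gt_of_ne hy with h | h
  · rw [if_pos h]
    have h1 : HasDerivAt (fun y : ℝ => y • uL) uL y := by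
      simpa using (hasDerivAt_id y).smul_const uL
    refine h1.congr_of_eventuallyEq ?_
    filter_upwards [eventually_lt_nhds h] with x hx
    rw [potentialTrace, if_pos hx]
  · rw [if_neg h.not_gt]
    have h1 : HasDerivAt (fun y : ℝ => y • uR) uR y := by
      simpa using (hasDerivAt_id y).smul_const uR
    refine h1.congr_of_eventuallyEq ?_
    filter_upwards [eventually_gt_nhds h] with x hx
    rw [potentialTrace, if_neg hx.not_gt]

namespace IsBalanced

variable {F : E → E} {uL uR : E} {V Φ : ℝ → E} {N : Set ℝ} {C : ℝ}

theorem locallyIntegrable (h : IsBalanced F uL uR V Φ N C) :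
    LocallyIntegrable (fun z : ℝ × ℝ => V (z.2 / z.1)) (volume.restrict {z | 0 < z.1}) := by
  refine locallyIntegrable_of_norm_le (C := |C|)
    (aestronglyMeasurable_comp_div h.finite h.continuousAt) ?_
  filter_upwards [ae_div_notMem h.finite] with z hz
  have h1 := (h.norm_le _ hz).trans (le_abs_self C)
  exact h1.trans (le_mul_of_one_le_right (abs_nonneg C)
    (by linarith [abs_nonneg z.1, abs_nonneg z.2]))

theorem locallyIntegrable_flux (h : IsBalanced F uL uR V Φ N C) :
    LocallyIntegrable (fun z : ℝ × ℝ => F (V (z.2 / z.1))) (volume.restrict {z | 0 < z.1}) := by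
  refine locallyIntegrable_of_norm_le (C := |C|)
    (aestronglyMeasurable_comp_div (X := fun ξ => F (V ξ)) h.finite h.continuousAt_flux) ?_
  filter_upwards [ae_div_notMem h.finite] with z hz
  have h1 := (h.norm_flux_le _ hz).trans (le_abs_self C)
  exact h1.trans (le_mul_of_one_le_right (abs_nonneg C)
    (by linarith [abs_nonneg z.1, abs_nonneg z.2]))

theorem locallyIntegrable_potential (h : IsBalanced F uL uR V Φ N C) :
    LocallyIntegrable (potential Φ) (volume.restrict {z : ℝ × ℝ | 0 < z.1}) := by
  have hm : MeasurableSet {z : ℝ × ℝ | 0 < z.1} := measurableSet_lt measurable_const measurable_fst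
  refine locallyIntegrable_of_norm_le (C := |C|) ?_ ?_
  · refine ContinuousOn.aestronglyMeasurable (fun z hz => ContinuousAt.continuousWithinAt ?_) hm
    have h1 : ContinuousAt (fun z : ℝ × ℝ => Φ (z.2 / z.1)) z :=
      ContinuousAt.comp (f := fun z : ℝ × ℝ => z.2 / z.1) h.continuous.continuousAt
        (continuous_snd.continuousAt.div continuous_fst.continuousAt (ne_of_gt hz))
    exact (continuous_fst.continuousAt.smul h1).neg
  · filter_upwards [ae_div_notMem h.finite, ae_restrict_mem hm] with z hz hpos
    have hpos : 0 < z.1 := hpos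
    have h1 := (h.norm_flux_le _ hz).trans (le_abs_self C)
    have h2 := (h.norm_le _ hz).trans (le_abs_self C)
    -- Substituting Φ = F(V) - ξV with ξ = y/t cancels the division by t, and the potential grows at
    -- most linearly.
    have h3 : potential Φ z = z.2 • V (z.2 / z.1) - z.1 • F (V (z.2 / z.1)) := by
      rw [potential, h.eq _ hz, smul_sub, smul_smul, mul_div_cancel₀ _ hpos.ne', neg_sub]
    rw [h3]
    calc _ ≤ |z.2| * |C| + |z.1| * |C| := by
          refine (norm_sub_le _ _).trans ?_
          rw [norm_smul, norm_smul, Real.norm_eq_abs, Real.norm_eq_abs]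
          gcongr
      _ ≤ |C| * (1 + |z.1| + |z.2|) := by nlinarith [abs_nonneg C]

theorem hasDerivAt_potential_snd (h : IsBalanced F uL uR V Φ N C) {t y : ℝ} (ht : 0 < t)
    (hy : y / t ∉ N) : HasDerivAt (fun y => potential Φ (t, y)) (V (y / t)) y := by
  have h1 : HasDerivAt (fun y : ℝ => y / t) t⁻¹ y := by
    simpa using (hasDerivAt_id y).div_const t
  have h2 := (HasDerivAt.scomp y (h.hasDerivAt _ hy) h1).const_smul t
  refine h2.neg.congr_deriv ?_
  rw [smul_smul, mul_inv_cancel₀ ht.ne', one_smul, neg_neg]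

/-- Differentiating -tΦ(y/t) gives -Φ - (y/t)V, and the last term completes Φ = F(V) - ξV to F(V).
-/
theorem hasDerivAt_potential_fst (h : IsBalanced F uL uR V Φ N C) {t y : ℝ} (ht : 0 < t)
    (hy : y / t ∉ N) : HasDerivAt (fun t => potential Φ (t, y)) (-F (V (y / t))) t := by
  have h1 : HasDerivAt (fun t : ℝ => y / t) (-(y / t ^ 2)) t := by
    have := (hasDerivAt_inv ht.ne').const_mul y
    refine this.congr_deriv ?_
    ring
  have h2 := (hasDerivAt_id t).smul (HasDerivAt.scomp t (h.hasDerivAt _ hy) h1)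
  refine h2.neg.congr_deriv ?_
  simp only [Function.comp, id, one_smul]
  rw [h.eq _ hy, smul_neg, neg_smul, neg_neg, smul_smul]
  have : t * (y / t ^ 2) = y / t := by field_simp
  rw [this]; abel_nf

theorem continuous_potential_snd (h : IsBalanced F uL uR V Φ N C) (t : ℝ) :
    Continuous fun y => potential Φ (t, y) :=
  ((h.continuous.comp (continuous_id.div_const t)).const_smul t).neg

/-- The potential, extended by its trace. -/
theorem continuousOn_potential_fst (h : IsBalanced F uL uR V Φ N C) {y : ℝ} (hy : y ≠ 0) :
    ContinuousOn (fun t => if t = 0 then potentialTrace uL uR y else potential Φ (t, y)) (Ici 0) := by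
  intro t ht
  rcases eq_or_lt_of_le (show 0 ≤ t from ht) with rfl | ht
  · have hfin : ∀ᶠ ξ in cofinite, ξ ∉ N := h.finite.compl_mem_cofinite
    have hΦR : ∀ᶠ ξ in atTop, Φ ξ = F uR - ξ • uR := by
      filter_upwards [h.right, hfin.filter_mono atTop_le_cofinite] with ξ h1 h2
      rw [h.eq ξ h2, h1]
    have hΦL : ∀ᶠ ξ in atBot, Φ ξ = F uL - ξ • uL := by
      filter_upwards [h.left, hfin.filter_mono atBot_le_cofinite] with ξ h1 h2
      rw [h.eq ξ h2, h1]
    -- As t decreases to 0 with y ≠ 0, y/t runs to ±∞, where V is constant. Hence the potential is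
    -- exactly y u - t F(u) for small t > 0, with limit y u.
    have key : ∀ u : E, potentialTrace uL uR y = y • u →
        (∀ᶠ t in 𝓝[>] (0 : ℝ), Φ (y / t) = F u - (y / t) • u) →
        ContinuousWithinAt (fun t => if t = 0 then potentialTrace uL uR y else potential Φ (t, y))
          (Ici 0) 0 := by
      intro u hu hev
      have hc : ContinuousWithinAt (fun t : ℝ => y • u - t • F u) (Ici 0) 0 :=
        Continuous.continuousWithinAt (by fun_prop)
      refine hc.congr_of_eventuallyEq ?_ (by simp [hu])
      rw [← Ioi_union_left, nhdsWithin_union, nhdsWithin_singleton, EventuallyEq,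
        eventually_sup]
      refine ⟨?_, by simp [hu]⟩
      filter_upwards [hev, self_mem_nhdsWithin] with t h1 h2
      have h2 : 0 < t := h2
      rw [if_neg h2.ne', potential, h1, smul_sub, smul_smul, mul_div_cancel₀ _ h2.ne', neg_sub]
    have hinv : Tendsto (fun t : ℝ => t⁻¹) (𝓝[>] 0) atTop := tendsto_inv_nhdsGT_zero
    rcases lt_or_gt_of_ne hy with hy | hy
    · refine key uL (by rw [potentialTrace, if_pos hy]) ?_
      exact (hinv.const_mul_atTop_of_neg hy).eventually hΦL
    · refine key uR (by rw [potentialTrace, if_neg hy.not_gt]) ?_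
      exact (hinv.const_mul_atTop hy).eventually hΦR
  · have h1 : ContinuousAt (fun t : ℝ => potential Φ (t, y)) t := by
      have h2 : ContinuousAt (fun t : ℝ => Φ (y / t)) t :=
        ContinuousAt.comp (f := fun t : ℝ => y / t) h.continuous.continuousAt
          (continuousAt_const.div continuousAt_id ht.ne')
      exact (continuousAt_id.smul h2).neg
    refine (h1.congr ?_).continuousWithinAt
    filter_upwards [eventually_ne_nhds ht.ne'] with s hs
    rw [if_neg hs]

end IsBalanced

end Weak

section Weak

variable {E : Type*} [NormedAddCommGroup E] [NormedSpace ℝ E]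

/-! ### Partial derivatives of a test function -/

theorem hasDerivAt_comp_prodMk_left {g : ℝ × ℝ → ℝ} (hg : Differentiable ℝ g) (t y : ℝ) :
    HasDerivAt (fun t => g (t, y)) (fderiv ℝ g (t, y) (1, 0)) t :=
  HasFDerivAt.comp_hasDerivAt (l := g) t (hg (t, y)).hasFDerivAt
    ((hasDerivAt_id t).prodMk (hasDerivAt_const t y))

theorem hasDerivAt_comp_prodMk_right {g : ℝ × ℝ → ℝ} (hg : Differentiable ℝ g) (t y : ℝ) :
    HasDerivAt (fun y => g (t, y)) (fderiv ℝ g (t, y) (0, 1)) y :=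
  HasFDerivAt.comp_hasDerivAt (l := g) y (hg (t, y)).hasFDerivAt
    ((hasDerivAt_const y t).prodMk (hasDerivAt_id y))

theorem exists_box_of_hasCompactSupport {ψ : ℝ × ℝ → ℝ} (hψ : HasCompactSupport ψ) :
    ∃ A : ℝ, 0 < A ∧ ∀ t y : ℝ, A ≤ |t| ∨ A ≤ |y| → (t, y) ∉ tsupport ψ := by
  obtain ⟨R, hR⟩ := hψ.isBounded.exists_norm_le
  refine ⟨|R| + 1, by positivity, fun t y h hmem => ?_⟩
  have h1 := (hR _ hmem).trans (le_abs_self R)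
  have h2 : |t| ≤ ‖((t, y) : ℝ × ℝ)‖ := norm_fst_le ((t, y) : ℝ × ℝ)
  have h3 : |y| ≤ ‖((t, y) : ℝ × ℝ)‖ := norm_snd_le ((t, y) : ℝ × ℝ)
  rcases h with h | h <;> linarith

/-- With U the potential, the integrand is ψ_t U_y - ψ_y U_t = ∂_y(ψ_t U) - ∂ₜ(ψ_y U), the mixed
derivatives of ψ cancelling. The y-divergence integrates to 0, the t-divergence leaves the trace of
U at t = 0, and a last integration by parts in y balances it against the initial datum. -/
theorem IsBalanced.isWeakRiemannSolution [CompleteSpace E] {F : E → E} {uL uR : E} {V Φ : ℝ → E}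
    {N : Set ℝ} {C : ℝ} (h : IsBalanced F uL uR V Φ N C) :
    IsWeakRiemannSolution F uL uR (fun z => V (z.2 / z.1)) := by
  refine ⟨h.locallyIntegrable, h.locallyIntegrable_flux, fun ψ hψ hcs => ?_⟩
  obtain ⟨A, hA, hbox⟩ := exists_box_of_hasCompactSupport hcs
  set ψt : ℝ × ℝ → ℝ := fun z => fderiv ℝ ψ z (1, 0) with hψt
  set ψy : ℝ × ℝ → ℝ := fun z => fderiv ℝ ψ z (0, 1) with hψy
  set ψ2 : ℝ × ℝ → ℝ := fun z => fderiv ℝ ψy z (1, 0) with hψ2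
  have hd : Differentiable ℝ ψ := hψ.differentiable (by simp)
  have hfd : ContDiff ℝ ((⊤ : ℕ∞) : WithTop ℕ∞) (fderiv ℝ ψ) := hψ.fderiv_right (by simp)
  have htd : ContDiff ℝ ((⊤ : ℕ∞) : WithTop ℕ∞) ψt := hfd.clm_apply contDiff_const
  have hyd : ContDiff ℝ ((⊤ : ℕ∞) : WithTop ℕ∞) ψy := hfd.clm_apply contDiff_const
  have h2d : ContDiff ℝ ((⊤ : ℕ∞) : WithTop ℕ∞) ψ2 :=
    (hyd.fderiv_right (m := ((⊤ : ℕ∞) : WithTop ℕ∞)) (by simp)).clm_apply contDiff_const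
  have htc : HasCompactSupport ψt := hcs.fderiv_apply ℝ (1, 0)
  have hyc : HasCompactSupport ψy := hcs.fderiv_apply ℝ (0, 1)
  have h2c : HasCompactSupport ψ2 := hyc.fderiv_apply ℝ (1, 0)
  -- Equality of mixed partials: the same `ψ2` must occur in both divergences in order to cancel.
  have hsymm : ∀ z, fderiv ℝ ψt z (0, 1) = ψ2 z := by
    intro z
    have h1 : DifferentiableAt ℝ (fderiv ℝ ψ) z := (hfd.differentiable (by simp)) z
    have h2 : ∀ v w, fderiv ℝ (fun z => fderiv ℝ ψ z v) z w = fderiv ℝ (fderiv ℝ ψ) z w v := by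
      intro v w
      rw [fderiv_clm_apply h1 (differentiableAt_const v)]
      simp
    have h3 : IsSymmSndFDerivAt ℝ ψ z := hψ.contDiffAt.isSymmSndFDerivAt (by
      simp only [minSmoothness_of_isRCLikeNormedField]; exact WithTop.coe_le_coe.2 (le_top (a := (2 : ℕ∞))))
    show fderiv ℝ (fun z => fderiv ℝ ψ z (1, 0)) z (0, 1) =
      fderiv ℝ (fun z => fderiv ℝ ψ z (0, 1)) z (1, 0)
    rw [h2, h2]
    exact h3 _ _
  have hz0 : ∀ t y : ℝ, A ≤ |t| ∨ A ≤ |y| → ψ (t, y) = 0 ∧ ψt (t, y) = 0 ∧ ψy (t, y) = 0 ∧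
      ψ2 (t, y) = 0 := by
    intro t y hty
    have h0 := hbox t y hty
    have hsub : tsupport ψy ⊆ tsupport ψ :=
      (closure_mono fun z hz => by
        refine fun e => hz ?_
        simp only [hψy, e]; rfl).trans (tsupport_fderiv_subset ℝ)
    have h1 : fderiv ℝ ψ (t, y) = 0 :=
      image_eq_zero_of_notMem_tsupport fun hm => h0 (tsupport_fderiv_subset ℝ hm)
    have h2 : fderiv ℝ ψy (t, y) = 0 :=
      image_eq_zero_of_notMem_tsupport fun hm => h0 (hsub (tsupport_fderiv_subset ℝ hm))
    exact ⟨image_eq_zero_of_notMem_tsupport h0, by simp [hψt, h1], by simp [hψy, h1],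
      by simp [hψ2, h2]⟩
  have hμ : (volume.restrict {z : ℝ × ℝ | 0 < z.1}) =
      (volume.restrict (Ioi (0 : ℝ))).prod (volume : Measure ℝ) := by
    have : {z : ℝ × ℝ | 0 < z.1} = Ioi (0 : ℝ) ×ˢ univ := by ext z; simp
    rw [this, Measure.volume_eq_prod, ← Measure.prod_restrict, Measure.restrict_univ]
  have hI2 := h.locallyIntegrable_potential.integrable_smul_left_of_hasCompactSupport
    h2d.continuous h2c
  have hI1 := h.locallyIntegrable.integrable_smul_left_of_hasCompactSupport htd.continuous htc
  have hI3 := h.locallyIntegrable_flux.integrable_smul_left_of_hasCompactSupport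
    hyd.continuous hyc
  have hG1 : Integrable (fun z => ψ2 z • potential Φ z + ψt z • V (z.2 / z.1))
      (volume.restrict {z : ℝ × ℝ | 0 < z.1}) := hI2.add hI1
  have hG2 : Integrable (fun z => ψ2 z • potential Φ z - ψy z • F (V (z.2 / z.1)))
      (volume.restrict {z : ℝ × ℝ | 0 < z.1}) := hI2.sub hI3
  have hsplit : ∀ z : ℝ × ℝ, ψt z • V (z.2 / z.1) + ψy z • F (V (z.2 / z.1)) =
      (ψ2 z • potential Φ z + ψt z • V (z.2 / z.1)) -
      (ψ2 z • potential Φ z - ψy z • F (V (z.2 / z.1))) := fun z => by abel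
  have e1 : ∫ z in {z : ℝ × ℝ | 0 < z.1},
      (ψ2 z • potential Φ z + ψt z • V (z.2 / z.1)) = 0 := by
    rw [hμ] at hG1 ⊢
    rw [integral_prod _ hG1]
    refine (integral_congr_ae ?_).trans (integral_zero _ _)
    filter_upwards [hG1.prod_right_ae, ae_restrict_mem measurableSet_Ioi] with t hint ht
    have ht : 0 < t := ht
    rw [← intervalIntegral.integral_eq_integral_of_support_subset (a := -A) (b := A)]
    -- The fundamental theorem of calculus tolerates the finitely many points y = n t where V may
    -- jump, because the potential is continuous across them.
    · rw [integral_eq_of_hasDerivAt_off_countable (fun y => ψt (t, y) • potential Φ (t, y)) _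
        (s := (fun n => n * t) '' N) (h.finite.countable.image _) ?_ ?_ hint.intervalIntegrable]
      · rw [(hz0 t A (.inr (le_abs_self A))).2.1, (hz0 t (-A) (.inr (by
          rw [abs_neg]; exact le_abs_self A))).2.1]
        simp
      · exact Continuous.continuousOn ((htd.continuous.comp (by fun_prop)).smul
          (h.continuous_potential_snd t))
      · rintro y ⟨-, hy⟩
        have hy : y / t ∉ N := fun hm => hy ⟨y / t, hm, div_mul_cancel₀ _ ht.ne'⟩
        refine ((hasDerivAt_comp_prodMk_right (htd.differentiable (by simp)) t y).smul
          (h.hasDerivAt_potential_snd ht hy)).congr_deriv ?_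
        rw [hsymm, add_comm]
    · intro y hy
      by_contra hn
      refine hy ?_
      have : A ≤ |y| := by
        by_contra! hlt
        have := abs_lt.1 hlt
        exact hn ⟨this.1, this.2.le⟩
      obtain ⟨-, g1, -, g2⟩ := hz0 t y (.inr this)
      simp [g1, g2]
  have e2 : ∫ z in {z : ℝ × ℝ | 0 < z.1},
      (ψ2 z • potential Φ z - ψy z • F (V (z.2 / z.1))) =
      -∫ y : ℝ, ψy (0, y) • potentialTrace uL uR y := by
    rw [hμ] at hG2 ⊢
    rw [integral_prod_symm _ hG2, ← integral_neg]
    refine integral_congr_ae ?_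
    -- On the line y = 0 the argument y/t does not run to infinity as t → 0; this single line is
    -- negligible.
    have hne : ∀ᵐ y : ℝ, y ≠ 0 := by simp [ae_iff, measure_singleton]
    filter_upwards [hG2.prod_left_ae, hne] with y hint hy
    rw [setIntegral_eq_of_subset_of_forall_sdiff_eq_zero measurableSet_Ioi
      (Ioc_subset_Ioi_self : Ioc 0 A ⊆ Ioi 0), ← intervalIntegral.integral_of_le hA.le]
    · rw [integral_eq_of_hasDerivAt_off_countable
        (fun t => ψy (t, y) • (if t = 0 then potentialTrace uL uR y else potential Φ (t, y))) _
        (s := (fun n => y / n) '' N) (h.finite.countable.image _) ?_ ?_ ?_]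
      · rw [(hz0 A y (.inl (le_abs_self A))).2.2.1]
        simp
      · rw [uIcc_of_le hA.le]
        exact (Continuous.continuousOn (hyd.continuous.comp (by fun_prop))).smul
          ((h.continuousOn_potential_fst hy).mono Icc_subset_Ici_self)
      · rintro t ⟨ht, hy'⟩
        rw [min_eq_left hA.le] at ht
        have ht : 0 < t := ht.1
        have hy' : y / t ∉ N := fun hm => hy' ⟨y / t, hm, by field_simp⟩
        have g1 : HasDerivAt (fun t => if t = 0 then potentialTrace uL uR y else
            potential Φ (t, y)) (-F (V (y / t))) t := by
          refine (h.hasDerivAt_potential_fst ht hy').congr_of_eventuallyEq ?_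
          filter_upwards [eventually_ne_nhds ht.ne'] with s hs
          rw [if_neg hs]
        refine ((hasDerivAt_comp_prodMk_left (hyd.differentiable (by simp)) t y).smul
          g1).congr_deriv ?_
        rw [if_neg ht.ne', smul_neg, add_comm, ← sub_eq_add_neg]
      · rw [intervalIntegrable_iff_integrableOn_Ioc_of_le hA.le]
        exact IntegrableOn.mono_set hint Ioc_subset_Ioi_self
    · rintro t ⟨ht, hn⟩
      have ht : 0 < t := ht
      have : A ≤ |t| := by
        by_contra! hlt
        exact hn ⟨ht, (abs_lt.1 hlt).2.le⟩
      obtain ⟨-, -, g1, g2⟩ := hz0 t y (.inl this)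
      simp [g1, g2]
  have hline : Continuous fun y : ℝ => ((0, y) : ℝ × ℝ) := by fun_prop
  have hout : ∀ y ∉ Icc (-A) A, A ≤ |(0 : ℝ)| ∨ A ≤ |y| := fun y hy => by
    by_contra! h
    exact hy (abs_le.1 h.2.le)
  have hi1 : Integrable fun y : ℝ => ψy (0, y) • potentialTrace uL uR y :=
    (continuous_potentialTrace uL uR).locallyIntegrable.integrable_smul_left_of_hasCompactSupport
      (hyd.continuous.comp hline)
      (HasCompactSupport.intro isCompact_Icc fun y hy => (hz0 0 y (hout y hy)).2.2.1)
  have hi2 : Integrable fun y : ℝ => ψ (0, y) • (if y < 0 then uL else uR) := by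
    refine LocallyIntegrable.integrable_smul_left_of_hasCompactSupport ?_
      (hψ.continuous.comp hline)
      (HasCompactSupport.intro isCompact_Icc fun y hy => (hz0 0 y (hout y hy)).1)
    refine LocallyIntegrable.mono (f := fun _ => max ‖uL‖ ‖uR‖) (locallyIntegrable_const _) ?_
      (Eventually.of_forall fun y => ?_)
    · exact (StronglyMeasurable.ite measurableSet_Iio stronglyMeasurable_const
        stronglyMeasurable_const).aestronglyMeasurable
    · refine le_trans ?_ (le_abs_self _)
      split_ifs
      · exact le_max_left _ _
      · exact le_max_right _ _
  -- The trace y u₀(y) is a continuous primitive of the initial datum u₀, so the integrand is the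
  -- derivative of ψ(0, ·) times the trace, off y = 0.
  have e3 : (∫ y : ℝ, ψy (0, y) • potentialTrace uL uR y) +
      ∫ y : ℝ, ψ (0, y) • (if y < 0 then uL else uR) = 0 := by
    have hsum : Integrable fun y : ℝ => ψy (0, y) • potentialTrace uL uR y +
        ψ (0, y) • (if y < 0 then uL else uR) := hi1.add hi2
    rw [← integral_add hi1 hi2,
      ← intervalIntegral.integral_eq_integral_of_support_subset (a := -A) (b := A)]
    · rw [integral_eq_of_hasDerivAt_off_countable
        (fun y => ψ (0, y) • potentialTrace uL uR y) _ (s := {0}) (countable_singleton 0) ?_ ?_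
        hsum.intervalIntegrable]
      · rw [(hz0 0 A (.inr (le_abs_self A))).1, (hz0 0 (-A) (.inr (by
          rw [abs_neg]; exact le_abs_self A))).1]
        simp
      · exact ((hψ.continuous.comp hline).smul
          (continuous_potentialTrace uL uR)).continuousOn
      · rintro y ⟨-, hy⟩
        refine ((hasDerivAt_comp_prodMk_right hd 0 y).smul
          (hasDerivAt_potentialTrace uL uR hy)).congr_deriv ?_
        rw [add_comm]
    · intro y hy
      by_contra hn
      refine hy ?_
      have : A ≤ |y| := by
        by_contra! hlt
        have := abs_lt.1 hlt
        exact hn ⟨this.1, this.2.le⟩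
      obtain ⟨g1, -, g2, -⟩ := hz0 0 y (.inr this)
      simp [g1, g2]
  have e0 : ∫ z in {z : ℝ × ℝ | 0 < z.1}, (ψt z • V (z.2 / z.1) + ψy z • F (V (z.2 / z.1))) =
      ∫ y : ℝ, ψy (0, y) • potentialTrace uL uR y := by
    simp only [hsplit]
    rw [integral_sub hG1 hG2, e1, e2, zero_sub, neg_neg]
  show (∫ z in {z : ℝ × ℝ | 0 < z.1}, (ψt z • V (z.2 / z.1) + ψy z • F (V (z.2 / z.1)))) +
    ∫ y : ℝ, ψ (0, y) • (if y < 0 then uL else uR) = 0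
  rw [e0, e3]

theorem IsSuperposition.isRiemannSolution [CompleteSpace E] {F : E → E} {lam coord : E → ℝ}
    {uL uR u₁ u₂ : E} {V : ℝ → E} (hF : Differentiable ℝ F) (hlam : ∀ u, 0 < lam u)
    (h : IsSuperposition F lam coord uL uR V u₁ u₂) :
    IsRiemannSolution F lam coord uL uR V u₁ u₂ := by
  obtain ⟨Φ, N, C, hb⟩ := h.isBalanced hF hlam
  exact ⟨hb.isWeakRiemannSolution, h⟩

end Weak

/-! ## Reduction of the Transverse Magnetic system -/

/-- `D ↦ ω · D` as a continuous linear map. -/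
def dotL (ω : EuclideanSpace ℝ (Fin 2)) : EuclideanSpace ℝ (Fin 2) →L[ℝ] ℝ :=
  ω 0 • EuclideanSpace.proj 0 + ω 1 • EuclideanSpace.proj 1

/-- `D ↦ ω × D` as a continuous linear map. -/
def crossL (ω : EuclideanSpace ℝ (Fin 2)) : EuclideanSpace ℝ (Fin 2) →L[ℝ] ℝ :=
  ω 0 • EuclideanSpace.proj 1 - ω 1 • EuclideanSpace.proj 0

theorem dotL_apply (ω D : EuclideanSpace ℝ (Fin 2)) : dotL ω D = dot ω D := rfl

theorem crossL_apply (ω D : EuclideanSpace ℝ (Fin 2)) : crossL ω D = cross ω D := rfl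

/-- The coordinates `(ω × D, H₃)` of a state. -/
def reduce (ω : EuclideanSpace ℝ (Fin 2)) (u : TMState) : ℝ × ℝ := (cross ω u.1, u.2)

/-- The state with `ω · D = d₀` and given `(ω × D, H₃)`. -/
def planeState (ω : EuclideanSpace ℝ (Fin 2)) (d₀ : ℝ) (v : ℝ × ℝ) : TMState :=
  (d₀ • ω + v.1 • perp ω, v.2)

theorem sq_add_sq_eq_one {ω : EuclideanSpace ℝ (Fin 2)} (hω : ‖ω‖ = 1) : ω 0 ^ 2 + ω 1 ^ 2 = 1 := by
  have h := EuclideanSpace.real_norm_sq_eq ω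
  rw [hω, Fin.sum_univ_two] at h
  linarith

section Geometry

variable {ω : EuclideanSpace ℝ (Fin 2)} (hω : ‖ω‖ = 1)
include hω

theorem dot_smul_add_cross_smul (D : EuclideanSpace ℝ (Fin 2)) :
    dot ω D • ω + cross ω D • perp ω = D := by
  have h := sq_add_sq_eq_one hω
  ext i
  fin_cases i
  · simp [dot, cross, perp]; linear_combination D 0 * h
  · simp [dot, cross, perp]; linear_combination D 1 * h

theorem dot_add_smul_perp (a b : ℝ) : dot ω (a • ω + b • perp ω) = a := by
  have h := sq_add_sq_eq_one hω
  simp [dot, perp]; linear_combination a * h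

theorem cross_add_smul_perp (a b : ℝ) : cross ω (a • ω + b • perp ω) = b := by
  have h := sq_add_sq_eq_one hω
  simp [cross, perp]; linear_combination b * h

theorem norm_sq_eq (D : EuclideanSpace ℝ (Fin 2)) : ‖D‖ ^ 2 = dot ω D ^ 2 + cross ω D ^ 2 := by
  have h := sq_add_sq_eq_one hω
  rw [EuclideanSpace.real_norm_sq_eq, Fin.sum_univ_two, dot, cross]
  linear_combination (-(D 0 ^ 2 + D 1 ^ 2)) * h

theorem planeState_reduce (u : TMState) : planeState ω (dot ω u.1) (reduce ω u) = u :=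
  Prod.ext (dot_smul_add_cross_smul hω u.1) rfl

theorem reduce_planeState (d₀ : ℝ) (v : ℝ × ℝ) : reduce ω (planeState ω d₀ v) = v :=
  Prod.ext (cross_add_smul_perp hω d₀ v.1) rfl

theorem dot_planeState (d₀ : ℝ) (v : ℝ × ℝ) : dot ω (planeState ω d₀ v).1 = d₀ :=
  dot_add_smul_perp hω d₀ v.1

theorem state_ext {u v : TMState} (h1 : dot ω u.1 = dot ω v.1) (h2 : reduce ω u = reduce ω v) :
    u = v := by
  rw [← planeState_reduce hω u, ← planeState_reduce hω v, h1, h2]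

end Geometry

/-! ### The flux and its waves in the coordinates (ω · D, ω × D, H₃) -/

namespace Medium

variable (M : Medium) {ω : EuclideanSpace ℝ (Fin 2)} (hω : ‖ω‖ = 1)

theorem P_eq (D : EuclideanSpace ℝ (Fin 2)) :
    M.P D = (M.eps0 * (1 + M.epsr * M.sqE (‖D‖ ^ 2)))⁻¹ • D := by rw [P, p_sq]

include hω

theorem flux_eq (u : TMState) :
    M.flux ω u = (u.2 • perp ω, M.f (cross ω u.1) (dot ω u.1)) := by
  have h0 := M.eps0_pos
  have hm := M.mu0_pos
  refine Prod.ext ?_ ?_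
  · ext i
    fin_cases i <;> simp [flux, flux₁, flux₂, perp] <;> ring
  · show ω 0 * (M.mu0⁻¹ * M.P u.1 1) + ω 1 * (-(M.mu0⁻¹ * M.P u.1 0)) = _
    rw [f_eq, M.c_sq, P_eq, norm_sq_eq hω, cross]
    simp only [PiLp.smul_apply, smul_eq_mul, mul_inv, div_eq_mul_inv]
    ring

theorem norm_P_sq (D : EuclideanSpace ℝ (Fin 2)) : ‖M.P D‖ ^ 2 = M.sqE (dot ω D ^ 2 + cross ω D ^ 2) := by
  have h0 := M.eps0_pos
  have hr := M.epsr_pos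
  have hn : 0 ≤ dot ω D ^ 2 + cross ω D ^ 2 := by positivity
  have hx := M.sqE_nonneg hn
  have hs := M.sqE_eq hn
  rw [P_eq, norm_smul, mul_pow, norm_sq_eq hω D, Real.norm_eq_abs, sq_abs]
  nth_rewrite 2 [← hs]
  field_simp

theorem charSpeed_eq (u : TMState) : M.charSpeed ω u = M.lam (cross ω u.1) (dot ω u.1) := by
  have hd : dot ω (M.P u.1) =
      dot ω u.1 / (M.eps0 * (1 + M.epsr * M.sqE (dot ω u.1 ^ 2 + cross ω u.1 ^ 2))) := by
    rw [← dotL_apply, P_eq, map_smul, dotL_apply, norm_sq_eq hω, smul_eq_mul, div_eq_inv_mul]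
  rw [charSpeed, lam_eq, lamSq, norm_P_sq M hω, hd]

theorem charSpeed_pos (u : TMState) : 0 < M.charSpeed ω u := by
  rw [charSpeed_eq M hω]; exact M.lam_pos _ _

theorem differentiable_flux : Differentiable ℝ (M.flux ω) := by
  have h0 := M.epsr_pos
  have he : M.flux ω = fun u : TMState => (u.2 • perp ω, M.c ^ 2 * crossL ω u.1 /
      (1 + M.epsr * M.sqE (dotL ω u.1 ^ 2 + crossL ω u.1 ^ 2))) := by
    funext u; rw [flux_eq M hω, f_eq, crossL_apply, dotL_apply]
  rw [he]
  have hs : Differentiable ℝ fun u : TMState => M.sqE (dotL ω u.1 ^ 2 + crossL ω u.1 ^ 2) := by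
    intro u
    have hn : 0 ≤ dotL ω u.1 ^ 2 + crossL ω u.1 ^ 2 := by positivity
    exact DifferentiableAt.comp (g := M.sqE) u (M.hasDerivAt_sqE hn).differentiableAt (by fun_prop)
  have hne : ∀ u : TMState, 1 + M.epsr * M.sqE (dotL ω u.1 ^ 2 + crossL ω u.1 ^ 2) ≠ 0 := by
    intro u
    have := M.sqE_nonneg (by positivity : 0 ≤ dotL ω u.1 ^ 2 + crossL ω u.1 ^ 2)
    positivity
  refine Differentiable.prodMk (by fun_prop) ?_
  simp only [div_eq_mul_inv]
  have hi := Differentiable.inv (h := fun u : TMState =>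
    1 + M.epsr * M.sqE (dotL ω u.1 ^ 2 + crossL ω u.1 ^ 2)) (by fun_prop) hne
  exact Differentiable.fun_mul (by fun_prop) hi

theorem hasDerivAt_flux_line (u w : TMState) :
    HasDerivAt (fun s : ℝ => M.flux ω (u + s • w)) (fderiv ℝ (M.flux ω) u w) 0 := by
  have h1 : HasDerivAt (fun s : ℝ => u + s • w) w 0 := by
    simpa using ((hasDerivAt_id (0 : ℝ)).smul_const w).const_add u
  have h2 : HasFDerivAt (M.flux ω) (fderiv ℝ (M.flux ω) u) (u + (0 : ℝ) • w) := by
    rw [zero_smul, add_zero]; exact (M.differentiable_flux hω u).hasFDerivAt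
  exact h2.comp_hasDerivAt 0 h1

theorem fderiv_flux_fst (u w : TMState) : (fderiv ℝ (M.flux ω) u w).1 = w.2 • perp ω := by
  have h1 : HasDerivAt (fun s : ℝ => (M.flux ω (u + s • w)).1) (fderiv ℝ (M.flux ω) u w).1 0 :=
    (ContinuousLinearMap.fst ℝ (EuclideanSpace ℝ (Fin 2)) ℝ).hasFDerivAt.comp_hasDerivAt 0 (M.hasDerivAt_flux_line hω u w)
  refine h1.unique ?_
  simp only [flux_eq M hω, Prod.snd_add, Prod.smul_snd]
  have h2 : HasDerivAt (fun s : ℝ => u.2 + s * w.2) w.2 0 := by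
    simpa using ((hasDerivAt_id (0 : ℝ)).mul_const w.2).const_add u.2
  exact h2.smul_const (perp ω)

/-- For w with ω·w = 0 the line u + s w keeps d₀ fixed, so only ∂₁f = λ² enters and the derivative
of f in d₀ is never needed. -/
theorem fderiv_flux_snd (u : TMState) {w : TMState} (hw : dot ω w.1 = 0) :
    (fderiv ℝ (M.flux ω) u w).2 = M.lam (cross ω u.1) (dot ω u.1) ^ 2 * cross ω w.1 := by
  have h1 : HasDerivAt (fun s : ℝ => (M.flux ω (u + s • w)).2) (fderiv ℝ (M.flux ω) u w).2 0 :=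
    (ContinuousLinearMap.snd ℝ (EuclideanSpace ℝ (Fin 2)) ℝ).hasFDerivAt.comp_hasDerivAt 0 (M.hasDerivAt_flux_line hω u w)
  refine h1.unique ?_
  have e : (fun s : ℝ => (M.flux ω (u + s • w)).2) =
      fun s => M.f (cross ω u.1 + s * cross ω w.1) (dot ω u.1) := by
    funext s
    rw [flux_eq M hω]
    simp only [Prod.fst_add, Prod.smul_fst, ← dotL_apply, ← crossL_apply, map_add, map_smul,
      smul_eq_mul]
    rw [dotL_apply ω w.1, hw, mul_zero, add_zero]
  rw [e]
  have h2 : HasDerivAt (fun s : ℝ => cross ω u.1 + s * cross ω w.1) (cross ω w.1) 0 := by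
    simpa using ((hasDerivAt_id (0 : ℝ)).mul_const (cross ω w.1)).const_add (cross ω u.1)
  have h3 := M.hasDerivAt_f (cross ω u.1 + 0 * cross ω w.1) (dot ω u.1)
  have h4 := HasDerivAt.comp (h := fun s : ℝ => cross ω u.1 + s * cross ω w.1) 0 h3 h2
  rw [zero_mul, add_zero] at h4
  exact h4

/-- The D-component of F'(u)w is parallel to ω^⊥, so ξ (ω·w) = 0. Eigenvectors of nonzero eigenvalue
are thus tangent to the plane ω·D = const. -/
theorem fderiv_flux_eq_smul (u w : TMState) {ξ : ℝ} (hξ : ξ ≠ 0) :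
    fderiv ℝ (M.flux ω) u w = ξ • w ↔ dot ω w.1 = 0 ∧
      fderiv ℝ (M.planarFlux (dot ω u.1)) (reduce ω u) (reduce ω w) = ξ • reduce ω w := by
  rw [fderiv_planarFlux_eq_smul]
  have hperp : dot ω (perp ω) = 0 ∧ cross ω (perp ω) = 1 := by
    have h := dot_add_smul_perp hω 0 1
    have h' := cross_add_smul_perp hω 0 1
    rw [zero_smul, zero_add, one_smul] at h h'
    exact ⟨h, h'⟩
  constructor
  · intro h
    have e1 : w.2 • perp ω = ξ • w.1 := (M.fderiv_flux_fst hω u w).symm.trans (congrArg Prod.fst h)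
    have e2 : dot ω w.1 = 0 := by
      have := congrArg (dotL ω) e1
      rw [map_smul, map_smul, dotL_apply, dotL_apply, hperp.1, smul_zero, eq_comm, smul_eq_mul] at this
      exact (mul_eq_zero.1 this).resolve_left hξ
    refine ⟨e2, ?_, ?_⟩
    · have := congrArg (crossL ω) e1
      rw [map_smul, map_smul, crossL_apply, crossL_apply, hperp.2] at this
      rw [smul_eq_mul, mul_one, smul_eq_mul] at this
      exact this
    · exact (M.fderiv_flux_snd hω u e2).symm.trans (congrArg Prod.snd h)
  · rintro ⟨h1, h2, h3⟩
    refine Prod.ext ?_ ?_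
    · rw [M.fderiv_flux_fst hω]
      have h4 := dot_smul_add_cross_smul hω w.1
      rw [h1, zero_smul, zero_add] at h4
      have h2 : w.2 = ξ * cross ω w.1 := h2
      rw [Prod.smul_fst, ← h4, smul_smul, h2]
    · rw [M.fderiv_flux_snd hω u h1]
      exact h3

/-- The jump of the flux in D is parallel to ω^⊥, so σ [ω·D] = 0: only a stationary discontinuity
can change ω·D. -/
theorem rankineHugoniot_flux_iff {σ : ℝ} (hσ : σ ≠ 0) (u v : TMState) :
    RankineHugoniot (M.flux ω) σ u v ↔ dot ω v.1 = dot ω u.1 ∧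
      RankineHugoniot (M.planarFlux (dot ω u.1)) σ (reduce ω u) (reduce ω v) := by
  rw [rankineHugoniot_planarFlux, RankineHugoniot, flux_eq M hω, flux_eq M hω, Prod.ext_iff]
  have hperp : dot ω (perp ω) = 0 ∧ cross ω (perp ω) = 1 := by
    have h := dot_add_smul_perp hω 0 1
    have h' := cross_add_smul_perp hω 0 1
    rw [zero_smul, zero_add, one_smul] at h h'
    exact ⟨h, h'⟩
  constructor
  · rintro ⟨h1, h2⟩
    have h1 : σ • (v.1 - u.1) = v.2 • perp ω - u.2 • perp ω := h1
    have h2 : σ * (v.2 - u.2) = M.f (cross ω v.1) (dot ω v.1) - M.f (cross ω u.1) (dot ω u.1) := h2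
    have e1 : dot ω v.1 = dot ω u.1 := by
      have := congrArg (dotL ω) h1
      rw [← sub_smul, map_smul, map_smul, map_sub, dotL_apply, dotL_apply, dotL_apply, hperp.1,
        smul_zero, smul_eq_mul] at this
      exact sub_eq_zero.1 ((mul_eq_zero.1 this).resolve_left hσ)
    refine ⟨e1, ?_, ?_⟩
    · have := congrArg (crossL ω) h1
      rw [← sub_smul, map_smul, map_smul, map_sub, crossL_apply, crossL_apply, crossL_apply,
        hperp.2, smul_eq_mul, smul_eq_mul, mul_one] at this
      exact this
    · rw [e1] at h2
      exact h2
  · rintro ⟨h1, h2, h3⟩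
    have h2 : σ * (cross ω v.1 - cross ω u.1) = v.2 - u.2 := h2
    refine ⟨?_, ?_⟩
    · show σ • (v.1 - u.1) = v.2 • perp ω - u.2 • perp ω
      rw [← sub_smul, ← h2, ← dot_smul_add_cross_smul hω v.1, ← dot_smul_add_cross_smul hω u.1]
      simp only [cross_add_smul_perp hω, h1]
      module
    · show σ * (v.2 - u.2) = M.f (cross ω v.1) (dot ω v.1) - M.f (cross ω u.1) (dot ω u.1)
      rw [h1]
      exact h3

theorem rankineHugoniot_flux_zero_iff (u v : TMState) :
    RankineHugoniot (M.flux ω) 0 u v ↔ u.2 = v.2 ∧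
      M.f (cross ω u.1) (dot ω u.1) = M.f (cross ω v.1) (dot ω v.1) := by
  rw [RankineHugoniot, zero_smul, eq_comm, sub_eq_zero, eq_comm, flux_eq M hω, flux_eq M hω,
    Prod.mk_inj]
  refine and_congr_left fun _ => ⟨fun h => ?_, fun h => by rw [h]⟩
  have h1 := congrArg (crossL ω) h
  have h' := cross_add_smul_perp hω 0 1
  rw [zero_smul, zero_add, one_smul] at h'
  simpa only [map_smul, crossL_apply, h', smul_eq_mul, mul_one] using h1

/-- The waves of the Transverse Magnetic system. -/
abbrev IsTMWave (M : Medium) (ω : EuclideanSpace ℝ (Fin 2)) (k : Family) (u v : TMState)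
    (W : ℝ → TMState) : Prop :=
  IsWave (M.flux ω) (M.charSpeed ω) (fun u => cross ω u.1) k u v W

omit hω in
theorem ne_zero_of_sign_mul_pos {k : Family} {σ : ℝ} (h : 0 < k.sign * σ) : σ ≠ 0 := by
  rintro rfl
  simp at h

/-- Every competitor in Liu's condition moves at nonzero speed and so lies in the plane ω·D = const
of the left state; the two conditions test the same states. -/
theorem isLiuShock_flux_iff (k : Family) (σ : ℝ) (u v : TMState) :
    IsLiuShock (M.flux ω) (fun u => cross ω u.1) k σ u v ↔ dot ω v.1 = dot ω u.1 ∧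
      M.IsPlanarShock (dot ω u.1) k σ (reduce ω u) (reduce ω v) := by
  constructor
  · intro h
    obtain ⟨h1, h2⟩ := (M.rankineHugoniot_flux_iff hω (ne_zero_of_sign_mul_pos h.sign) u v).1
      h.rankineHugoniot
    refine ⟨h1, fun e => h.nontrivial (state_ext hω h1.symm e), h.sign, h2, ?_⟩
    intro σ' b hb hσ' hRH hmem
    refine h.liu σ' (planeState ω (dot ω u.1) b) (fun e => hb ?_) hσ' ?_ ?_
    · rw [← reduce_planeState hω (dot ω u.1) b, e]
    · rw [M.rankineHugoniot_flux_iff hω (ne_zero_of_sign_mul_pos hσ'), dot_planeState hω,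
        reduce_planeState hω]
      exact ⟨rfl, hRH⟩
    · show cross ω (planeState ω (dot ω u.1) b).1 ∈ _
      rw [planeState, cross_add_smul_perp hω]
      exact hmem
  · rintro ⟨h1, h⟩
    have hσ := ne_zero_of_sign_mul_pos h.sign
    refine ⟨fun e => h.nontrivial (by rw [e]), h.sign,
      (M.rankineHugoniot_flux_iff hω hσ u v).2 ⟨h1, h.rankineHugoniot⟩, ?_⟩
    intro σ' w hw hσ' hRH hmem
    obtain ⟨g1, g2⟩ := (M.rankineHugoniot_flux_iff hω (ne_zero_of_sign_mul_pos hσ') u w).1 hRH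
    exact h.liu σ' (reduce ω w) (fun e => hw (state_ext hω g1 e)) hσ' g2 hmem

omit hω in
/-- `u ↦ (ω × D, H₃)` as a continuous linear map. -/
def reduceL (ω : EuclideanSpace ℝ (Fin 2)) : TMState →L[ℝ] ℝ × ℝ :=
  ((crossL ω).comp (ContinuousLinearMap.fst ℝ _ _)).prod (ContinuousLinearMap.snd ℝ _ _)

variable {M}

/-- Inside the fan the derivative of W is an eigenvector of eigenvalue ξ ≠ 0, hence ω·D has zero
derivative. -/
theorem dot_rarefaction {k : Family} {u v : TMState} {W : ℝ → TMState}
    (h : IsRarefaction (M.flux ω) (M.charSpeed ω) k u v W) (ξ : ℝ) :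
    dot ω (W ξ).1 = dot ω u.1 := by
  have hc : Continuous fun ξ => dotL ω (W ξ).1 :=
    (dotL ω).continuous.comp (continuous_fst.comp h.continuous)
  have key : ∀ ξ ∈ Ioc (k.sign * M.charSpeed ω u) (k.sign * M.charSpeed ω v),
      dot ω (W ξ).1 = dot ω u.1 := by
    intro ξ hξ
    have hd : ∀ η ∈ Ioo (k.sign * M.charSpeed ω u) ξ,
        HasDerivAt (fun ξ => dotL ω (W ξ).1) 0 η := by
      intro η hη
      obtain ⟨e1, w, -, e2, e3⟩ := h.fan η ⟨hη.1, hη.2.trans_le hξ.2⟩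
      have hη0 : η ≠ 0 := by
        rw [← e1]
        have := (M.charSpeed_pos hω (W η)).ne'
        cases k <;> simpa [Family.sign] using this
      have e4 := ((M.fderiv_flux_eq_smul hω _ _ hη0).1 e3).1
      rw [← dotL_apply] at e4
      rw [← e4]
      exact ((dotL ω).comp (ContinuousLinearMap.fst ℝ _ _)).hasFDerivAt.comp_hasDerivAt η e2
    obtain ⟨η, -, h2⟩ := exists_hasDerivAt_eq_slope _ _ hξ.1 hc.continuousOn hd
    rw [eq_comm, div_eq_zero_iff, h.left _ le_rfl] at h2
    exact sub_eq_zero.1 (h2.resolve_right (sub_pos.2 hξ.1).ne')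
  rcases le_or_gt ξ (k.sign * M.charSpeed ω u) with h1 | h1
  · rw [h.left ξ h1]
  · rcases le_or_gt ξ (k.sign * M.charSpeed ω v) with h2 | h2
    · exact key ξ ⟨h1, h2⟩
    · rw [h.right ξ h2.le, ← h.right _ le_rfl]
      exact key _ (right_mem_Ioc.2 h.speed_lt)

theorem isPlanarRarefaction_reduce {k : Family} {u v : TMState} {W : ℝ → TMState}
    (h : IsRarefaction (M.flux ω) (M.charSpeed ω) k u v W) :
    dot ω v.1 = dot ω u.1 ∧
    M.IsPlanarRarefaction (dot ω u.1) k (reduce ω u) (reduce ω v) (fun ξ => reduce ω (W ξ)) := by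
  have hdot := dot_rarefaction hω h
  have hv : dot ω v.1 = dot ω u.1 := by rw [← hdot _, h.right _ le_rfl]
  have hsp : ∀ w : TMState, dot ω w.1 = dot ω u.1 →
      M.charSpeed ω w = M.planarSpeed (dot ω u.1) (reduce ω w) := fun w hw => by
    rw [charSpeed_eq M hω, hw]; rfl
  have hlt := h.speed_lt
  have hl := h.left
  have hr := h.right
  have hf := h.fan
  rw [hsp u rfl] at hlt hl hf
  rw [hsp v hv] at hlt hr hf
  refine ⟨hv, hlt, (reduceL ω).continuous.comp h.continuous, fun ξ hξ => by rw [hl ξ hξ],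
    fun ξ hξ => by rw [hr ξ hξ], fun ξ hξ => ?_⟩
  obtain ⟨e1, w, hw, e2, e3⟩ := hf ξ hξ
  have hξ0 : ξ ≠ 0 := by
    rw [← e1]
    have := (M.charSpeed_pos hω (W ξ)).ne'
    cases k <;> simpa [Family.sign] using this
  obtain ⟨g1, g2⟩ := (M.fderiv_flux_eq_smul hω _ _ hξ0).1 e3
  rw [hsp _ (hdot ξ)] at e1
  rw [hdot ξ] at g2
  refine ⟨e1, reduce ω w, fun e => hw ?_, (reduceL ω).hasFDerivAt.comp_hasDerivAt ξ e2, g2⟩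
  refine state_ext hω ?_ ?_
  · rw [g1]; simp [dot]
  · rw [e]; simp [reduce, cross]; rfl

theorem isRarefaction_planeState {k : Family} {d₀ : ℝ} {a b : ℝ × ℝ} {W : ℝ → ℝ × ℝ}
    (h : M.IsPlanarRarefaction d₀ k a b W) :
    IsRarefaction (M.flux ω) (M.charSpeed ω) k (planeState ω d₀ a) (planeState ω d₀ b)
      (fun ξ => planeState ω d₀ (W ξ)) := by
  have hsp : ∀ a, M.charSpeed ω (planeState ω d₀ a) = M.planarSpeed d₀ a := fun a => by
    rw [charSpeed_eq M hω, dot_planeState hω, planeState, cross_add_smul_perp hω]; rfl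
  have hc : Continuous (planeState ω d₀) := by unfold planeState; fun_prop
  refine ⟨by rw [hsp, hsp]; exact h.speed_lt, hc.comp h.continuous, fun ξ hξ => ?_, fun ξ hξ => ?_,
    fun ξ hξ => ?_⟩
  · rw [hsp] at hξ; rw [h.left ξ hξ]
  · rw [hsp] at hξ; rw [h.right ξ hξ]
  · rw [hsp, hsp] at hξ
    obtain ⟨e1, w, hw, e2, e3⟩ := h.fan ξ hξ
    have hξ0 : ξ ≠ 0 := by
      rw [← e1]
      have := (M.lam_pos (W ξ).1 d₀).ne'
      cases k <;> simpa [Family.sign, planarSpeed] using this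
    refine ⟨by rw [hsp, e1], planeState ω 0 w, fun e => hw ?_, ?_, ?_⟩
    · rw [← reduce_planeState hω 0 w, e]
      simp [reduce, cross]
    · have g1 : HasDerivAt (fun ξ => (W ξ).1) w.1 ξ :=
        (ContinuousLinearMap.fst ℝ ℝ ℝ).hasFDerivAt.comp_hasDerivAt ξ e2
      have g2 : HasDerivAt (fun ξ => (W ξ).2) w.2 ξ :=
        (ContinuousLinearMap.snd ℝ ℝ ℝ).hasFDerivAt.comp_hasDerivAt ξ e2
      refine (((g1.smul_const (perp ω)).const_add (d₀ • ω)).prodMk g2).congr_deriv ?_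
      simp [planeState]
    · rw [M.fderiv_flux_eq_smul hω _ _ hξ0, dot_planeState hω, dot_planeState hω,
        reduce_planeState hω, reduce_planeState hω]
      exact ⟨rfl, e3⟩

/-- The last clause excepts one value σ because the profile is arbitrary at a shock; it is what
recovers W from its reduction almost everywhere. -/
theorem isPlanarWave_reduce {k : Family} {u v : TMState} {W : ℝ → TMState}
    (h : M.IsTMWave ω k u v W) :
    dot ω v.1 = dot ω u.1 ∧
    M.IsPlanarWave (dot ω u.1) k (reduce ω u) (reduce ω v) (fun ξ => reduce ω (W ξ)) ∧
    ∃ σ : ℝ, ∀ ξ ≠ σ, dot ω (W ξ).1 = dot ω u.1 := by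
  have hcases : ∀ {σ : ℝ} {W : ℝ → TMState} {c : ℝ}, (∀ ξ < σ, dot ω (W ξ).1 = c) →
      (∀ ξ, σ < ξ → dot ω (W ξ).1 = c) → ∀ ξ ≠ σ, dot ω (W ξ).1 = c := by
    intro σ W c h1 h2 ξ hξ
    rcases lt_or_gt_of_ne hξ with h | h
    · exact h1 ξ h
    · exact h2 ξ h
  cases h with
  | trivial _ _ _ h =>
    exact ⟨rfl, .trivial _ _ _ fun ξ => by rw [h], 0, fun ξ _ => by rw [h]⟩
  | shock _ _ _ _ σ h left right =>
    obtain ⟨h1, h2⟩ := (M.isLiuShock_flux_iff hω _ _ _ _).1 h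
    refine ⟨h1, .shock _ _ _ _ σ h2 (fun ξ hξ => by rw [left ξ hξ]) fun ξ hξ => by rw [right ξ hξ],
      σ, hcases (fun ξ hξ => by rw [left ξ hξ]) fun ξ hξ => by rw [right ξ hξ, h1]⟩
  | rarefaction _ _ _ _ h =>
    obtain ⟨h1, h2⟩ := isPlanarRarefaction_reduce hω h
    exact ⟨h1, .rarefaction _ _ _ _ h2, 0, fun ξ _ => dot_rarefaction hω h ξ⟩
  | slowComposite _ um _ _ Wr σ hs hσ hr left right =>
    obtain ⟨h1, h2⟩ := (M.isLiuShock_flux_iff hω _ _ _ _).1 hs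
    obtain ⟨h3, h4⟩ := isPlanarRarefaction_reduce hω hr
    rw [charSpeed_eq M hω, h1] at hσ
    rw [h1] at h3 h4
    exact ⟨h3, .slowComposite _ (reduce ω um) _ _ (fun ξ => reduce ω (Wr ξ)) σ h2 hσ h4
      (fun ξ hξ => by rw [left ξ hξ]) (fun ξ hξ => by rw [right ξ hξ]), σ,
      hcases (fun ξ hξ => by rw [left ξ hξ]) fun ξ hξ => by
        rw [right ξ hξ, dot_rarefaction hω hr, h1]⟩
  | fastComposite _ um _ _ Wr σ hr hσ hs left right =>
    obtain ⟨h1, h2⟩ := (M.isLiuShock_flux_iff hω _ _ _ _).1 hs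
    obtain ⟨h3, h4⟩ := isPlanarRarefaction_reduce hω hr
    rw [charSpeed_eq M hω, h3] at hσ
    rw [h3] at h1 h2
    exact ⟨h1, .fastComposite _ (reduce ω um) _ _ (fun ξ => reduce ω (Wr ξ)) σ h4 hσ h2
      (fun ξ hξ => by rw [left ξ hξ]) (fun ξ hξ => by rw [right ξ hξ]), σ,
      hcases (fun ξ hξ => by rw [left ξ hξ, dot_rarefaction hω hr]) fun ξ hξ => by
        rw [right ξ hξ, h1]⟩

theorem isTMWave_planeState {k : Family} {d₀ : ℝ} {a b : ℝ × ℝ} {W : ℝ → ℝ × ℝ}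
    (h : M.IsPlanarWave d₀ k a b W) :
    M.IsTMWave ω k (planeState ω d₀ a) (planeState ω d₀ b) (fun ξ => planeState ω d₀ (W ξ)) := by
  have hsp : ∀ a, M.charSpeed ω (planeState ω d₀ a) = M.planarSpeed d₀ a := fun a => by
    rw [charSpeed_eq M hω, dot_planeState hω, planeState, cross_add_smul_perp hω]; rfl
  have hshock : ∀ {k : Family} {σ : ℝ} {a b : ℝ × ℝ}, M.IsPlanarShock d₀ k σ a b →
      IsLiuShock (M.flux ω) (fun u => cross ω u.1) k σ (planeState ω d₀ a) (planeState ω d₀ b) := by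
    intro k σ a b h
    rw [M.isLiuShock_flux_iff hω, dot_planeState hω, dot_planeState hω, reduce_planeState hω,
      reduce_planeState hω]
    exact ⟨rfl, h⟩
  cases h with
  | trivial _ _ _ h => exact .trivial _ _ _ fun ξ => by rw [h]
  | shock _ _ _ _ σ h left right =>
    exact .shock _ _ _ _ σ (hshock h) (fun ξ hξ => by rw [left ξ hξ])
      fun ξ hξ => by rw [right ξ hξ]
  | rarefaction _ _ _ _ h => exact .rarefaction _ _ _ _ (isRarefaction_planeState hω h)
  | slowComposite _ um _ _ Wr σ hs hσ hr left right =>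
    exact .slowComposite _ (planeState ω d₀ um) _ _ (fun ξ => planeState ω d₀ (Wr ξ)) σ (hshock hs)
      (by rw [hsp, hσ]) (isRarefaction_planeState hω hr) (fun ξ hξ => by rw [left ξ hξ])
      fun ξ hξ => by rw [right ξ hξ]
  | fastComposite _ um _ _ Wr σ hr hσ hs left right =>
    exact .fastComposite _ (planeState ω d₀ um) _ _ (fun ξ => planeState ω d₀ (Wr ξ)) σ
      (isRarefaction_planeState hω hr) (by rw [hsp, hσ]) (hshock hs)
      (fun ξ hξ => by rw [left ξ hξ]) fun ξ hξ => by rw [right ξ hξ]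

end Medium

/-! ### Existence and uniqueness for the Riemann problem -/

theorem ae_eq_of_eq_on_halfLines {α : Type*} {V V' W₁ W₁' W₂ W₂' : ℝ → α}
    (h₁ : ∀ ξ < 0, V ξ = W₁ ξ) (h₂ : ∀ ξ, 0 < ξ → V ξ = W₂ ξ) (h₁' : ∀ ξ < 0, V' ξ = W₁' ξ)
    (h₂' : ∀ ξ, 0 < ξ → V' ξ = W₂' ξ) (e₁ : W₁ =ᵐ[volume] W₁') (e₂ : W₂ =ᵐ[volume] W₂') :
    V =ᵐ[volume] V' := by
  have h0 : ∀ᵐ ξ : ℝ, ξ ≠ 0 := by simp [ae_iff, measure_singleton]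
  filter_upwards [e₁, e₂, h0] with ξ g₁ g₂ hξ
  rcases lt_or_gt_of_ne hξ with h | h
  · rw [h₁ ξ h, h₁' ξ h, g₁]
  · rw [h₂ ξ h, h₂' ξ h, g₂]

namespace Medium

variable {M : Medium} {ω : EuclideanSpace ℝ (Fin 2)}

section TM

variable (hω : ‖ω‖ = 1)
include hω

theorem IsTMWave.ae_eq {k : Family} {u v : TMState} {W W' : ℝ → TMState}
    (h : M.IsTMWave ω k u v W) (h' : M.IsTMWave ω k u v W') : W =ᵐ[volume] W' := by
  obtain ⟨-, h1, σ, h2⟩ := isPlanarWave_reduce hω h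
  obtain ⟨-, h1', σ', h2'⟩ := isPlanarWave_reduce hω h'
  have h3 : (fun ξ => reduce ω (W ξ)) =ᵐ[volume] fun ξ => reduce ω (W' ξ) := by
    cases k
    · exact h1.slow_unique h1'
    · exact h1.fast_unique h1'
  have hn : ∀ τ : ℝ, ∀ᵐ ξ : ℝ, ξ ≠ τ := fun τ => by simp [ae_iff, measure_singleton]
  filter_upwards [h3, hn σ, hn σ'] with ξ g1 g2 g3
  exact state_ext hω ((h2 ξ g2).trans (h2' ξ g3).symm) g1

/-- The slow wave keeps ω·D at its left value and the fast wave at its right value, so each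
intermediate state lies on an explicit wave curve, and the contact supplies the two equations of the
algebraic system. -/
theorem IsTMSolution.intermediate {uL uR u₁ u₂ : TMState} {V : ℝ → TMState}
    (h : M.IsTMSolution ω uL uR V u₁ u₂) :
    M.IntermediateSystem ω uL uR (cross ω u₁.1) (cross ω u₂.1) ∧
    u₁ = planeState ω (dot ω uL.1)
      (cross ω u₁.1, uL.2 + M.waveFn (cross ω uL.1) (cross ω u₁.1) (dot ω uL.1)) ∧
    u₂ = planeState ω (dot ω uR.1)
      (cross ω u₂.1, uR.2 - M.waveFn (cross ω uR.1) (cross ω u₂.1) (dot ω uR.1)) := by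
  obtain ⟨⟨W₁, hW₁, -⟩, hc, W₂, hW₂, -⟩ := h.superposition
  obtain ⟨d1, p1, -⟩ := isPlanarWave_reduce hω hW₁
  obtain ⟨d2, p2, -⟩ := isPlanarWave_reduce hω hW₂
  obtain ⟨c1, c2⟩ := (M.rankineHugoniot_flux_zero_iff hω u₁ u₂).1 hc
  have e1 : u₁.2 = uL.2 + M.waveFn (cross ω uL.1) (cross ω u₁.1) (dot ω uL.1) := p1.slow_snd
  have e2 : u₂.2 = uR.2 - M.waveFn (cross ω uR.1) (cross ω u₂.1) (dot ω u₂.1) := p2.fast_snd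
  rw [← d2] at e2
  refine ⟨⟨?_, ?_⟩, ?_, ?_⟩
  · rw [d1, ← d2] at c2; exact c2
  · rw [← e1, ← e2, c1]
  · rw [← e1, ← d1]; exact (planeState_reduce hω u₁).symm
  · rw [← e2, d2]; exact (planeState_reduce hω u₂).symm

theorem IsTMSolution.intermediate_eq {uL uR u₁ u₂ : TMState} {V : ℝ → TMState} {d₁ d₂ : ℝ}
    (h : M.IsTMSolution ω uL uR V u₁ u₂) (hd : M.IntermediateSystem ω uL uR d₁ d₂) :
    u₁ = planeState ω (dot ω uL.1) (d₁, uL.2 + M.waveFn (cross ω uL.1) d₁ (dot ω uL.1)) ∧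
    u₂ = planeState ω (dot ω uR.1) (d₂, uR.2 - M.waveFn (cross ω uR.1) d₂ (dot ω uR.1)) := by
  obtain ⟨h1, h2, h3⟩ := IsTMSolution.intermediate hω h
  have e := (M.existsUnique_intermediateSystem ω uL uR).unique
    (y₁ := (cross ω u₁.1, cross ω u₂.1)) (y₂ := (d₁, d₂)) h1 hd
  rw [Prod.mk_inj] at e
  rw [e.1] at h2
  rw [e.2] at h3
  exact ⟨h2, h3⟩

theorem exists_isTMSolution (M : Medium) (uL uR : TMState) :
    ∃ (V : ℝ → TMState) (u₁ u₂ : TMState), M.IsTMSolution ω uL uR V u₁ u₂ := by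
  obtain ⟨⟨d₁, d₂⟩, ⟨h1, h2⟩, -⟩ := M.existsUnique_intermediateSystem ω uL uR
  dsimp only at h1 h2
  obtain ⟨W₁, hW₁⟩ := M.exists_isPlanarWave_slow (dot ω uL.1) (reduce ω uL) d₁
  obtain ⟨W₂, hW₂⟩ := M.exists_isPlanarWave_fast (dot ω uR.1) (reduce ω uR) d₂
  have t1 := isTMWave_planeState hω hW₁
  have t2 := isTMWave_planeState hω hW₂
  rw [planeState_reduce hω] at t1 t2
  refine ⟨fun ξ => if ξ < 0 then planeState ω (dot ω uL.1) (W₁ ξ) else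
    planeState ω (dot ω uR.1) (W₂ ξ), _, _, IsSuperposition.isRiemannSolution
    (M.differentiable_flux hω) (M.charSpeed_pos hω) ⟨⟨_, t1, fun ξ hξ => if_pos hξ⟩, ?_,
      ⟨_, t2, fun ξ hξ => if_neg hξ.not_gt⟩⟩⟩
  rw [M.rankineHugoniot_flux_zero_iff hω, dot_planeState hω, dot_planeState hω]
  simp only [planeState, cross_add_smul_perp hω]
  exact ⟨h2, h1⟩

theorem IsTMSolution.unique {uL uR u₁ u₂ u₁' u₂' : TMState} {V V' : ℝ → TMState}
    (h : M.IsTMSolution ω uL uR V u₁ u₂) (h' : M.IsTMSolution ω uL uR V' u₁' u₂') :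
    V =ᵐ[volume] V' ∧ u₁ = u₁' ∧ u₂ = u₂' := by
  obtain ⟨e1, e2⟩ := IsTMSolution.intermediate_eq hω h (IsTMSolution.intermediate hω h').1
  obtain ⟨-, e1', e2'⟩ := IsTMSolution.intermediate hω h'
  obtain rfl : u₁ = u₁' := e1.trans e1'.symm
  obtain rfl : u₂ = u₂' := e2.trans e2'.symm
  obtain ⟨⟨W₁, hW₁, l⟩, -, W₂, hW₂, r⟩ := h.superposition
  obtain ⟨⟨W₁', hW₁', l'⟩, -, W₂', hW₂', r'⟩ := h'.superposition
  exact ⟨ae_eq_of_eq_on_halfLines l r l' r' (IsTMWave.ae_eq hω hW₁ hW₁')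
    (IsTMWave.ae_eq hω hW₂ hW₂'), rfl, rfl⟩

theorem IsTMSolution.ae_dot_eq_zero {uL uR u₁ u₂ : TMState} {V : ℝ → TMState}
    (hL : dot ω uL.1 = 0) (hR : dot ω uR.1 = 0) (h : M.IsTMSolution ω uL uR V u₁ u₂) :
    ∀ᵐ ξ : ℝ, dot ω (V ξ).1 = 0 := by
  obtain ⟨⟨W₁, hW₁, l⟩, -, W₂, hW₂, r⟩ := h.superposition
  obtain ⟨d1, -, σ₁, g1⟩ := isPlanarWave_reduce hω hW₁
  obtain ⟨d2, -, σ₂, g2⟩ := isPlanarWave_reduce hω hW₂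
  have hn : ∀ τ : ℝ, ∀ᵐ ξ : ℝ, ξ ≠ τ := fun τ => by simp [ae_iff, measure_singleton]
  filter_upwards [hn 0, hn σ₁, hn σ₂] with ξ h0 h1 h2
  rcases lt_or_gt_of_ne h0 with hξ | hξ
  · rw [l ξ hξ, g1 ξ h1, hL]
  · rw [r ξ hξ, g2 ξ h2, ← d2, hR]

end TM

/-! ## The p-system -/

theorem pFlux_eq (M : Medium) : M.pFlux = M.planarFlux 0 := by
  funext v
  rw [pFlux, planarFlux, f_zero_right]

theorem pSpeed_eq (M : Medium) : M.pSpeed = M.planarSpeed 0 := by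
  funext v
  have h1 : HasDerivAt (fun d => M.mu0⁻¹ * M.p d) (M.lam v.1 0 ^ 2) v.1 := by
    have := M.hasDerivAt_f v.1 0
    simpa only [f_zero_right] using this
  rw [pSpeed, planarSpeed, ← deriv_const_mul_field, h1.deriv, Real.sqrt_sq (M.lam_pos _ _).le]

/-- With one middle state, the two wave relations give φ(d_-, d, 0) + φ(d_+, d, 0) = H_+ - H_-,
whose left side is strictly decreasing in d. -/
theorem IsLiuPSolution.unique {vL vR vm vm' : ℝ × ℝ} {V V' : ℝ → ℝ × ℝ}
    (h : M.IsLiuPSolution vL vR V vm) (h' : M.IsLiuPSolution vL vR V' vm') :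
    V =ᵐ[volume] V' ∧ vm = vm' := by
  rw [IsLiuPSolution, pFlux_eq, pSpeed_eq] at h h'
  obtain ⟨⟨W₁, hW₁, l⟩, -, W₂, hW₂, r⟩ := h.superposition
  obtain ⟨⟨W₁', hW₁', l'⟩, -, W₂', hW₂', r'⟩ := h'.superposition
  have e1 := IsPlanarWave.slow_snd hW₁
  have e2 := IsPlanarWave.fast_snd hW₂
  have e1' := IsPlanarWave.slow_snd hW₁'
  have e2' := IsPlanarWave.fast_snd hW₂'
  have hfst : vm.1 = vm'.1 := by
    refine ((M.strictAnti_waveFn 0 vL.1).add (M.strictAnti_waveFn 0 vR.1)).injective ?_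
    show M.waveFn vL.1 vm.1 0 + M.waveFn vR.1 vm.1 0 =
      M.waveFn vL.1 vm'.1 0 + M.waveFn vR.1 vm'.1 0
    linarith
  obtain rfl : vm = vm' := Prod.ext hfst (by rw [e1, e1', hfst])
  exact ⟨ae_eq_of_eq_on_halfLines l r l' r' (IsPlanarWave.slow_unique hW₁ hW₁')
    (IsPlanarWave.fast_unique hW₂ hW₂'), rfl⟩

theorem IsTMSolution.isLiuPSolution (hω : ‖ω‖ = 1) {uL uR u₁ u₂ : TMState} {V : ℝ → TMState}
    (hL : dot ω uL.1 = 0) (hR : dot ω uR.1 = 0) (h : M.IsTMSolution ω uL uR V u₁ u₂) :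
    u₁ = u₂ ∧ M.IsLiuPSolution (reduce ω uL) (reduce ω uR) (fun ξ => reduce ω (V ξ))
      (reduce ω u₁) := by
  obtain ⟨⟨W₁, hW₁, l⟩, hc, W₂, hW₂, r⟩ := h.superposition
  obtain ⟨d1, p1, -⟩ := isPlanarWave_reduce hω hW₁
  obtain ⟨d2, p2, -⟩ := isPlanarWave_reduce hω hW₂
  rw [hL] at d1 p1
  rw [hR, eq_comm] at d2
  rw [d2] at p2
  obtain ⟨c1, c2⟩ := (M.rankineHugoniot_flux_zero_iff hω u₁ u₂).1 hc
  rw [d1, d2] at c2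
  -- Both intermediate states have ω·D = 0, so equality of f(·, 0) across the contact forces
  -- equality of ω × D.
  have hu : u₁ = u₂ :=
    state_ext hω (d1.trans d2.symm) (Prod.ext ((M.strictMono_f 0).injective c2) c1)
  refine ⟨hu, ?_⟩
  rw [IsLiuPSolution, pFlux_eq, pSpeed_eq]
  refine IsSuperposition.isRiemannSolution
    (fun v => (M.hasFDerivAt_planarFlux 0 v).differentiableAt) (fun v => M.lam_pos v.1 0)
    ⟨⟨_, p1, fun ξ hξ => by rw [l ξ hξ]⟩, ?_, ⟨_, ?_, fun ξ hξ => by rw [r ξ hξ]⟩⟩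
  · simp [RankineHugoniot]
  · rw [hu]; exact p2

end Medium
end KerrTM
end

theorem mainTheorem2 (M : KerrTM.Medium) :
    (∀ ω : EuclideanSpace ℝ (Fin 2), ‖ω‖ = 1 → ∀ uL uR : KerrTM.TMState,
      -- existence
      (∃ (V : ℝ → KerrTM.TMState) (u₁ u₂ : KerrTM.TMState), M.IsTMSolution ω uL uR V u₁ u₂) ∧
      -- uniqueness
      (∀ (V V' : ℝ → KerrTM.TMState) (u₁ u₂ u₁' u₂' : KerrTM.TMState),
        M.IsTMSolution ω uL uR V u₁ u₂ → M.IsTMSolution ω uL uR V' u₁' u₂' →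
        V =ᵐ[volume] V' ∧ u₁ = u₁' ∧ u₂ = u₂') ∧
      -- the intermediate states
      (∃! d : ℝ × ℝ, M.IntermediateSystem ω uL uR d.1 d.2) ∧
      (∀ (V : ℝ → KerrTM.TMState) (u₁ u₂ : KerrTM.TMState) (d₁ d₂ : ℝ),
        M.IsTMSolution ω uL uR V u₁ u₂ → M.IntermediateSystem ω uL uR d₁ d₂ →
        u₁ = (KerrTM.dot ω uL.1 • ω + d₁ • KerrTM.perp ω,
          uL.2 + M.waveFn (KerrTM.cross ω uL.1) d₁ (KerrTM.dot ω uL.1)) ∧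
        u₂ = (KerrTM.dot ω uR.1 • ω + d₂ • KerrTM.perp ω,
          uR.2 - M.waveFn (KerrTM.cross ω uR.1) d₂ (KerrTM.dot ω uR.1)))) ∧
    -- data of the form `(0, D₂, H₃)` in the direction `(1, 0)`
    (∀ (D₂L H₃L D₂R H₃R : ℝ) (V : ℝ → KerrTM.TMState) (u₁ u₂ : KerrTM.TMState),
      M.IsTMSolution !₂[1, 0] (!₂[0, D₂L], H₃L) (!₂[0, D₂R], H₃R) V u₁ u₂ →
      (∀ᵐ ξ : ℝ, (V ξ).1 0 = 0) ∧
      u₁ = u₂ ∧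
      M.IsLiuPSolution (D₂L, H₃L) (D₂R, H₃R) (fun ξ => ((V ξ).1 1, (V ξ).2)) (u₁.1 1, u₁.2) ∧
      (∀ (W : ℝ → ℝ × ℝ) (vm : ℝ × ℝ), M.IsLiuPSolution (D₂L, H₃L) (D₂R, H₃R) W vm →
        W =ᵐ[volume] (fun ξ => ((V ξ).1 1, (V ξ).2)) ∧ vm = (u₁.1 1, u₁.2))) := by
  refine ⟨fun ω hω uL uR => ⟨KerrTM.Medium.exists_isTMSolution hω M uL uR,
    fun V V' u₁ u₂ u₁' u₂' h h' => KerrTM.Medium.IsTMSolution.unique hω h h',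
    M.existsUnique_intermediateSystem ω uL uR,
    fun V u₁ u₂ d₁ d₂ h hd => KerrTM.Medium.IsTMSolution.intermediate_eq hω h hd⟩, ?_⟩
  intro D₂L H₃L D₂R H₃R V u₁ u₂ h
  have hω : ‖(!₂[1, 0] : EuclideanSpace ℝ (Fin 2))‖ = 1 := by
    simp [EuclideanSpace.norm_eq]
  have hdot : ∀ D : EuclideanSpace ℝ (Fin 2), KerrTM.dot !₂[1, 0] D = D 0 := fun D => by
    simp [KerrTM.dot]
  have hred : ∀ u : KerrTM.TMState, KerrTM.reduce !₂[1, 0] u = (u.1 1, u.2) := fun u => by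
    simp [KerrTM.reduce, KerrTM.cross]
  have hL : KerrTM.dot !₂[1, 0] (!₂[0, D₂L] : EuclideanSpace ℝ (Fin 2)) = 0 := by simp [hdot]
  have hR : KerrTM.dot !₂[1, 0] (!₂[0, D₂R] : EuclideanSpace ℝ (Fin 2)) = 0 := by simp [hdot]
  have h1 := KerrTM.Medium.IsTMSolution.ae_dot_eq_zero hω hL hR h
  obtain ⟨h2, h3⟩ := KerrTM.Medium.IsTMSolution.isLiuPSolution hω hL hR h
  simp only [hdot] at h1
  simp only [hred] at h3
  exact ⟨h1, h2, h3, fun W vm hW => KerrTM.Medium.IsLiuPSolution.unique hW h3⟩
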